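/- Fix $d>1$. For integers $n\ge d$, let $\boldsymbol A\in\{0,1\}^{n\times n}$ be the adjacency matrix of the Erdős–Rényi random graph $\mathsf G(n,d/n)$ on $\{1,\dots,n\}$, in which each of the $\binom n2$ pairs of distinct vertices is joined by an edge independently with probability $d/n$. Let $\boldsymbol B\in\mathbb R^{n(n-1)\times n(n-1)}$ be the matrix with rows and columns indexed by the ordered pairs $(i,j)$ of distinct elements of $\{1,\dots,n\}$ and with entries \[ \boldsymbol B\big((i,j),(i',j')\big)=\begin{cases}\boldsymbol A_{i'j'}-\dfrac dn & \text{if } i'=j \text{ and } j'\ne i,\\[1ex] 0 & \text{otherwise.}\end{cases} \] Let $\rho(\boldsymbol B)$ denote the spectral radius of $\boldsymbol B$, i.e. the largest modulus of a complex eigenvalue of $\boldsymbol B$. Then for every $\varepsilon>0$, \[ \mathbb P\big[\rho(\boldsymbol B)\le \sqrt d\,(1+\varepsilon)\big]\longrightarrow 1\qquad\text{as } n\to\infty . \] -/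

import Mathlib

/-- The number `d / n` as a point of `[0, 1]`; it is truncated to `1` for the finitely many `n`
with `n < d`, for which `G(n, d/n)` is not defined. -/
noncomputable def edgeProb (d : ℝ) (n : ℕ) : unitInterval :=
  Set.projIcc (0 : ℝ) 1 zero_le_one (d / n)

theorem edgeProb_coe {d : ℝ} {n : ℕ} (hd : 0 ≤ d) (hn : d ≤ n) :
    (edgeProb d n : ℝ) = d / n := by
  have h : d / n ∈ Set.Icc (0 : ℝ) 1 :=
    ⟨div_nonneg hd n.cast_nonneg, div_le_one_of_le₀ hn n.cast_nonneg⟩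
  rw [edgeProb, Set.projIcc_of_mem zero_le_one h]

/-- Ordered pairs `(i, j)` of distinct vertices: the directed edges of the complete graph on `V`. -/
abbrev OrderedPair (V : Type*) : Type _ := {e : V × V // e.1 ≠ e.2}

/-- The weighted non-backtracking matrix of the complete graph on `V` with edge weights `c`:
the entry at `((i, j), (i', j'))` is `c i' j'` if `i' = j` and `j' ≠ i`, and `0` otherwise. -/
def nonBacktrackingMatrix {V : Type*} [DecidableEq V] (c : V → V → ℝ) :
    Matrix (OrderedPair V) (OrderedPair V) ℝ :=
  Matrix.of fun e f => if f.1.1 = e.1.2 ∧ f.1.2 ≠ e.1.1 then c f.1.1 f.1.2 else 0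

open Classical in
/-- The non-backtracking matrix of the complete graph on `n` vertices with the weights
`A i j - d / n`, where `A` is the adjacency matrix of `G`. -/
noncomputable def centeredNonBacktrackingMatrix (d : ℝ) (n : ℕ) (G : SimpleGraph (Fin n)) :
    Matrix (OrderedPair (Fin n)) (OrderedPair (Fin n)) ℝ :=
  nonBacktrackingMatrix fun i j => G.adjMatrix ℝ i j - d / n

/-- The spectral radius of a real square matrix: the largest modulus of a complex eigenvalue. -/
noncomputable def realMatrixSpectralRadius {ι : Type*} [Fintype ι] [DecidableEq ι]
    (M : Matrix ι ι ℝ) : ENNReal :=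
  spectralRadius ℂ (M.map Complex.ofReal)

/-!
The proof is a version of the trace method for non-backtracking matrices. Let `x` be the centred
edge weights `1[ε ∈ G] - d / n`, let `D` be the diagonal matrix of their values at the directed
edges, and let `T` be the non-backtracking matrix of the complete graph, so that the matrix in
question is `T * D`. Distributing square roots of `|x|` over rows and columns turns `T * D` into a
matrix `b` with the same non-zero eigenvalues (`realMatrixSpectralRadius_le`); it suffices to
bound the norm of `b ^ ℓ` for some `ℓ` of order `log n`.

Call a non-backtracking walk good if it visits at least as many vertices as it has distinct edges,
so that it contains at most one cycle. If `N k` is the matrix of the sums of the weights of the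
good walks with `k + 2` vertices, balanced in the same way, then `N 1 = b` and
`b * N k = N (k + 1) + R (k + 1)`, where `R (k + 1)` collects the tangled walks, which are not
good but become so when their first step is removed (`nbAdj_mul_walkMatrix`). If `‖N k‖` is at
most about `√d ^ k`, and `‖R k‖` is much smaller than `1 / ℓ`, then `‖b ^ ℓ‖` is at most about
`√d ^ ℓ` (`norm_pow_le_of_recursion`).

Both norms are bounded by Markov's inequality from expected traces: of `(N k * (N k)ᵀ) ^ m` with a
large constant `m`, and of `R k * (R k)ᵀ`. These are sums over closed chains of `2 * m` walks. As
the weights are centred, only chains contribute that traverse every edge twice, apart from the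
edges at which two walks meet, and each contributes about `d / n` to the power of the number of
its distinct edges (`integral_trace_le`). So the number of closed chains has to be bounded,
weighted by `1 / n` per distinct edge (`sum_closedChains_le`). The chain is built up walk by walk.
A good walk is self-avoiding or a lasso: a self-avoiding path that closes a cycle, goes around it,
and leaves it along a self-avoiding path (`exists_lasso`). Hence only self-avoiding paths have to
be attached to the piece `S` of the graph that has been visited before. Such a path meets each
vertex of `S` at most once, so that the number of its courses inside `S` is at most the product of
`deg - 1` over the vertices of `S`; this is exponential in the number of edges minus the number of
vertices of `S`, as all but boundedly many vertices of `S` have degree at least two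
(`prod_deg_le`). Such an exponential factor is harmless, because every unit of excess of edges
over vertices is paid for by a factor `1 / n` (`sum_nodup_le`). What remains is polynomial in the
length of the walks, hence in `log n`. The expected trace is thus at most of order
`n * d ^ (m * k)` for good walks, up to logarithms, and `d ^ k / n` for tangled ones, since these
have more edges than vertices. Now `ℓ` is taken to be so small a multiple of `log n` that
`d ^ (4 * ℓ) ≤ n`, and `m` so large that `n ^ (1 / m)` is smaller than `(1 + ε) ^ ℓ`
(`exists_measure_spectralRadius_gt_le`).
-/

open Finset

set_option linter.unusedSectionVars false

namespace NonBacktracking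

/-! ### Walks and their supports -/

section

variable {V : Type*}

/-- The list of edges traversed by a walk, given as the list of its vertices. -/
def edgeList : List V → List (Sym2 V)
  | a :: b :: l => s(a, b) :: edgeList (b :: l)
  | _ => []

@[simp] lemma edgeList_nil : edgeList ([] : List V) = [] := rfl
@[simp] lemma edgeList_singleton (a : V) : edgeList [a] = [] := rfl
@[simp] lemma edgeList_cons_cons (a b : V) (l : List V) :
    edgeList (a :: b :: l) = s(a, b) :: edgeList (b :: l) := rfl

lemma length_edgeList (l : List V) : (edgeList l).length = l.length - 1 := by
  induction l with
  | nil => rfl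
  | cons a l ih =>
    cases l with
    | nil => rfl
    | cons b l => simp [ih]

lemma mem_edgeList {l : List V} {ε : Sym2 V} :
    ε ∈ edgeList l ↔ ∃ t a b, l[t]? = some a ∧ l[t + 1]? = some b ∧ ε = s(a, b) := by
  induction l with
  | nil => simp
  | cons a l ih =>
    cases l with
    | nil => simp
    | cons b l =>
      rw [edgeList_cons_cons, List.mem_cons, ih]
      constructor
      · rintro (rfl | ⟨t, x, y, hx, hy, rfl⟩)
        · exact ⟨0, a, b, by simp, by simp, rfl⟩
        · exact ⟨t + 1, x, y, by simpa using hx, by simpa using hy, rfl⟩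
      · rintro ⟨t, x, y, hx, hy, rfl⟩
        cases t with
        | zero => left; simp at hx hy; rw [hx, hy]
        | succ t => right; exact ⟨t, x, y, by simpa using hx, by simpa using hy, rfl⟩

lemma edgeList_append_pair (l : List V) (a b : V) :
    edgeList (l ++ [a, b]) = edgeList (l ++ [a]) ++ [s(a, b)] := by
  induction l with
  | nil => rfl
  | cons x l ih =>
    cases l with
    | nil => rfl
    | cons y l => simpa using ih

lemma edgeList_reverse (l : List V) : edgeList l.reverse = (edgeList l).reverse := by
  induction l with
  | nil => rfl
  | cons a l ih =>
    cases l with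
    | nil => rfl
    | cons b l =>
      have : (a :: b :: l).reverse = l.reverse ++ [b, a] := by simp
      rw [this, edgeList_append_pair, edgeList_cons_cons, List.reverse_cons, ← ih, Sym2.eq_swap]
      simp

lemma mem_of_mem_edgeList {l : List V} {ε : Sym2 V} (h : ε ∈ edgeList l) {w : V} (hw : w ∈ ε) :
    w ∈ l := by
  obtain ⟨t, a, b, ha, hb, rfl⟩ := mem_edgeList.1 h
  rcases Sym2.mem_iff.1 hw with rfl | rfl
  · exact List.mem_of_getElem? ha
  · exact List.mem_of_getElem? hb

/-- A list of vertices is a non-backtracking walk of the complete graph: consecutive vertices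
differ, and so do vertices two steps apart. -/
def IsNB (l : List V) : Prop :=
  ∀ i j a b, l[i]? = some a → l[j]? = some b → i < j → j ≤ i + 2 → a ≠ b

lemma isNB_cons {a : V} {l : List V} :
    IsNB (a :: l) ↔ (∀ b, l[0]? = some b → a ≠ b) ∧ (∀ b, l[1]? = some b → a ≠ b) ∧ IsNB l := by
  constructor
  · intro h
    refine ⟨fun b hb => h 0 1 a b (by simp) (by simpa using hb) (by simp) (by simp),
      fun b hb => h 0 2 a b (by simp) (by simpa using hb) (by simp) (by simp), ?_⟩
    intro i j x y hx hy hij hji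
    exact h (i + 1) (j + 1) x y (by simpa using hx) (by simpa using hy) (by lia) (by lia)
  · rintro ⟨h0, h1, h⟩ i j x y hx hy hij hji
    obtain ⟨j, rfl⟩ : ∃ k, j = k + 1 := ⟨j - 1, by lia⟩
    cases i with
    | zero =>
      simp only [List.getElem?_cons_zero, Option.some.injEq] at hx
      subst hx
      simp only [List.getElem?_cons_succ] at hy
      have : j = 0 ∨ j = 1 := by lia
      rcases this with rfl | rfl
      · exact h0 _ hy
      · exact h1 _ hy
    | succ i => exact h i j x y (by simpa using hx) (by simpa using hy) (by lia) (by lia)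

lemma IsNB.tail {a : V} {l : List V} (h : IsNB (a :: l)) : IsNB l := (isNB_cons.1 h).2.2

lemma isNB_reverse {l : List V} (h : IsNB l) : IsNB l.reverse := by
  intro i j a b ha hb hij hji
  have hi := (List.getElem?_eq_some_iff.1 ha).1
  have hj := (List.getElem?_eq_some_iff.1 hb).1
  rw [List.length_reverse] at hi hj
  rw [List.getElem?_reverse hi] at ha
  rw [List.getElem?_reverse hj] at hb
  exact (h _ _ _ _ hb ha (by lia) (by lia)).symm

lemma isNB_of_nodup {l : List V} (h : l.Nodup) : IsNB l := by
  intro i j a b ha hb hij _ hab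
  obtain ⟨hi, ha⟩ := List.getElem?_eq_some_iff.1 ha
  obtain ⟨hj, hb⟩ := List.getElem?_eq_some_iff.1 hb
  have := (h.getElem_inj_iff (hi := hi) (hj := hj)).1 (by rw [ha, hb, hab])
  lia

lemma not_isDiag_of_isNB {l : List V} (h : IsNB l) {ε : Sym2 V} (hε : ε ∈ edgeList l) :
    ¬ ε.IsDiag := by
  obtain ⟨t, a, b, ha, hb, rfl⟩ := mem_edgeList.1 hε
  simpa using h _ _ _ _ ha hb (by lia) (by lia)

variable [DecidableEq V]

noncomputable instance (l : List V) : Decidable (IsNB l) := Classical.propDecidable _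

/-- The set of edges traversed by a walk. -/
def walkEdges (l : List V) : Finset (Sym2 V) := (edgeList l).toFinset

lemma mem_walkEdges {l : List V} {ε : Sym2 V} :
    ε ∈ walkEdges l ↔ ∃ t a b, l[t]? = some a ∧ l[t + 1]? = some b ∧ ε = s(a, b) := by
  rw [walkEdges, List.mem_toFinset, mem_edgeList]

@[simp] lemma walkEdges_cons_cons (a b : V) (l : List V) :
    walkEdges (a :: b :: l) = insert s(a, b) (walkEdges (b :: l)) := by
  simp [walkEdges]

@[simp] lemma walkEdges_singleton (a : V) : walkEdges [a] = ∅ := rfl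
@[simp] lemma walkEdges_nil : walkEdges ([] : List V) = ∅ := rfl

@[simp] lemma walkEdges_reverse (l : List V) : walkEdges l.reverse = walkEdges l := by
  simp [walkEdges, edgeList_reverse]

lemma mem_of_mem_walkEdges {l : List V} {ε : Sym2 V} (h : ε ∈ walkEdges l) {w : V} (hw : w ∈ ε) :
    w ∈ l := mem_of_mem_edgeList (by simpa [walkEdges] using h) hw

/-- A finite piece of a graph: a set of vertices and a set of edges. -/
abbrev Piece (V : Type*) := Finset V × Finset (Sym2 V)

/-- The vertices and edges visited by a walk. -/
def supp (l : List V) : Piece V := (l.toFinset, walkEdges l)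

@[simp] lemma supp_reverse (l : List V) : supp l.reverse = supp l := by simp [supp]

lemma supp_cons_cons (a b : V) (l : List V) :
    supp (a :: b :: l) = ({a, b}, {s(a, b)}) ⊔ supp (b :: l) := by
  ext x
  · simp [supp]
  · simp only [supp, walkEdges_cons_cons, Prod.snd_sup, sup_eq_union, mem_union, mem_insert,
      mem_singleton]

/-- The number of edges of `E` at the vertex `w`. -/
def deg (E : Finset (Sym2 V)) (w : V) : ℕ := #{ε ∈ E | w ∈ ε}

lemma deg_mono {E F : Finset (Sym2 V)} (h : E ⊆ F) (w : V) : deg E w ≤ deg F w :=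
  card_le_card (filter_subset_filter _ h)

/-- The invariant of the pieces of a graph swept out by a sequence of walks: edges end at vertices
of the piece, at most `ρ` vertices have degree at most one, and the number of vertices is at most
one more than the number of edges. -/
structure Inv (ρ : ℕ) (S : Piece V) : Prop where
  valid : ∀ ε ∈ S.2, ∀ w ∈ ε, w ∈ S.1
  low : #{w ∈ S.1 | deg S.2 w ≤ 1} ≤ ρ
  conn : #S.1 ≤ #S.2 + 1

lemma valid_sup {S S' : Piece V} (h : ∀ ε ∈ S.2, ∀ w ∈ ε, w ∈ S.1)
    (h' : ∀ ε ∈ S'.2, ∀ w ∈ ε, w ∈ S'.1) : ∀ ε ∈ (S ⊔ S').2, ∀ w ∈ ε, w ∈ (S ⊔ S').1 := by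
  intro ε hε w hw
  simp only [Prod.snd_sup, Prod.fst_sup, sup_eq_union, mem_union] at hε ⊢
  exact hε.imp (fun h1 => h ε h1 w hw) (fun h1 => h' ε h1 w hw)

lemma valid_supp (l : List V) : ∀ ε ∈ (supp l).2, ∀ w ∈ ε, w ∈ (supp l).1 := by
  intro ε hε w hw
  simpa [supp] using mem_of_mem_walkEdges hε hw

lemma excess_step {S : Piece V} (h : ∀ ε ∈ S.2, ∀ w ∈ ε, w ∈ S.1) {a b : V} (ha : a ∈ S.1) :
    #(S ⊔ ({a, b}, {s(a, b)})).1 + #S.2 ≤ #S.1 + #(S ⊔ ({a, b}, {s(a, b)})).2 := by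
  have h1 : (S ⊔ ({a, b}, {s(a, b)})).1 = insert b S.1 := by
    ext x; simp only [Prod.fst_sup, sup_eq_union, mem_union, mem_insert, mem_singleton]
    constructor
    · rintro (h | rfl | rfl) <;> simp [*]
    · rintro (rfl | h) <;> simp [*]
  have h2 : (S ⊔ (({a, b}, {s(a, b)}) : Piece V)).2 = insert s(a, b) S.2 := by
    ext x; simp [or_comm]
  rw [h1, h2]
  by_cases hb : b ∈ S.1
  · rw [insert_eq_of_mem hb]
    have := card_le_card (subset_insert s(a, b) S.2)
    lia
  · have : s(a, b) ∉ S.2 := fun h' => hb (h _ h' b (by simp))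
    rw [card_insert_of_notMem hb, card_insert_of_notMem this]
    lia

/-- Walking along from a vertex of a piece adds at least as many edges as vertices. -/
lemma excess_supp {l : List V} : ∀ {S : Piece V} {a : V} (_ : ∀ ε ∈ S.2, ∀ w ∈ ε, w ∈ S.1)
    (_ : a ∈ S.1), #(S ⊔ supp (a :: l)).1 + #S.2 ≤ #S.1 + #(S ⊔ supp (a :: l)).2 := by
  induction l with
  | nil =>
    intro S a _ ha
    have : S.1 ∪ {a} = S.1 := by simpa using ha
    simp [supp, this]
  | cons b l ih =>
    intro S a h ha
    have h1 := excess_step h (b := b) ha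
    have h2 := ih (S := S ⊔ ({a, b}, {s(a, b)})) (a := b)
      (valid_sup h (by simp)) (by simp)
    rw [supp_cons_cons, ← sup_assoc]
    lia

/-- A non-backtracking walk has at least two edges at each of its vertices, apart from its ends. -/
lemma two_le_deg {l : List V} (h : IsNB l) {w : V} (hw : w ∈ l) (h0 : l.head? ≠ some w)
    (h1 : l.getLast? ≠ some w) : 2 ≤ deg (walkEdges l) w := by
  obtain ⟨t, ht⟩ := List.mem_iff_getElem?.1 hw
  have htl := (List.getElem?_eq_some_iff.1 ht).1
  have ht0 : t ≠ 0 := by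
    rintro rfl; rw [List.head?_eq_getElem?] at h0; exact h0 ht
  have ht1 : t + 1 < l.length := by
    by_contra hc
    rw [List.getLast?_eq_getElem?] at h1
    have : l.length - 1 = t := by lia
    rw [this] at h1; exact h1 ht
  obtain ⟨t, rfl⟩ : ∃ k, t = k + 1 := ⟨t - 1, by lia⟩
  have hx : l[t]? = some l[t] := List.getElem?_eq_getElem (by lia)
  have hy : l[t + 1 + 1]? = some l[t + 1 + 1] := List.getElem?_eq_getElem (by lia)
  have hxy := h _ _ _ _ hx hy (by lia) (by lia)
  have hne : s(l[t], w) ≠ s(w, l[t + 1 + 1]) := by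
    rw [Sym2.eq_swap]
    intro h'
    exact hxy (Sym2.congr_right.1 h')
  rw [deg, ← card_pair hne]
  apply card_le_card
  intro ε hε
  rw [mem_insert, mem_singleton] at hε
  rcases hε with rfl | rfl
  · simp only [mem_filter, Sym2.mem_iff, or_true, and_true]
    exact mem_walkEdges.2 ⟨t, _, _, hx, ht, rfl⟩
  · simp only [mem_filter, Sym2.mem_iff, true_or, and_true]
    exact mem_walkEdges.2 ⟨t + 1, _, _, ht, hy, rfl⟩

lemma low_sup_supp {S : Piece V} {l : List V} (h : IsNB l) :
    #{w ∈ (S ⊔ supp l).1 | deg (S ⊔ supp l).2 w ≤ 1} ≤ #{w ∈ S.1 | deg S.2 w ≤ 1} + 2 := by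
  have hs : ({w ∈ (S ⊔ supp l).1 | deg (S ⊔ supp l).2 w ≤ 1} : Finset V) ⊆
      {w ∈ S.1 | deg S.2 w ≤ 1} ∪ (l.head?.toFinset ∪ l.getLast?.toFinset) := by
    intro w hw
    simp only [mem_filter, Prod.fst_sup, sup_eq_union, mem_union, Prod.snd_sup] at hw
    obtain ⟨hw, hd⟩ := hw
    simp only [mem_union, mem_filter, Option.mem_toFinset, Option.mem_def]
    by_contra hc
    push Not at hc
    rcases hw with hw | hw
    · have := hc.1 hw
      have := deg_mono (subset_union_left (s₁ := S.2) (s₂ := (supp l).2)) w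
      lia
    · have := two_le_deg h (by simpa [supp] using hw) hc.2.1 hc.2.2
      have := deg_mono (subset_union_right (s₁ := S.2) (s₂ := (supp l).2)) w
      simp only [supp] at *
      lia
  refine (card_le_card hs).trans ((card_union_le _ _).trans ?_)
  have h1 := card_union_le l.head?.toFinset l.getLast?.toFinset
  have h2 : #(l.head?.toFinset) ≤ 1 := by cases l.head? <;> simp
  have h3 : #(l.getLast?.toFinset) ≤ 1 := by cases l.getLast? <;> simp
  lia

/-- Attaching a non-backtracking walk at one of its ends creates at most two vertices of low degree,
and does not lower the excess. -/
lemma Inv.sup_supp {ρ : ℕ} {S : Piece V} (hS : Inv ρ S) {l : List V} (h : IsNB l) {a : V}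
    (ha : l.head? = some a ∨ l.getLast? = some a) (haS : a ∈ S.1) : Inv (ρ + 2) (S ⊔ supp l) where
  valid := valid_sup hS.valid (valid_supp l)
  low := (low_sup_supp h).trans (by have := hS.low; lia)
  conn := by
    have key : ∀ l : List V, l.head? = some a →
        #(S ⊔ supp l).1 + #S.2 ≤ #S.1 + #(S ⊔ supp l).2 := by
      intro l hl
      cases l with
      | nil => simp at hl
      | cons b l =>
        simp only [List.head?_cons, Option.some.injEq] at hl
        subst hl
        exact excess_supp hS.valid haS
    have hc := hS.conn
    rcases ha with ha | ha
    · have := key l ha; lia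
    · have := key l.reverse (by simpa using ha)
      rw [supp_reverse] at this
      lia

lemma Inv.singleton (u : V) : Inv 1 (({u}, ∅) : Piece V) where
  valid := by simp
  low := (card_filter_le _ _).trans (by simp)
  conn := by simp

lemma sum_deg_le {S : Piece V} : ∑ w ∈ S.1, deg S.2 w ≤ 2 * #S.2 := by
  simp only [deg, card_filter]
  rw [sum_comm]
  rw [mul_comm, ← smul_eq_mul]
  refine sum_le_card_nsmul _ _ _ fun ε _ => ?_
  rw [← card_filter]
  induction ε with
  | h x y =>
    refine (card_le_card (t := {x, y}) ?_).trans (card_le_two)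
    intro w hw
    simpa using (mem_filter.1 hw).2

/-- The product of the numbers of non-backtracking continuations over the vertices of a piece is
exponential in the excess and the number of low-degree vertices only: a vertex of degree `d ≥ 2`
contributes at most `2 ^ (d - 2)`, and the degrees add up to twice the number of edges. -/
lemma prod_deg_le {ρ : ℕ} {S : Piece V} (hS : Inv ρ S) :
    (∏ w ∈ S.1, max (deg S.2 w - 1) 1) * 4 ^ #S.1 ≤ 4 ^ (#S.2 + ρ) := by
  have h1 : ∀ d : ℕ, max (d - 1) 1 * 4 ≤ 2 ^ (d + if d ≤ 1 then 2 else 0) := by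
    intro d
    rcases Nat.lt_or_ge d 2 with hd | hd
    · interval_cases d <;> simp
    · obtain ⟨k, rfl⟩ := Nat.exists_eq_add_of_le hd
      have : k + 1 ≤ 2 ^ k := Nat.lt_two_pow_self
      rw [if_neg (by lia), max_eq_left (by lia), add_zero, pow_add]
      have : 2 + k - 1 = k + 1 := by lia
      rw [this]
      lia
  calc (∏ w ∈ S.1, max (deg S.2 w - 1) 1) * 4 ^ #S.1
      = ∏ w ∈ S.1, (max (deg S.2 w - 1) 1 * 4) := by rw [prod_mul_distrib, prod_const]
    _ ≤ ∏ w ∈ S.1, 2 ^ (deg S.2 w + if deg S.2 w ≤ 1 then 2 else 0) :=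
        prod_le_prod' fun w _ => h1 _
    _ = 2 ^ (∑ w ∈ S.1, deg S.2 w + 2 * #{w ∈ S.1 | deg S.2 w ≤ 1}) := by
        rw [prod_pow_eq_pow_sum, sum_add_distrib, ← sum_filter, sum_const, smul_eq_mul, mul_comm 2]
    _ ≤ 2 ^ (2 * (#S.2 + ρ)) := by
        refine Nat.pow_le_pow_right (by norm_num) ?_
        have := sum_deg_le (S := S)
        have := hS.low
        lia
    _ = 4 ^ (#S.2 + ρ) := by rw [pow_mul]; norm_num

end

/-! ### Enumeration of paths -/

section

section ListsOf

variable {α : Type*}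

/-- The lists of length `k` with entries in `s`. -/
def listsOf (s : Finset α) : ℕ → Finset (List α)
  | 0 => {[]}
  | k + 1 => (s ×ˢ listsOf s k).map
      ⟨fun p => p.1 :: p.2, fun _ _ h => Prod.ext (List.cons.inj h).1 (List.cons.inj h).2⟩

lemma mem_listsOf {s : Finset α} {k : ℕ} {l : List α} :
    l ∈ listsOf s k ↔ l.length = k ∧ ∀ x ∈ l, x ∈ s := by
  induction k generalizing l with
  | zero =>
    rw [listsOf, mem_singleton, List.length_eq_zero_iff]
    constructor
    · rintro rfl; simp
    · exact fun h => h.1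
  | succ k ih =>
    cases l with
    | nil => simp [listsOf]
    | cons a l =>
      simp only [listsOf, mem_map, mem_product, ih, Prod.exists, List.length_cons, add_left_inj,
        List.mem_cons, forall_eq_or_imp]
      constructor
      · rintro ⟨_, _, ⟨h1, h2, h3⟩, h⟩
        obtain ⟨rfl, rfl⟩ := List.cons.inj h
        exact ⟨h2, h1, h3⟩
      · rintro ⟨h1, h2, h3⟩
        exact ⟨a, l, ⟨h2, h1, h3⟩, rfl⟩

@[simp] lemma mem_listsOf_univ [Fintype α] {k : ℕ} {l : List α} :
    l ∈ listsOf univ k ↔ l.length = k := by simp [mem_listsOf]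

lemma sum_listsOf_succ {M : Type*} [AddCommMonoid M] (s : Finset α) (k : ℕ) (f : List α → M) :
    ∑ l ∈ listsOf s (k + 1), f l = ∑ a ∈ s, ∑ l ∈ listsOf s k, f (a :: l) := by
  rw [listsOf, sum_map, sum_product]
  rfl

end ListsOf

variable {V : Type*} [DecidableEq V] [Fintype V]

/-- The weight `(n y)⁻¹ ^ v * y ^ e` of a piece with `v` vertices and `e` edges, where `n` is the
number of all vertices: it is `n ^ (-v) * y ^ (e - v)`. -/
noncomputable def weight (y : ℝ) (S : Piece V) : ℝ :=
  ((Fintype.card V : ℝ) * y)⁻¹ ^ #S.1 * y ^ #S.2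

lemma weight_pos [Nonempty V] {y : ℝ} (hy : 0 < y) (S : Piece V) : 0 < weight y S := by
  have : (0 : ℝ) < Fintype.card V := by exact_mod_cast Fintype.card_pos
  unfold weight; positivity

/-- The factor by which the weight of the piece `S` changes when a walk steps from `a` to `b`. -/
noncomputable def stepWeight (y : ℝ) (S : Piece V) (a b : V) : ℝ :=
  if b ∈ S.1 then (if s(a, b) ∈ S.2 then 1 else y) else (Fintype.card V : ℝ)⁻¹

/-- The product of the step weights along a walk. -/
noncomputable def pathWeight (y : ℝ) (S : Piece V) : V → List V → ℝ
  | _, [] => 1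
  | a, b :: l => stepWeight y S a b * pathWeight y S b l

/-- The sum of the path weights over the self-avoiding paths with `k` steps that start at `a` and
avoid `P`. -/
noncomputable def pathSum (y : ℝ) (S : Piece V) : ℕ → V → Finset V → ℝ
  | 0, _, _ => 1
  | k + 1, a, P => ∑ b with b ≠ a ∧ b ∉ P, stepWeight y S a b * pathSum y S k b (insert a P)

lemma pathSum_eq (y : ℝ) (S : Piece V) (k : ℕ) : ∀ (a : V) (P : Finset V),
    ∑ l ∈ listsOf univ k, (if (a :: l).Nodup ∧ ∀ x ∈ l, x ∉ P then pathWeight y S a l else 0) =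
      pathSum y S k a P := by
  induction k with
  | zero => intro a P; simp [listsOf, pathWeight, pathSum]
  | succ k ih =>
    intro a P
    rw [sum_listsOf_succ, pathSum, sum_filter]
    refine sum_congr rfl fun b _ => ?_
    by_cases hb : b ≠ a ∧ b ∉ P
    · rw [if_pos hb, ← ih, mul_sum]
      refine sum_congr rfl fun l _ => ?_
      rw [mul_ite, mul_zero, pathWeight]
      refine if_congr ?_ rfl rfl
      simp only [List.nodup_cons, List.mem_cons, not_or, forall_eq_or_imp, mem_insert]
      constructor
      · rintro ⟨⟨⟨h1, h2⟩, h3, h4⟩, h5, h6⟩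
        exact ⟨⟨h3, h4⟩, fun x hx => ⟨fun h => h2 (h ▸ hx), h6 x hx⟩⟩
      · rintro ⟨⟨h3, h4⟩, h6⟩
        exact ⟨⟨⟨hb.1.symm, fun h => (h6 a h).1 rfl⟩, h3, h4⟩, hb.2, fun x hx => (h6 x hx).2⟩
    · rw [if_neg hb]
      refine sum_eq_zero fun l _ => if_neg ?_
      rintro ⟨h1, h2⟩
      refine hb ⟨?_, h2 b (by simp)⟩
      rintro rfl
      simp at h1

lemma weight_sup_supp [Nonempty V] {y : ℝ} (hy : 0 < y) {S : Piece V}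
    (hS : ∀ ε ∈ S.2, ∀ w ∈ ε, w ∈ S.1) {l : List V} {a : V} (ha : a ∈ S.1) (hl : (a :: l).Nodup) :
    weight y (S ⊔ supp (a :: l)) = weight y S * pathWeight y S a l := by
  have hn : (0 : ℝ) < Fintype.card V := by exact_mod_cast Fintype.card_pos
  have key : ∀ (l : List V) (a : V), (a :: l).Nodup →
      weight y (S.1 ∪ l.toFinset, S.2 ∪ walkEdges (a :: l)) =
        weight y S * pathWeight y S a l := by
    intro l
    induction l with
    | nil => intro a _; simp [pathWeight]
    | cons b l ih =>
      intro a hl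
      have hbl := (List.nodup_cons.1 hl).2
      have hab : a ∉ b :: l := (List.nodup_cons.1 hl).1
      have hb : b ∉ l := (List.nodup_cons.1 hbl).1
      have hbe : s(a, b) ∉ walkEdges (b :: l) := fun h =>
        hab (mem_of_mem_walkEdges h (by simp))
      have h1 : S.1 ∪ (b :: l).toFinset = insert b (S.1 ∪ l.toFinset) := by
        rw [List.toFinset_cons, union_insert]
      have h2 : S.2 ∪ walkEdges (a :: b :: l) = insert s(a, b) (S.2 ∪ walkEdges (b :: l)) := by
        rw [walkEdges_cons_cons, union_insert]
      rw [pathWeight, mul_left_comm, ← ih b hbl, h1, h2, stepWeight]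
      by_cases hbS : b ∈ S.1
      · rw [if_pos hbS, insert_eq_of_mem (mem_union_left _ hbS)]
        by_cases hE : s(a, b) ∈ S.2
        · rw [if_pos hE, insert_eq_of_mem (mem_union_left _ hE), one_mul]
        · have : s(a, b) ∉ S.2 ∪ walkEdges (b :: l) := by simp [hE, hbe]
          rw [if_neg hE]
          simp only [weight, card_insert_of_notMem this]
          ring
      · have hE : s(a, b) ∉ S.2 := fun h => hbS (hS _ h b (by simp))
        have h3 : s(a, b) ∉ S.2 ∪ walkEdges (b :: l) := by simp [hE, hbe]
        have h4 : b ∉ S.1 ∪ l.toFinset := by simp [hbS, hb]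
        rw [if_neg hbS]
        simp only [weight, card_insert_of_notMem h3, card_insert_of_notMem h4, pow_succ]
        have : ((Fintype.card V : ℝ) * y)⁻¹ * y = (Fintype.card V : ℝ)⁻¹ := by field_simp
        rw [← this]
        ring
  rw [← key l a hl]
  congr 1
  ext x
  · simp only [supp, Prod.fst_sup, sup_eq_union, List.toFinset_cons, mem_union, mem_insert]
    constructor
    · rintro (h | rfl | h) <;> simp [*]
    · rintro (h | h) <;> simp [*]
  · simp [supp]

/-- The number of ways to continue a self-avoiding path inside `S`, outside of `P`. -/
noncomputable def degProd (S : Piece V) (P : Finset V) : ℝ :=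
  ∏ w ∈ S.1 \ P, ((max (deg S.2 w - 1) 1 : ℕ) : ℝ)

lemma one_le_degFactor (S : Piece V) (w : V) : (1 : ℝ) ≤ ((max (deg S.2 w - 1) 1 : ℕ) : ℝ) := by
  exact_mod_cast le_max_right _ _

lemma degProd_pos (S : Piece V) (P : Finset V) : 0 < degProd S P :=
  prod_pos fun w _ => zero_lt_one.trans_le (one_le_degFactor S w)

lemma degProd_eq {S : Piece V} {P : Finset V} {a : V} (ha : a ∈ S.1) (haP : a ∉ P) :
    degProd S P = ((max (deg S.2 a - 1) 1 : ℕ) : ℝ) * degProd S (insert a P) := by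
  have : S.1 \ P = insert a (S.1 \ insert a P) := by
    ext x
    simp only [mem_sdiff, mem_insert, not_or]
    constructor
    · rintro ⟨h1, h2⟩
      by_cases hx : x = a
      · exact .inl hx
      · exact .inr ⟨h1, hx, h2⟩
    · rintro (rfl | ⟨h1, _, h2⟩)
      · exact ⟨ha, haP⟩
      · exact ⟨h1, h2⟩
  rw [degProd, this, prod_insert (by simp), degProd]

lemma degProd_insert_le {S : Piece V} {P : Finset V} {a : V} :
    degProd S (insert a P) ≤ degProd S P := by
  by_cases h : a ∈ S.1 ∧ a ∉ P
  · rw [degProd_eq h.1 h.2]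
    exact le_mul_of_one_le_left (degProd_pos _ _).le (one_le_degFactor S a)
  · have : S.1 \ insert a P = S.1 \ P := by
      ext x
      simp only [mem_sdiff, mem_insert, not_or]
      constructor
      · rintro ⟨h1, _, h2⟩; exact ⟨h1, h2⟩
      · rintro ⟨h1, h2⟩
        refine ⟨h1, ?_, h2⟩
        rintro rfl
        exact h ⟨h1, h2⟩
    rw [degProd, this, degProd]

/-- Having come from `c` along an edge of `S`, a path has at most `deg - 1` old edges to go on. -/
lemma card_old_lt (S : Piece V) {a c : V} {P : Finset V} (hc : c ∈ P) (hac : s(a, c) ∈ S.2) :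
    #{b ∈ S.1 | (b ≠ a ∧ b ∉ P) ∧ s(a, b) ∈ S.2} + 1 ≤ deg S.2 a := by
  have hc' : c ∉ ({b ∈ S.1 | (b ≠ a ∧ b ∉ P) ∧ s(a, b) ∈ S.2} : Finset V) := by simp [hc]
  rw [← card_insert_of_notMem hc']
  refine card_le_card_of_injOn (fun b => s(a, b)) ?_ ?_
  · intro b hb
    simp only [coe_insert, coe_filter, Set.mem_insert_iff, Set.mem_ofPred_eq] at hb
    rcases hb with rfl | hb
    · simp [hac]
    · simp [hb.2.2]
  · intro b _ b' _ h
    exact Sym2.congr_right.1 h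

/-- Bounds on sums over self-avoiding paths, according to where the path starts. A path at a vertex
of the piece `S` that it has reached along an edge of `S` has at most `deg - 1` ways to go on inside
`S`, and a path never meets a vertex twice, so that these factors multiply to at most `degProd`. The
weight `y` pays for each return to `S` along a new edge. -/
lemma pathSum_le [Nonempty V] {y L : ℝ} (hy : 0 < y) (hL : 1 ≤ L) {S : Piece V}
    (hS : ∀ ε ∈ S.2, ∀ w ∈ ε, w ∈ S.1) (hyL : y * (3 * L ^ 4) ≤ 1) (hSL : (#S.1 : ℝ) ≤ L) (k : ℕ)
    (hk : (k : ℝ) + 1 ≤ L) :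
    ∀ (a : V) (P : Finset V), a ∉ P →
      (a ∈ S.1 → (∃ c ∈ P, s(a, c) ∈ S.2) → pathSum y S k a P ≤ degProd S P * (3 * (k + 1))) ∧
      (a ∈ S.1 → pathSum y S k a P ≤ degProd S P * (L * (3 * (k + 1)))) ∧
      (a ∉ S.1 → pathSum y S k a P ≤ degProd S P * (1 + k / L)) := by
  have hn : (0 : ℝ) < Fintype.card V := by exact_mod_cast Fintype.card_pos
  induction k with
  | zero =>
    intro a P _
    have := degProd_pos S P
    simp only [pathSum, CharP.cast_eq_zero, zero_add, mul_one, zero_div, add_zero]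
    have h1 : 1 ≤ degProd S P := by
      have : 0 < ∏ w ∈ S.1 \ P, max (deg S.2 w - 1) 1 := prod_pos fun w _ => by lia
      rw [degProd, ← Nat.cast_prod]
      exact_mod_cast this
    refine ⟨fun _ _ => by linarith, fun _ => ?_, fun _ => h1⟩
    nlinarith
  | succ k ih =>
    intro a P haP
    push_cast at hk
    have ih' := ih (by linarith)
    have hk0 : (0 : ℝ) ≤ k := k.cast_nonneg
    set D := degProd S (insert a P) with hD
    have hD0 : 0 < D := degProd_pos _ _
    have hDP : D ≤ degProd S P := degProd_insert_le
    have hDP0 := degProd_pos S P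
    set N := #{b ∈ S.1 | (b ≠ a ∧ b ∉ P) ∧ s(a, b) ∈ S.2} with hN
    -- split the sum according to whether the step stays in `S` along an old edge, stays in `S`
    -- along a new edge, or leaves `S`
    have main : pathSum y S (k + 1) a P ≤
        N * (D * (3 * (k + 1))) + L * (y * (D * (L * (3 * (k + 1))))) + D * (1 + k / L) := by
      rw [pathSum]
      have hb : ∀ b ∈ ({b | b ≠ a ∧ b ∉ P} : Finset V),
          stepWeight y S a b * pathSum y S k b (insert a P) ≤
            (if b ∈ S.1 ∧ s(a, b) ∈ S.2 then D * (3 * (k + 1)) else 0) +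
            (if b ∈ S.1 then y * (D * (L * (3 * (k + 1)))) else 0) +
            (Fintype.card V : ℝ)⁻¹ * (D * (1 + k / L)) := by
        intro b hb
        simp only [mem_filter, mem_univ, true_and] at hb
        obtain ⟨i1, i2, i3⟩ := ih' b (insert a P) (by simp [hb.1, hb.2])
        have p1 : 0 ≤ (Fintype.card V : ℝ)⁻¹ * (D * (1 + k / L)) := by positivity
        have p2 : 0 ≤ y * (D * (L * (3 * (k + 1)))) := by positivity
        unfold stepWeight
        by_cases hbS : b ∈ S.1
        · by_cases hE : s(a, b) ∈ S.2
          · have := i1 hbS ⟨a, by simp, by rwa [Sym2.eq_swap]⟩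
            simp only [hbS, hE, if_true, and_self, one_mul]
            linarith
          · have := mul_le_mul_of_nonneg_left (i2 hbS) hy.le
            simp only [hbS, hE, if_true, if_false, and_false, zero_add]
            linarith
        · have := mul_le_mul_of_nonneg_left (i3 hbS) (inv_nonneg.2 hn.le)
          simp only [hbS, if_false, false_and, zero_add]
          exact this
      refine (sum_le_sum hb).trans ?_
      rw [sum_add_distrib, sum_add_distrib]
      refine add_le_add (add_le_add ?_ ?_) ?_
      · rw [← sum_filter, sum_const, nsmul_eq_mul]
        refine mul_le_mul_of_nonneg_right ?_ (by positivity)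
        rw [hN]
        exact_mod_cast card_le_card fun b hb => by
          simp only [mem_filter, mem_univ, true_and] at hb ⊢
          exact ⟨hb.2.1, hb.1, hb.2.2⟩
      · rw [← sum_filter, sum_const, nsmul_eq_mul]
        refine mul_le_mul_of_nonneg_right (le_trans ?_ hSL) (by positivity)
        exact_mod_cast card_le_card fun b hb => (mem_filter.1 hb).2
      · rw [sum_const, nsmul_eq_mul, ← mul_assoc]
        have : ((#({b | b ≠ a ∧ b ∉ P} : Finset V) : ℕ) : ℝ) * (Fintype.card V : ℝ)⁻¹ ≤ 1 := by
          rw [← div_eq_mul_inv, div_le_one hn]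
          exact_mod_cast card_le_univ _
        have h0 : 0 ≤ D * (1 + k / L) := by positivity
        nlinarith
    have hL0 : 0 < L := by linarith
    have hkL : (k : ℝ) / L ≤ 1 := by rw [div_le_one hL0]; linarith
    -- the contribution of the returns to `S` along new edges
    have hret : L * (y * (D * (L * (3 * (k + 1))))) ≤ D * (1 / L) := by
      have h1 : y * (3 * L ^ 4) * (1 / L) ≤ 1 / L :=
        mul_le_of_le_one_left (by positivity) hyL
      have h2 : L * (y * (L * (3 * (k + 1)))) ≤ y * (3 * L ^ 4) * (1 / L) := by
        have : y * (3 * L ^ 4) * (1 / L) = y * (3 * L ^ 3) := by field_simp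
        rw [this]
        have : (k : ℝ) + 1 ≤ L := by linarith
        calc L * (y * (L * (3 * (k + 1)))) = y * (3 * L ^ 2 * (k + 1)) := by ring
          _ ≤ y * (3 * L ^ 2 * L) := by gcongr
          _ = y * (3 * L ^ 3) := by ring
      calc L * (y * (D * (L * (3 * (k + 1))))) = D * (L * (y * (L * (3 * (k + 1))))) := by ring
        _ ≤ D * (1 / L) := by gcongr; exact h2.trans h1
    have h1L : 1 / L ≤ 1 := by rw [div_le_one hL0]; exact hL
    have hrest : L * (y * (D * (L * (3 * (k + 1))))) + D * (1 + k / L) ≤ D * 3 := by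
      calc _ ≤ D * (1 / L) + D * (1 + k / L) := by gcongr
        _ = D * (1 / L + 1 + k / L) := by ring
        _ ≤ D * 3 := by gcongr; linarith
    refine ⟨fun ha hc => ?_, fun ha => ?_, fun ha => ?_⟩
    · obtain ⟨c, hcP, hac⟩ := hc
      have hcard := card_old_lt S (a := a) hcP hac
      have hNf : (N : ℝ) ≤ ((max (deg S.2 a - 1) 1 : ℕ) : ℝ) := by
        have : N ≤ max (deg S.2 a - 1) 1 := le_max_of_le_left (by lia)
        exact_mod_cast this
      have h1 : N * (D * (3 * (k + 1))) ≤ degProd S P * (3 * (k + 1)) := by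
        rw [degProd_eq ha haP, mul_assoc, ← hD]
        gcongr
      push_cast
      nlinarith
    · have hNL : (N : ℝ) ≤ L := by
        refine le_trans ?_ hSL
        exact_mod_cast card_filter_le _ _
      have h1 : N * (D * (3 * (k + 1))) ≤ L * (degProd S P * (3 * (k + 1))) := by gcongr
      have h2 : D * 3 ≤ L * (degProd S P * 3) := by nlinarith
      push_cast
      nlinarith
    · have hN0 : N = 0 := by
        rw [hN, card_eq_zero, filter_eq_empty_iff]
        exact fun b _ h => ha (hS _ h.2 a (by simp))
      rw [hN0, Nat.cast_zero, zero_mul, zero_add] at main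
      calc pathSum y S (k + 1) a P ≤ D * (1 / L) + D * (1 + k / L) := by linarith
        _ = D * (1 + (k + 1) / L) := by ring
        _ ≤ degProd S P * (1 + ((k + 1 : ℕ) : ℝ) / L) := by push_cast; gcongr

/-- The weight gained by a self-avoiding path attached to a piece is compensated by a constant and
by a fourfold increase of the parameter `y`. -/
lemma sum_nodup_le [Nonempty V] {y L : ℝ} (hy : 0 < y) (hL : 1 ≤ L) {S : Piece V} {ρ : ℕ}
    (hS : Inv ρ S) (hyL : y * (3 * L ^ 4) ≤ 1) (hSL : (#S.1 : ℝ) ≤ L) (k : ℕ) (hk : (k : ℝ) ≤ L) :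
    ∑ l ∈ listsOf univ k with l.Nodup ∧ ∃ a ∈ S.1, l.head? = some a, weight y (S ⊔ supp l) ≤
      4 ^ ρ * (3 * L ^ 3) * weight (4 * y) S := by
  have hn : (0 : ℝ) < Fintype.card V := by exact_mod_cast Fintype.card_pos
  have hpos : 0 < weight (4 * y) S := weight_pos (by positivity) _
  cases k with
  | zero =>
    rw [sum_eq_zero (s := filter _ _)]
    · positivity
    · intro l hl
      simp only [listsOf, mem_filter, mem_singleton] at hl
      obtain ⟨rfl, _, a, _, ha⟩ := hl
      simp at ha
  | succ k =>
    push_cast at hk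
    have hdeg : weight y S * degProd S ∅ ≤ 4 ^ ρ * weight (4 * y) S := by
      have h1 : degProd S ∅ * 4 ^ #S.1 ≤ 4 ^ (#S.2 + ρ) := by
        rw [degProd, sdiff_empty]
        exact_mod_cast prod_deg_le hS
      have h2 : weight y S = ((Fintype.card V : ℝ) * (4 * y))⁻¹ ^ #S.1 * y ^ #S.2 * 4 ^ #S.1 := by
        rw [weight, mul_right_comm, ← mul_pow]
        congr 2
        field_simp
      rw [h2, weight, mul_assoc _ ((4 : ℝ) ^ #S.1), mul_comm ((4 : ℝ) ^ #S.1)]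
      calc _ ≤ ((Fintype.card V : ℝ) * (4 * y))⁻¹ ^ #S.1 * y ^ #S.2 * 4 ^ (#S.2 + ρ) := by gcongr
        _ = _ := by rw [mul_pow, pow_add]; ring
    have hcard : ((#S.1 : ℕ) : ℝ) * (L * (3 * (k + 1))) ≤ 3 * L ^ 3 := by
      calc ((#S.1 : ℕ) : ℝ) * (L * (3 * (k + 1))) ≤ L * (L * (3 * L)) := by gcongr
        _ = 3 * L ^ 3 := by ring
    calc _ = ∑ a, ∑ l ∈ listsOf univ k,
          if (a :: l).Nodup ∧ a ∈ S.1 then weight y (S ⊔ supp (a :: l)) else 0 := by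
          rw [sum_filter, sum_listsOf_succ]
          refine sum_congr rfl fun a _ => sum_congr rfl fun l _ => if_congr ?_ rfl rfl
          simp
      _ = ∑ a ∈ S.1, weight y S * pathSum y S k a ∅ := by
          rw [← sum_filter_add_sum_filter_not univ (fun a => a ∈ S.1)]
          rw [sum_eq_zero (s := filter (fun a => a ∉ S.1) univ), add_zero]
          · rw [filter_mem_eq_inter, univ_inter]
            refine sum_congr rfl fun a ha => ?_
            rw [← pathSum_eq, mul_sum]
            refine sum_congr rfl fun l _ => ?_
            by_cases h : (a :: l).Nodup
            · rw [if_pos ⟨h, ha⟩, if_pos ⟨h, by simp⟩, weight_sup_supp hy hS.valid ha h]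
            · rw [if_neg (fun h' => h h'.1), if_neg (fun h' => h h'.1), mul_zero]
          · intro a ha
            refine sum_eq_zero fun l _ => if_neg fun h => (mem_filter.1 ha).2 h.2
      _ ≤ ∑ _a ∈ S.1, weight y S * (degProd S ∅ * (L * (3 * (k + 1)))) := by
          refine sum_le_sum fun a ha => mul_le_mul_of_nonneg_left ?_ (weight_pos hy S).le
          exact (pathSum_le hy hL hS.valid hyL hSL k hk a ∅ (by simp)).2.1 ha
      _ = weight y S * degProd S ∅ * (#S.1 * (L * (3 * (k + 1)))) := by
          rw [sum_const, nsmul_eq_mul]; ring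
      _ ≤ 4 ^ ρ * weight (4 * y) S * (3 * L ^ 3) := by
          refine mul_le_mul hdeg hcard (by positivity) (by positivity)
      _ = _ := by ring

end

/-! ### Lassos -/

section

variable {V : Type*} [DecidableEq V]

section Excess

/-- The vertices visited by the sequence `f` at the times `a, …, b`. -/
def timeVerts (f : ℕ → V) (a b : ℕ) : Finset V := (Icc a b).image f

/-- The edges traversed by the sequence `f` between the times `a` and `b`. -/
def timeEdges (f : ℕ → V) (a b : ℕ) : Finset (Sym2 V) :=
  (Ico a b).image fun t => s(f t, f (t + 1))

variable {f : ℕ → V}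

lemma mem_timeVerts {a b : ℕ} {w : V} : w ∈ timeVerts f a b ↔ ∃ t, (a ≤ t ∧ t ≤ b) ∧ f t = w := by
  simp [timeVerts]

lemma mem_timeEdges {a b : ℕ} {ε : Sym2 V} :
    ε ∈ timeEdges f a b ↔ ∃ t, (a ≤ t ∧ t < b) ∧ s(f t, f (t + 1)) = ε := by
  simp [timeEdges]

lemma timeVerts_succ {a b : ℕ} (h : a ≤ b) :
    timeVerts f a (b + 1) = insert (f (b + 1)) (timeVerts f a b) := by
  rw [timeVerts, timeVerts, ← image_insert]
  congr 1
  ext t; simp; lia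

lemma timeEdges_succ {a b : ℕ} (h : a ≤ b) :
    timeEdges f a (b + 1) = insert s(f b, f (b + 1)) (timeEdges f a b) := by
  rw [timeEdges, timeEdges, ← image_insert (fun t => s(f t, f (t + 1)))]
  congr 1
  ext t; simp; lia

lemma timeVerts_left {a b : ℕ} (h : a + 1 ≤ b) :
    timeVerts f a b = insert (f a) (timeVerts f (a + 1) b) := by
  rw [timeVerts, timeVerts, ← image_insert]
  congr 1
  ext t; simp; lia

lemma timeEdges_left {a b : ℕ} (h : a + 1 ≤ b) :
    timeEdges f a b = insert s(f a, f (a + 1)) (timeEdges f (a + 1) b) := by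
  rw [timeEdges, timeEdges, ← image_insert (fun t => s(f t, f (t + 1)))]
  congr 1
  ext t; simp; lia

lemma mem_timeVerts_of_mem_timeEdges {a b : ℕ} {ε : Sym2 V} (h : ε ∈ timeEdges f a b) {w : V}
    (hw : w ∈ ε) : w ∈ timeVerts f a b := by
  obtain ⟨t, ⟨h1, h2⟩, rfl⟩ := mem_timeEdges.1 h
  rcases Sym2.mem_iff.1 hw with rfl | rfl
  · exact mem_timeVerts.2 ⟨t, ⟨h1, h2.le⟩, rfl⟩
  · exact mem_timeVerts.2 ⟨t + 1, ⟨by lia, by lia⟩, rfl⟩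

lemma card_insert_excess {A : Finset V} {B : Finset (Sym2 V)}
    (h : ∀ ε ∈ B, ∀ w ∈ ε, w ∈ A) (x y : V) :
    #B + #(insert x A) ≤ #(insert s(x, y) B) + #A := by
  by_cases hx : x ∈ A
  · rw [insert_eq_of_mem hx]
    have := card_le_card (subset_insert s(x, y) B)
    lia
  · have : s(x, y) ∉ B := fun h' => hx (h _ h' x (by simp))
    rw [card_insert_of_notMem hx, card_insert_of_notMem this]
    lia

lemma excess_succ {a b : ℕ} (h : a ≤ b) :
    #(timeEdges f a b) + #(timeVerts f a (b + 1)) ≤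
      #(timeEdges f a (b + 1)) + #(timeVerts f a b) := by
  rw [timeVerts_succ h, timeEdges_succ h, Sym2.eq_swap]
  exact card_insert_excess (fun ε hε w hw => mem_timeVerts_of_mem_timeEdges hε hw) _ _

lemma excess_left {a b : ℕ} (h : a + 1 ≤ b) :
    #(timeEdges f (a + 1) b) + #(timeVerts f a b) ≤
      #(timeEdges f a b) + #(timeVerts f (a + 1) b) := by
  rw [timeVerts_left h, timeEdges_left h]
  exact card_insert_excess (fun ε hε w hw => mem_timeVerts_of_mem_timeEdges hε hw) _ _

lemma excess_mono_right {a b c : ℕ} (hab : a ≤ b) (hbc : b ≤ c) :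
    #(timeEdges f a b) + #(timeVerts f a c) ≤ #(timeEdges f a c) + #(timeVerts f a b) := by
  induction c, hbc using Nat.le_induction with
  | base => rfl
  | succ c hc ih =>
    have := excess_succ (f := f) (hab.trans hc)
    lia

lemma excess_mono {i b N : ℕ} (hib : i ≤ b) (hbN : b ≤ N) :
    #(timeEdges f i b) + #(timeVerts f 0 N) ≤ #(timeEdges f 0 N) + #(timeVerts f i b) := by
  have h1 := excess_mono_right (f := f) hib hbN
  have h2 : ∀ i, i ≤ N →
      #(timeEdges f i N) + #(timeVerts f 0 N) ≤ #(timeEdges f 0 N) + #(timeVerts f i N) := by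
    intro i
    induction i with
    | zero => intro _; rfl
    | succ i ih =>
      intro hi
      have := ih (by lia)
      have := excess_left (f := f) hi
      lia
  have := h2 i (hib.trans hbN)
  lia

/-- Returning to a visited vertex along a new edge raises the excess. -/
lemma excess_lt {a b : ℕ} (hab : a ≤ b) (hv : f (b + 1) ∈ timeVerts f a b)
    (he : s(f b, f (b + 1)) ∉ timeEdges f a b) :
    #(timeEdges f a b) + #(timeVerts f a (b + 1)) + 1 =
      #(timeEdges f a (b + 1)) + #(timeVerts f a b) := by
  rw [timeVerts_succ hab, timeEdges_succ hab, insert_eq_of_mem hv, card_insert_of_notMem he]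
  lia

/-- A non-backtracking sequence with at most as many edges as vertices that is not self-avoiding
consists of a self-avoiding path up to its first return, which closes a cycle, of some steps around
this cycle, and of a self-avoiding path. -/
theorem exists_lasso {N : ℕ} (nb1 : ∀ t, t + 1 ≤ N → f t ≠ f (t + 1))
    (nb2 : ∀ t, t + 2 ≤ N → f t ≠ f (t + 2)) (hex : #(timeEdges f 0 N) ≤ #(timeVerts f 0 N))
    (hni : ¬ Set.InjOn f (Set.Iic N)) :
    ∃ q i j, i < q ∧ q ≤ j ∧ j ≤ N ∧ Set.InjOn f (Set.Iio q) ∧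
      (∀ t ≤ j, f t = f (if t < q then t else i + (t - i) % (q - i))) ∧
      Set.InjOn f (Set.Icc j N) := by
  classical
  have hq : ∃ q, q ≤ N ∧ ∃ i < q, f i = f q := by
    by_contra hc
    push Not at hc
    refine hni fun x hx y hy hxy => ?_
    rcases lt_trichotomy x y with h | h | h
    · exact absurd hxy (hc y hy x h)
    · exact h
    · exact absurd hxy.symm (hc x hx y h)
  obtain ⟨q, ⟨hqN, i, hiq, hfi⟩, hmin⟩ :
      ∃ q, (q ≤ N ∧ ∃ i < q, f i = f q) ∧ ∀ q' < q, ¬ (q' ≤ N ∧ ∃ i < q', f i = f q') :=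
    ⟨Nat.find hq, Nat.find_spec hq, fun q' h => Nat.find_min hq h⟩
  have hinj : Set.InjOn f (Set.Iio q) := by
    intro x hx y hy hxy
    rw [Set.mem_Iio] at hx hy
    rcases lt_trichotomy x y with h | h | h
    · exact absurd ⟨by lia, x, h, hxy⟩ (hmin y hy)
    · exact h
    · exact absurd ⟨by lia, y, h, hxy.symm⟩ (hmin x hx)
  have hi3 : i + 3 ≤ q := by
    by_contra hc
    have : q = i + 1 ∨ q = i + 2 := by lia
    rcases this with rfl | rfl
    · exact nb1 i hqN hfi
    · exact nb2 i hqN hfi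
  -- the first return closes a cycle
  have hcyc : #(timeVerts f i q) ≤ #(timeEdges f i q) := by
    obtain ⟨r, rfl⟩ : ∃ r, q = r + 1 := ⟨q - 1, by lia⟩
    have h0 := excess_mono_right (f := f) (a := i) (b := i) (c := r) le_rfl (by lia)
    have h1 := excess_lt (f := f) (a := i) (b := r) (by lia)
      (mem_timeVerts.2 ⟨i, ⟨le_rfl, by lia⟩, hfi⟩) (by
        intro h
        obtain ⟨t, ⟨ht1, ht2⟩, ht⟩ := mem_timeEdges.1 h
        rcases Sym2.eq_iff.1 ht with ⟨h1, h2⟩ | ⟨h1, h2⟩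
        · have := hinj (by simp; lia) (by simp) h1; lia
        · have := hinj (by simp; lia) (by simp) h2
          obtain rfl : r = t + 1 := this.symm
          exact nb2 t (by lia) h1)
    have h2 : timeVerts f i i = {f i} := by simp [timeVerts]
    have h3 : timeEdges f i i = ∅ := by simp [timeEdges]
    rw [h2, h3] at h0
    simp only [card_empty, card_singleton] at h0
    lia
  set g := q - i with hg
  -- the last time `j` up to which the walk goes around the cycle
  have hP : ∃ j, q ≤ j ∧ j ≤ N ∧ (∀ t, i ≤ t → t ≤ j → f t = f (i + (t - i) % g)) ∧
      (j < N → f (j + 1) ≠ f (i + (j + 1 - i) % g)) := by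
    have base : ∀ t, i ≤ t → t ≤ q → f t = f (i + (t - i) % g) := by
      intro t h1 h2
      rcases h2.lt_or_eq with h | rfl
      · rw [Nat.mod_eq_of_lt (by lia)]; congr 1; lia
      · rw [← hg, Nat.mod_self, add_zero, hfi]
    by_contra hc
    push Not at hc
    have all : ∀ j, q ≤ j → j ≤ N → ∀ t, i ≤ t → t ≤ j → f t = f (i + (t - i) % g) := by
      intro j hj
      induction j, hj using Nat.le_induction with
      | base => intro _; exact base
      | succ j hj ih =>
        intro hjN t h1 h2
        rcases h2.lt_or_eq with h | rfl
        · exact ih (by lia) t h1 (by lia)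
        · exact (hc j hj (by lia) (ih (by lia))).2
    have := (hc N hqN le_rfl (all N hqN le_rfl)).1
    exact lt_irrefl _ this
  obtain ⟨j, hqj, hjN, hper, hmax⟩ := hP
  have hgpos : 0 < g := by lia
  have hmod : ∀ t, (t - i) % g < g := fun t => Nat.mod_lt _ hgpos
  have hcycinj : ∀ s t, i ≤ s → s ≤ j → i ≤ t → t ≤ j → f s = f t → (s - i) % g = (t - i) % g := by
    intro s t h1 h2 h3 h4 h
    rw [hper s h1 h2, hper t h3 h4] at h
    have := hinj (by simp; have := hmod s; lia) (by simp; have := hmod t; lia) h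
    lia
  have hshift : ∀ s t, i ≤ s → i ≤ t → (s - i) % g = (t - i) % g →
      (s + 1 - i) % g = (t + 1 - i) % g := by
    intro s t hs ht h
    rw [show s + 1 - i = (s - i) + 1 by lia, show t + 1 - i = (t - i) + 1 by lia]
    exact Nat.ModEq.add_right 1 h
  -- after leaving the cycle the walk meets new vertices only
  have hnew : ∀ b, j ≤ b → b < N → f (b + 1) ∉ timeVerts f i b := by
    intro b
    induction b using Nat.strong_induction_on with
    | h b ih =>
      intro hjb hbN hv
      have hedge : s(f b, f (b + 1)) ∉ timeEdges f i b := by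
        intro h
        obtain ⟨t, ⟨ht1, ht2⟩, ht⟩ := mem_timeEdges.1 h
        rcases hjb.lt_or_eq with hlt | rfl
        · obtain ⟨b, rfl⟩ : ∃ c, b = c + 1 := ⟨b - 1, by lia⟩
          have hb := ih b (by lia) (by lia) (by lia)
          rcases Sym2.eq_iff.1 ht with ⟨h1, h2⟩ | ⟨h1, h2⟩
          · exact hb (mem_timeVerts.2 ⟨t, ⟨ht1, by lia⟩, h1⟩)
          · by_cases htb : t = b
            · subst htb
              exact nb2 t (by lia) h1
            · exact hb (mem_timeVerts.2 ⟨t + 1, ⟨by lia, by lia⟩, h2⟩)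
        · rcases Sym2.eq_iff.1 ht with ⟨h1, h2⟩ | ⟨h1, h2⟩
          · have h3 := hcycinj t j ht1 ht2.le (by lia) le_rfl h1
            have h4 := hshift t j ht1 (by lia) h3
            apply hmax hbN
            rw [← h2, hper (t + 1) (by lia) (by lia), h4]
          · have h3 := hcycinj (t + 1) j (by lia) (by lia) (by lia) le_rfl h2
            obtain ⟨k, rfl⟩ : ∃ k, j = k + 1 := ⟨j - 1, by lia⟩
            have h4 : (t - i) % g = (k - i) % g := by
              rw [show t + 1 - i = (t - i) + 1 by lia, show k + 1 - i = (k - i) + 1 by lia] at h3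
              exact Nat.ModEq.add_right_cancel' 1 h3
            refine nb2 k (by lia) ?_
            rw [← h1, hper t ht1 (by lia), hper k (by lia) (by lia), h4]
      have h1 := excess_lt (by lia) hv hedge
      have h2 := excess_mono_right (f := f) (a := i) (b := q) (c := b) (by lia) (by lia)
      have h3 := excess_mono (f := f) (i := i) (b := b + 1) (N := N) (by lia) (by lia)
      lia
  refine ⟨q, i, j, hiq, hqj, hjN, hinj, ?_, ?_⟩
  · intro t ht
    split_ifs with h
    · rfl
    · exact hper t (by lia) ht
  · have : ∀ x y, j ≤ x → x < y → y ≤ N → f x ≠ f y := by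
      intro x y h1 h2 h3 h
      obtain ⟨y, rfl⟩ : ∃ c, y = c + 1 := ⟨y - 1, by lia⟩
      exact hnew y (by lia) (by lia) (mem_timeVerts.2 ⟨x, ⟨by lia, by lia⟩, h⟩)
    intro x hx y hy hxy
    rw [Set.mem_Icc] at hx hy
    rcases lt_trichotomy x y with h | h | h
    · exact absurd hxy (this x y hx.1 h hy.2)
    · exact h
    · exact absurd hxy.symm (this y x hy.1 h hx.2)

end Excess

end

/-! ### Good walks -/

section

variable {V : Type*} [DecidableEq V]

/-- A non-backtracking walk whose vertices and edges form a graph with at most one cycle. -/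
def IsGood (l : List V) : Prop := IsNB l ∧ #(walkEdges l) ≤ #l.toFinset

noncomputable instance (l : List V) : Decidable (IsGood l) := Classical.propDecidable _

/-- The walk `l` runs along a self-avoiding path with `q` vertices, returns to the vertex at time
`i`, goes around the cycle that it has closed until the time `j`, and is self-avoiding from then
on. -/
def IsLasso (q i j : ℕ) (l : List V) : Prop :=
  i < q ∧ q ≤ j ∧ j < l.length ∧ (l.take q).Nodup ∧ (l.drop j).Nodup ∧
    ∀ t ≤ j, l[t]? = l[if t < q then t else i + (t - i) % (q - i)]?

noncomputable instance (q i j : ℕ) (l : List V) : Decidable (IsLasso q i j l) :=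
  Classical.propDecidable _

lemma isGood_of_nodup {l : List V} (h : l.Nodup) : IsGood l := by
  refine ⟨isNB_of_nodup h, ?_⟩
  rw [List.toFinset_card_of_nodup h, walkEdges]
  refine (List.toFinset_card_le _).trans ?_
  rw [length_edgeList]
  lia

lemma IsGood.reverse {l : List V} (h : IsGood l) : IsGood l.reverse :=
  ⟨isNB_reverse h.1, by simpa using h.2⟩

lemma card_excess_cons (a : V) (l : List V) :
    #(walkEdges l) + #(a :: l).toFinset ≤ #(walkEdges (a :: l)) + #l.toFinset ∨ l = [] := by
  cases l with
  | nil => exact .inr rfl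
  | cons b l =>
    left
    rw [walkEdges_cons_cons, List.toFinset_cons]
    exact card_insert_excess (fun ε hε w hw => by simpa using mem_of_mem_walkEdges hε hw) a b

lemma IsGood.tail {a : V} {l : List V} (h : IsGood (a :: l)) : IsGood l := by
  refine ⟨h.1.tail, ?_⟩
  rcases card_excess_cons a l with h' | rfl
  · have := h.2
    lia
  · simp

lemma IsGood.exists_isLasso {l : List V} (h : IsGood l) (hl : ¬ l.Nodup) :
    ∃ q i j, IsLasso q i j l := by
  obtain ⟨x, hx⟩ : ∃ x, x ∈ l := by
    cases l with
    | nil => simp at hl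
    | cons a l => exact ⟨a, by simp⟩
  have hlen : 0 < l.length := List.length_pos_of_mem hx
  set f : ℕ → V := fun t => l[t]?.getD x with hf
  have hget : ∀ t < l.length, l[t]? = some (f t) := by
    intro t ht
    simp [hf, List.getElem?_eq_getElem ht]
  set N := l.length - 1 with hN
  have hV : timeVerts f 0 N = l.toFinset := by
    ext w
    rw [mem_timeVerts, List.mem_toFinset, List.mem_iff_getElem?]
    constructor
    · rintro ⟨t, ht, rfl⟩; exact ⟨t, hget t (by lia)⟩
    · rintro ⟨t, ht⟩
      have htl := (List.getElem?_eq_some_iff.1 ht).1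
      rw [hget t htl] at ht
      exact ⟨t, by lia, Option.some.inj ht⟩
  have hE : timeEdges f 0 N = walkEdges l := by
    ext ε
    rw [mem_timeEdges, mem_walkEdges]
    constructor
    · rintro ⟨t, ht, rfl⟩; exact ⟨t, _, _, hget t (by lia), hget (t + 1) (by lia), rfl⟩
    · rintro ⟨t, a, b, ha, hb, rfl⟩
      have htl := (List.getElem?_eq_some_iff.1 hb).1
      rw [hget t (by lia)] at ha
      rw [hget (t + 1) htl] at hb
      exact ⟨t, by lia, by rw [Option.some.inj ha, Option.some.inj hb]⟩
  have hnd : ∀ x y, x < l.length → y < l.length → (f x = f y ↔ l[x]? = l[y]?) := by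
    intro x y hx hy
    rw [hget x hx, hget y hy, Option.some.injEq]
  obtain ⟨q, i, j, hiq, hqj, hjN, h1, h2, h3⟩ := exists_lasso (f := f) (N := N)
    (fun t ht => h.1 t (t + 1) _ _ (hget t (by lia)) (hget _ (by lia)) (by lia) (by lia))
    (fun t ht => h.1 t (t + 2) _ _ (hget t (by lia)) (hget _ (by lia)) (by lia) (by lia))
    (by rw [hV, hE]; exact h.2) (by
      intro hinj
      apply hl
      rw [List.nodup_iff_getElem?_ne_getElem?]
      intro x y hxy hy h'
      have := hinj (by simp; lia) (by simp; lia) ((hnd x y (by lia) hy).2 h')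
      lia)
  refine ⟨q, i, j, hiq, hqj, by lia, ?_, ?_, ?_⟩
  · rw [List.nodup_iff_getElem?_ne_getElem?]
    intro x y hxy hy h'
    rw [List.length_take] at hy
    rw [List.getElem?_take_of_lt (by lia), List.getElem?_take_of_lt (by lia)] at h'
    have := h1 (by simp; lia) (by simp; lia) ((hnd x y (by lia) (by lia)).2 h')
    lia
  · rw [List.nodup_iff_getElem?_ne_getElem?]
    intro x y hxy hy h'
    rw [List.length_drop] at hy
    rw [List.getElem?_drop, List.getElem?_drop] at h'
    have := h3 (by simp; lia) (by simp; lia) ((hnd (j + x) (j + y) (by lia) (by lia)).2 h')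
    lia
  · intro t ht
    refine (hnd _ _ (by lia) ?_).1 (h2 t ht)
    split_ifs with h
    · lia
    · have := Nat.mod_lt (t - i) (show 0 < q - i by lia)
      lia

/-- The edge from the last vertex of a walk to its vertex at time `i`, as a set, which is empty if
there is no such edge. -/
def closingEdge (i : ℕ) (α : List V) : Finset (Sym2 V) :=
  (α.getLast?.bind fun a => α[i]?.map fun b => s(a, b)).toFinset

lemma mem_closingEdge {i : ℕ} {α : List V} {ε : Sym2 V} :
    ε ∈ closingEdge i α ↔ ∃ a b, α.getLast? = some a ∧ α[i]? = some b ∧ ε = s(a, b) := by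
  simp only [closingEdge, Option.mem_toFinset, Option.mem_def, Option.bind_eq_some_iff,
    Option.map_eq_some_iff]
  constructor
  · rintro ⟨a, ha, b, hb, rfl⟩; exact ⟨a, b, ha, hb, rfl⟩
  · rintro ⟨a, b, ha, hb, rfl⟩; exact ⟨a, ha, b, hb, rfl⟩

lemma mem_of_mem_closingEdge {i : ℕ} {α : List V} {ε : Sym2 V} (h : ε ∈ closingEdge i α) {w : V}
    (hw : w ∈ ε) : w ∈ α := by
  obtain ⟨a, b, ha, hb, rfl⟩ := mem_closingEdge.1 h
  rcases Sym2.mem_iff.1 hw with rfl | rfl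
  · exact List.mem_of_getLast? ha
  · exact List.mem_of_getElem? hb

lemma mem_walkEdges_take {l : List V} {q : ℕ} {ε : Sym2 V} (h : ε ∈ walkEdges (l.take q)) :
    ε ∈ walkEdges l := by
  obtain ⟨t, a, b, ha, hb, rfl⟩ := mem_walkEdges.1 h
  rw [List.getElem?_take] at ha hb
  split_ifs at ha hb
  exact mem_walkEdges.2 ⟨t, a, b, ha, hb, rfl⟩

lemma mem_walkEdges_drop {l : List V} {q : ℕ} {ε : Sym2 V} (h : ε ∈ walkEdges (l.drop q)) :
    ε ∈ walkEdges l := by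
  obtain ⟨t, a, b, ha, hb, rfl⟩ := mem_walkEdges.1 h
  rw [List.getElem?_drop] at ha hb
  exact mem_walkEdges.2 ⟨q + t, a, b, ha, hb, rfl⟩

section Lasso

variable {q i j : ℕ} {l : List V}

lemma IsLasso.getElem?_take (h : IsLasso q i j l) {t : ℕ} (ht : t ≤ j) :
    l[t]? = (l.take q)[if t < q then t else i + (t - i) % (q - i)]? := by
  rw [List.getElem?_take_of_lt, ← h.2.2.2.2.2 t ht]
  split_ifs with h'
  · exact h'
  · have := Nat.mod_lt (t - i) (show 0 < q - i by have := h.1; lia)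
    lia

/-- The walk visits the vertices and edges of its two self-avoiding parts, and the edge that closes
the cycle. -/
lemma IsLasso.supp_eq (h : IsLasso q i j l) :
    supp l = supp (l.take q) ⊔ (∅, closingEdge i (l.take q)) ⊔ supp (l.drop j) := by
  have h' := h
  obtain ⟨hiq, hqj, hjl, -, -, hper⟩ := h
  have hg : ∀ t, (t - i) % (q - i) < q - i := fun t => Nat.mod_lt _ (by lia)
  ext x
  · simp only [supp, Prod.fst_sup, sup_eq_union, union_empty, mem_union, List.mem_toFinset]
    constructor
    · intro hx
      obtain ⟨t, ht⟩ := List.mem_iff_getElem?.1 hx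
      rcases le_total t j with htj | htj
      · left
        rw [h'.getElem?_take htj] at ht
        exact List.mem_of_getElem? ht
      · right
        refine List.mem_of_getElem? (i := t - j) ?_
        rw [List.getElem?_drop, ← ht]
        congr 1
        lia
    · rintro (hx | hx)
      · exact List.mem_of_mem_take hx
      · exact List.mem_of_mem_drop hx
  · simp only [supp, Prod.snd_sup, sup_eq_union, mem_union]
    have hlast : (l.take q).getLast? = l[q - 1]? := by
      rw [List.getLast?_eq_getElem?, List.length_take, min_eq_left (by lia),
        List.getElem?_take_of_lt (by lia)]
    have hi : (l.take q)[i]? = l[q]? := by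
      rw [List.getElem?_take_of_lt (by lia), hper q hqj, if_neg (by lia), Nat.mod_self, add_zero]
    constructor
    · intro hx
      obtain ⟨t, a, b, ha, hb, rfl⟩ := mem_walkEdges.1 hx
      rcases lt_or_ge t j with htj | htj
      · left
        -- an edge of the cycle or of the path leading to it
        have key : ∀ t a b, t < q → l[t]? = some a → l[t + 1]? = some b →
            s(a, b) ∈ walkEdges (l.take q) ∨ s(a, b) ∈ closingEdge i (l.take q) := by
          intro t a b ht ha hb
          rcases Nat.lt_or_ge (t + 1) q with h | h
          · left
            refine mem_walkEdges.2 ⟨t, a, b, ?_, ?_, rfl⟩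
            · rwa [List.getElem?_take_of_lt (by lia)]
            · rwa [List.getElem?_take_of_lt (by lia)]
          · right
            obtain rfl : q = t + 1 := by lia
            refine mem_closingEdge.2 ⟨a, b, ?_, ?_, rfl⟩
            · rw [hlast, ← ha]; rfl
            · rw [hi, hb]
        rcases Nat.lt_or_ge t q with h | h
        · exact key t a b h ha hb
        · refine key (i + (t - i) % (q - i)) a b (by have := hg t; lia) ?_ ?_
          · rw [← ha, hper t htj.le, if_neg (by lia)]
          · rw [← hb, hper (t + 1) htj, if_neg (by lia)]
            have hmod : (t + 1 - i) % (q - i) = ((t - i) % (q - i) + 1) % (q - i) := by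
              rw [show t + 1 - i = t - i + 1 by lia, Nat.mod_add_mod]
            rcases Nat.lt_or_ge ((t - i) % (q - i) + 1) (q - i) with h' | h'
            · rw [hmod, Nat.mod_eq_of_lt h', add_assoc]
            · have h'' : (t - i) % (q - i) + 1 = q - i := by have := hg t; lia
              rw [hmod, h'', Nat.mod_self, add_assoc, h'', add_zero,
                show i + (q - i) = q by lia, hper q hqj, if_neg (by lia), Nat.mod_self, add_zero]
      · right
        refine mem_walkEdges.2 ⟨t - j, a, b, ?_, ?_, rfl⟩
        · rw [List.getElem?_drop, ← ha]; congr 1; lia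
        · rw [List.getElem?_drop, ← hb]; congr 1; lia
    · rintro ((hx | hx) | hx)
      · exact mem_walkEdges_take hx
      · obtain ⟨a, b, ha, hb, rfl⟩ := mem_closingEdge.1 hx
        rw [hlast] at ha
        rw [hi] at hb
        exact mem_walkEdges.2 ⟨q - 1, a, b, ha, by rw [← hb]; congr 1; lia, rfl⟩
      · exact mem_walkEdges_drop hx

/-- The two self-avoiding parts determine the walk. -/
lemma IsLasso.eq_of {l' : List V} (h : IsLasso q i j l) (h' : IsLasso q i j l')
    (h1 : l.take q = l'.take q) (h2 : l.drop j = l'.drop j) : l = l' := by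
  apply List.ext_getElem?
  intro t
  rcases le_total t j with htj | htj
  · rw [h.getElem?_take htj, h'.getElem?_take htj, h1]
  · have := congrArg (fun m => m[t - j]?) h2
    simp only [List.getElem?_drop] at this
    rwa [show j + (t - j) = t by lia] at this

lemma IsLasso.head_drop (h : IsLasso q i j l) :
    ∃ a ∈ l.take q, (l.drop j).head? = some a := by
  have hj := h.2.2.1
  refine ⟨l[j], ?_, ?_⟩
  · refine List.mem_of_getElem? (i := if j < q then j else i + (j - i) % (q - i)) ?_
    rw [← h.getElem?_take le_rfl, List.getElem?_eq_getElem hj]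
  · rw [List.head?_drop, List.getElem?_eq_getElem hj]

end Lasso

variable [Fintype V]

/-- Summing the weights of the pieces `S ⊔ supp l` over the walks `l` of `𝒲` that start in the
piece `S` costs at most a factor `C`, together with an increase of the parameter `y` by a factor
`c`. -/
def HeadBound (𝒲 : Finset (List V)) (L : ℝ) (R r K : ℕ) (C c : ℝ) : Prop :=
  ∀ (y : ℝ) (S : Piece V) (ρ : ℕ), 0 < y → Inv ρ S → ρ + r ≤ R → (#S.1 : ℝ) + K ≤ L →
    c * y * (3 * L ^ 4) ≤ 1 →
    ∑ l ∈ 𝒲 with ∃ a ∈ S.1, l.head? = some a, weight y (S ⊔ supp l) ≤ C * weight (c * y) S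

lemma Inv.sup_edges {ρ : ℕ} {S : Piece V} (hS : Inv ρ S) {F : Finset (Sym2 V)}
    (hF : ∀ ε ∈ F, ∀ w ∈ ε, w ∈ S.1) : Inv ρ (S ⊔ (∅, F)) where
  valid := by
    intro ε hε w hw
    simp only [Prod.snd_sup, sup_eq_union, mem_union] at hε
    simp only [Prod.fst_sup, sup_eq_union, union_empty]
    rcases hε with hε | hε
    · exact hS.valid ε hε w hw
    · exact hF ε hε w hw
  low := by
    refine le_trans (card_le_card ?_) hS.low
    intro w hw
    simp only [Prod.fst_sup, sup_eq_union, union_empty, Prod.snd_sup, mem_filter] at hw ⊢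
    exact ⟨hw.1, (deg_mono subset_union_left w).trans hw.2⟩
  conn := by
    have := hS.conn
    have := card_le_card (subset_union_left (s₁ := S.2) (s₂ := F))
    simp only [Prod.fst_sup, sup_eq_union, union_empty, Prod.snd_sup]
    lia

lemma weight_sup_edges_le {y : ℝ} (hy : 0 < y) (hy1 : y ≤ 1) (S : Piece V) (F : Finset (Sym2 V)) :
    weight y (S ⊔ (∅, F)) ≤ weight y S := by
  unfold weight
  simp only [Prod.fst_sup, sup_eq_union, union_empty, Prod.snd_sup]
  refine mul_le_mul_of_nonneg_left ?_ (by positivity)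
  exact pow_le_pow_of_le_one hy.le hy1 (card_le_card subset_union_left)

lemma card_sup_supp_le (S : Piece V) (l : List V) : #(S ⊔ supp l).1 ≤ #S.1 + l.length :=
  (card_union_le _ _).trans (Nat.add_le_add_left (List.toFinset_card_le l) _)

/-- Bounds for two families of walks give one for the walks that are made up of a walk of each
family, where some edges between vertices of the first walk may be added. -/
lemma HeadBound.comp [Nonempty V] {𝒲 𝒲₁ 𝒲₂ : Finset (List V)} {L : ℝ}
    {R r r₁ r₂ K₁ K₂ : ℕ} {C₁ C₂ c₁ c₂ : ℝ} (h₁ : HeadBound 𝒲₁ L R r₁ K₁ C₁ c₁)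
    (h₂ : HeadBound 𝒲₂ L R r₂ K₂ C₂ c₂) (hL : 1 ≤ L) (hC₂ : 0 ≤ C₂) (hc₁ : 1 ≤ c₁)
    (hc₂ : 1 ≤ c₂) (hr₁ : r₁ ≤ r) (hr₂ : r₂ + 2 ≤ r)
    (hlen : ∀ α ∈ 𝒲₁, α.length ≤ K₁) (hNB : ∀ α ∈ 𝒲₁, IsNB α)
    (φ ψ : List V → List V) (F : List V → Finset (Sym2 V))
    (hF : ∀ α, ∀ ε ∈ F α, ∀ w ∈ ε, w ∈ α)
    (hφ : ∀ l ∈ 𝒲, φ l ∈ 𝒲₁) (hψ : ∀ l ∈ 𝒲, ψ l ∈ 𝒲₂) (hhead : ∀ l ∈ 𝒲, (φ l).head? = l.head?)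
    (hjoin : ∀ l ∈ 𝒲, ∃ a ∈ φ l, (ψ l).head? = some a)
    (hsupp : ∀ l ∈ 𝒲, supp l = supp (φ l) ⊔ (∅, F (φ l)) ⊔ supp (ψ l))
    (hinj : Set.InjOn (fun l => (φ l, ψ l)) (𝒲 : Set (List V))) :
    HeadBound 𝒲 L R r (K₁ + K₂) (C₁ * C₂) (c₁ * c₂) := by
  intro y S ρ hy hS hρ hK hyL
  push_cast at hK
  have hL4 : 1 ≤ 3 * L ^ 4 := by have := one_le_pow₀ (n := 4) hL; linarith
  have hc2y : 0 < c₂ * y := by positivity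
  have hc2L : c₂ * y * (3 * L ^ 4) ≤ 1 := by
    refine le_trans ?_ hyL
    have : c₂ * y ≤ c₁ * c₂ * y := by
      rw [mul_assoc]; exact le_mul_of_one_le_left hc2y.le hc₁
    gcongr
  have hc2y1 : c₂ * y ≤ 1 := le_trans (le_mul_of_one_le_right hc2y.le hL4) hc2L
  set A := ({α ∈ 𝒲₁ | ∃ a ∈ S.1, α.head? = some a} : Finset (List V)) with hA
  set T : List V → Piece V := fun α => S ⊔ supp α ⊔ (∅, F α) with hT
  have hTinv : ∀ α ∈ A, Inv (ρ + 2) (T α) := by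
    intro α hα
    obtain ⟨hα1, a, ha, hαa⟩ := mem_filter.1 hα
    refine (hS.sup_supp (hNB α hα1) (.inl hαa) ha).sup_edges fun ε hε w hw => ?_
    simp only [Prod.fst_sup, sup_eq_union, mem_union, supp, List.mem_toFinset]
    exact .inr (hF α ε hε w hw)
  have hTcard : ∀ α ∈ A, (#(T α).1 : ℝ) + K₂ ≤ L := by
    intro α hα
    have h1 : #(T α).1 ≤ #S.1 + K₁ := by
      simp only [hT, Prod.fst_sup, sup_eq_union, union_empty]
      exact (card_sup_supp_le S α).trans (by have := hlen α (mem_filter.1 hα).1; lia)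
    have : (#(T α).1 : ℝ) ≤ #S.1 + K₁ := by exact_mod_cast h1
    linarith
  calc ∑ l ∈ 𝒲 with ∃ a ∈ S.1, l.head? = some a, weight y (S ⊔ supp l)
      = ∑ p ∈ ({l ∈ 𝒲 | ∃ a ∈ S.1, l.head? = some a} : Finset (List V)).image
          (fun l => (φ l, ψ l)), weight y (T p.1 ⊔ supp p.2) := by
        rw [sum_image (fun x hx y hy h => hinj (mem_filter.1 hx).1 (mem_filter.1 hy).1 h)]
        refine sum_congr rfl fun l hl => ?_
        rw [hsupp l (mem_filter.1 hl).1, hT]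
        simp only [sup_assoc]
    _ ≤ ∑ p ∈ A.sigma fun α => ({β ∈ 𝒲₂ | ∃ a ∈ (T α).1, β.head? = some a} : Finset (List V)),
          weight y (T p.1 ⊔ supp p.2) := by
        refine le_trans ?_ (sum_le_sum_of_subset_of_nonneg
          (s := (({l ∈ 𝒲 | ∃ a ∈ S.1, l.head? = some a} : Finset (List V)).image
            fun l => (⟨φ l, ψ l⟩ : (_ : List V) × List V))) ?_ ?_)
        · rw [sum_image, sum_image]
          · intro x hx y hy h
            simp only [Sigma.mk.injEq, heq_eq_eq] at h
            exact hinj (mem_filter.1 hx).1 (mem_filter.1 hy).1 (Prod.ext h.1 h.2)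
          · exact fun x hx y hy h => hinj (mem_filter.1 hx).1 (mem_filter.1 hy).1 h
        · intro p hp
          obtain ⟨l, hl, rfl⟩ := mem_image.1 hp
          obtain ⟨hl, a, ha, hla⟩ := mem_filter.1 hl
          obtain ⟨b, hb, hbl⟩ := hjoin l hl
          rw [mem_sigma, mem_filter, mem_filter]
          refine ⟨⟨hφ l hl, a, ha, by rw [hhead l hl, hla]⟩, hψ l hl, b, ?_, hbl⟩
          simp [hT, supp, hb]
        · exact fun p _ _ => (weight_pos hy _).le
    _ = ∑ α ∈ A, ∑ β ∈ 𝒲₂ with ∃ a ∈ (T α).1, β.head? = some a, weight y (T α ⊔ supp β) := by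
        rw [sum_sigma]
    _ ≤ ∑ α ∈ A, C₂ * weight (c₂ * y) (T α) := by
        refine sum_le_sum fun α hα => ?_
        exact h₂ y (T α) (ρ + 2) hy (hTinv α hα) (by lia) (hTcard α hα) hc2L
    _ ≤ ∑ α ∈ A, C₂ * weight (c₂ * y) (S ⊔ supp α) := by
        gcongr with α _
        exact weight_sup_edges_le hc2y hc2y1 _ _
    _ ≤ C₂ * (C₁ * weight (c₁ * (c₂ * y)) S) := by
        rw [← mul_sum]
        gcongr
        refine h₁ (c₂ * y) S ρ hc2y hS (by lia) ?_ (by rwa [← mul_assoc c₁])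
        have : (0 : ℝ) ≤ K₂ := K₂.cast_nonneg
        linarith
    _ = C₁ * C₂ * weight (c₁ * c₂ * y) S := by rw [← mul_assoc c₁ c₂ y]; ring

/-- The weight of a piece decreases by at most a constant factor when `y` is replaced by `4 * y`. -/
lemma weight_le_four_mul [Nonempty V] {y : ℝ} (hy : 0 < y) {S : Piece V} {ρ : ℕ} (hS : Inv ρ S) :
    weight y S ≤ 4 ^ ρ * weight (4 * y) S := by
  have hn : (0 : ℝ) < Fintype.card V := by exact_mod_cast Fintype.card_pos
  have h1 : ((4 : ℝ)) ^ #S.1 ≤ 4 ^ (#S.2 + ρ) := by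
    have h := prod_deg_le hS
    have h0 : 1 ≤ ∏ w ∈ S.1, max (deg S.2 w - 1) 1 :=
      Nat.one_le_iff_ne_zero.2 (prod_ne_zero_iff.2 fun w _ => by lia)
    have : 4 ^ #S.1 ≤ 4 ^ (#S.2 + ρ) := le_trans (Nat.le_mul_of_pos_left _ h0) h
    exact_mod_cast this
  have h2 : weight y S = ((Fintype.card V : ℝ) * (4 * y))⁻¹ ^ #S.1 * y ^ #S.2 * 4 ^ #S.1 := by
    rw [weight, mul_right_comm, ← mul_pow]
    congr 2
    field_simp
  rw [h2, weight]
  calc _ ≤ ((Fintype.card V : ℝ) * (4 * y))⁻¹ ^ #S.1 * y ^ #S.2 * 4 ^ (#S.2 + ρ) := by gcongr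
    _ = _ := by rw [mul_pow, pow_add]; ring

lemma sum_biUnion_le {ι α : Type*} [DecidableEq α] (s : Finset ι) (t : ι → Finset α) {f : α → ℝ}
    (hf : ∀ x, 0 ≤ f x) : ∑ x ∈ s.biUnion t, f x ≤ ∑ i ∈ s, ∑ x ∈ t i, f x := by
  classical
  induction s using Finset.induction_on with
  | empty => simp
  | insert i s hi ih =>
    rw [biUnion_insert, sum_insert hi]
    refine le_trans ?_ (add_le_add_right ih _)
    exact le_of_le_of_eq (le_add_of_nonneg_right (sum_nonneg fun x _ => hf x)) sum_union_inter

/-- The constant in the bounds on sums over walks. -/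
noncomputable def walkConst (L : ℝ) (R : ℕ) : ℝ := 4 ^ R * (3 * L ^ 3)

lemma three_le_walkConst {L : ℝ} (hL : 1 ≤ L) (R : ℕ) : 3 ≤ walkConst L R := by
  have h1 : (1 : ℝ) ≤ 4 ^ R := one_le_pow₀ (by norm_num)
  have h2 : 1 ≤ L ^ 3 := one_le_pow₀ hL
  unfold walkConst
  nlinarith

/-- The self-avoiding paths with `k` vertices. -/
noncomputable def nodupWalks (V : Type*) [Fintype V] [DecidableEq V] (k : ℕ) : Finset (List V) :=
  {l ∈ listsOf univ k | l.Nodup}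

/-- The good walks with `k` vertices. -/
noncomputable def goodWalks (V : Type*) [Fintype V] [DecidableEq V] (k : ℕ) : Finset (List V) :=
  {l ∈ listsOf univ k | IsGood l}

lemma mem_nodupWalks {k : ℕ} {l : List V} : l ∈ nodupWalks V k ↔ l.length = k ∧ l.Nodup := by
  simp [nodupWalks]

lemma mem_goodWalks {k : ℕ} {l : List V} : l ∈ goodWalks V k ↔ l.length = k ∧ IsGood l := by
  simp [goodWalks]

lemma headBound_nodup [Nonempty V] {L : ℝ} (hL : 1 ≤ L) (R k : ℕ) :
    HeadBound (nodupWalks V k) L R 0 k (walkConst L R) 4 := by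
  intro y S ρ hy hS hρ hSk hyL
  have hk0 : (0 : ℝ) ≤ k := k.cast_nonneg
  have hS0 : (0 : ℝ) ≤ #S.1 := Nat.cast_nonneg _
  have hL4 : 0 < L ^ 4 := by positivity
  have h := sum_nodup_le hy hL hS (by nlinarith) (by linarith) k (by linarith)
  rw [nodupWalks, filter_filter]
  refine h.trans ?_
  have hpos : 0 < weight (4 * y) S := weight_pos (by positivity) _
  unfold walkConst
  gcongr
  · norm_num
  · lia

/-- A good walk is a self-avoiding path or a lasso, and a lasso is made up of two self-avoiding
paths and one edge once its three times are known. -/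
lemma headBound_good [Nonempty V] {L : ℝ} (hL : 1 ≤ L) (R k : ℕ) :
    HeadBound (goodWalks V k) L R 2 (2 * k) (walkConst L R ^ 4) 16 := by
  intro y S ρ hy hS hρ hSk hyL
  set A := walkConst L R with hA
  have hA3 : 3 ≤ A := three_le_walkConst hL R
  push_cast at hSk
  have hk0 : (0 : ℝ) ≤ k := k.cast_nonneg
  have hS0 : (0 : ℝ) ≤ #S.1 := Nat.cast_nonneg _
  have hL4 : 0 < L ^ 4 := by positivity
  have hpos : 0 < weight (16 * y) S := weight_pos (by positivity) _
  have hAL : L ^ 3 ≤ A := by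
    have h1 : (1 : ℝ) ≤ 4 ^ R := one_le_pow₀ (by norm_num)
    have h2 : 0 ≤ L ^ 3 := by positivity
    rw [hA, walkConst]; nlinarith
  have hAR : (4 : ℝ) ^ R ≤ A := by
    have h2 : 1 ≤ L ^ 3 := one_le_pow₀ hL
    rw [hA, walkConst]
    exact le_mul_of_one_le_right (by positivity) (by linarith)
  set W : ℕ × ℕ × ℕ → Finset (List V) := fun p =>
    {l ∈ listsOf univ k | IsLasso p.1 p.2.1 p.2.2 l} with hW
  -- the lassos with given times `q`, `i`, `j`
  have hlasso : ∀ p ∈ range k ×ˢ range k ×ˢ range k,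
      ∑ l ∈ W p with ∃ a ∈ S.1, l.head? = some a, weight y (S ⊔ supp l) ≤
        A * A * weight (16 * y) S := by
    rintro ⟨q, i, j⟩ hp
    simp only [mem_product, mem_range] at hp
    have := HeadBound.comp (𝒲 := W (q, i, j)) (headBound_nodup (V := V) hL R q)
      (headBound_nodup hL R (k - j)) hL (by positivity) (by norm_num) (by norm_num)
      (r := 2) (by lia) (by lia) (fun α hα => (mem_nodupWalks.1 hα).1.le)
      (fun α hα => isNB_of_nodup (mem_nodupWalks.1 hα).2)
      (fun l => l.take q) (fun l => l.drop j) (closingEdge i)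
      (fun α ε hε w hw => mem_of_mem_closingEdge hε hw) ?_ ?_ ?_ ?_ ?_ ?_ y S ρ hy hS hρ ?_ ?_
    · convert this using 3
      norm_num
    · intro l hl
      simp only [hW, mem_filter, mem_listsOf_univ] at hl
      exact mem_nodupWalks.2 ⟨by rw [List.length_take]; lia, hl.2.2.2.2.1⟩
    · intro l hl
      simp only [hW, mem_filter, mem_listsOf_univ] at hl
      exact mem_nodupWalks.2 ⟨by rw [List.length_drop]; lia, hl.2.2.2.2.2.1⟩
    · intro l hl
      simp only [hW, mem_filter, mem_listsOf_univ] at hl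
      have := hl.2.1
      rw [List.head?_take, if_neg (by lia)]
    · intro l hl
      exact (mem_filter.1 hl).2.head_drop
    · intro l hl
      exact (mem_filter.1 hl).2.supp_eq
    · intro l hl l' hl' h
      simp only [Prod.mk.injEq] at h
      exact (mem_filter.1 hl).2.eq_of (mem_filter.1 hl').2 h.1 h.2
    · have : (((q + (k - j) : ℕ)) : ℝ) ≤ 2 * k := by
        have : q + (k - j) ≤ 2 * k := by lia
        exact_mod_cast this
      linarith
    · norm_num
      linarith
  have hnodup : ∑ l ∈ nodupWalks V k with ∃ a ∈ S.1, l.head? = some a, weight y (S ⊔ supp l) ≤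
      A * A * weight (16 * y) S := by
    refine (headBound_nodup hL R k y S ρ hy hS (by lia) (by linarith) (by linarith)).trans ?_
    rw [mul_assoc]
    refine mul_le_mul_of_nonneg_left ?_ (by positivity)
    refine (weight_le_four_mul (by positivity) hS).trans ?_
    rw [← mul_assoc, show (4 : ℝ) * 4 = 16 by norm_num]
    refine mul_le_mul_of_nonneg_right (le_trans ?_ hAR) hpos.le
    exact pow_le_pow_right₀ (by norm_num) (by lia)
  calc ∑ l ∈ goodWalks V k with ∃ a ∈ S.1, l.head? = some a, weight y (S ⊔ supp l)
      ≤ ∑ l ∈ ({l ∈ nodupWalks V k | ∃ a ∈ S.1, l.head? = some a} : Finset (List V)) ∪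
          (range k ×ˢ range k ×ˢ range k).biUnion
            (fun p => {l ∈ W p | ∃ a ∈ S.1, l.head? = some a}), weight y (S ⊔ supp l) := by
        refine sum_le_sum_of_subset_of_nonneg ?_ fun l _ _ => (weight_pos hy _).le
        intro l hl
        rw [mem_filter, mem_goodWalks] at hl
        rw [mem_union, mem_filter, mem_biUnion]
        by_cases hnd : l.Nodup
        · exact .inl ⟨mem_nodupWalks.2 ⟨hl.1.1, hnd⟩, hl.2⟩
        · right
          obtain ⟨q, i, j, h⟩ := hl.1.2.exists_isLasso hnd
          refine ⟨(q, i, j), ?_, mem_filter.2 ⟨?_, hl.2⟩⟩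
          · have := h.1; have := h.2.1; have := h.2.2.1; have := hl.1.1
            simp only [mem_product, mem_range]
            lia
          · simp only [hW, mem_filter, mem_listsOf_univ]
            exact ⟨hl.1.1, h⟩
    _ ≤ A * A * weight (16 * y) S +
          ∑ p ∈ range k ×ˢ range k ×ˢ range k, A * A * weight (16 * y) S := by
        refine le_trans (le_of_le_of_eq (le_add_of_nonneg_right (sum_nonneg
          fun l _ => (weight_pos hy (S ⊔ supp l)).le)) (sum_union_inter)) ?_
        refine add_le_add hnodup ((sum_biUnion_le _ _ fun l => (weight_pos hy _).le).trans ?_)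
        exact sum_le_sum hlasso
    _ = (1 + (k : ℝ) ^ 3) * (A * A * weight (16 * y) S) := by
        rw [sum_const, nsmul_eq_mul, card_product, card_product, card_range]
        push_cast; ring
    _ ≤ (A ^ 2) * (A * A * weight (16 * y) S) := by
        have h1 : (k : ℝ) ^ 3 ≤ L ^ 3 := by gcongr; linarith
        refine mul_le_mul_of_nonneg_right ?_ (by positivity)
        nlinarith
    _ = A ^ 4 * weight (16 * y) S := by ring

end

/-! ### Tangled walks and closed chains -/

section

variable {V : Type*} [DecidableEq V] [Fintype V]

/-- The non-backtracking walks with `k` vertices that have at least two cycles, but whose tails have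
at most one. -/
noncomputable def tangledWalks (V : Type*) [Fintype V] [DecidableEq V] (k : ℕ) :
    Finset (List V) :=
  {l ∈ listsOf univ k | IsNB l ∧ ¬ IsGood l ∧ IsGood l.tail}

lemma mem_tangledWalks {k : ℕ} {l : List V} :
    l ∈ tangledWalks V k ↔ l.length = k ∧ IsNB l ∧ ¬ IsGood l ∧ IsGood l.tail := by
  simp [tangledWalks]

lemma exists_cons_cons_of_mem_tangledWalks {k : ℕ} {l : List V} (h : l ∈ tangledWalks V k) :
    ∃ a b l', l = a :: b :: l' ∧ a ≠ b := by
  obtain ⟨-, hNB, hg, -⟩ := mem_tangledWalks.1 h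
  match l with
  | [] => exact absurd (isGood_of_nodup List.nodup_nil) hg
  | [a] => exact absurd (isGood_of_nodup (List.nodup_singleton a)) hg
  | a :: b :: l' => exact ⟨a, b, l', rfl, hNB 0 1 a b (by simp) (by simp) (by simp) (by simp)⟩

/-- A tangled walk is a good walk preceded by a single step. -/
lemma headBound_tangled [Nonempty V] {L : ℝ} (hL : 1 ≤ L) (R k : ℕ) :
    HeadBound (tangledWalks V (k + 1)) L R 4 (2 * (k + 1)) (walkConst L R ^ 5) 64 := by
  have hA := three_le_walkConst hL R
  have := HeadBound.comp (𝒲 := tangledWalks V (k + 1)) (headBound_nodup (V := V) hL R 2)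
      (headBound_good hL R k) hL (by positivity) (by norm_num) (by norm_num)
      (r := 4) (by lia) (by lia) (fun α hα => (mem_nodupWalks.1 hα).1.le)
      (fun α hα => isNB_of_nodup (mem_nodupWalks.1 hα).2)
      (fun l => l.take 2) (fun l => l.tail) (fun _ => ∅) (by simp) ?_ ?_ ?_ ?_ ?_ ?_
  · convert this using 1
    · ring
    · ring
    · norm_num
  · intro l hl
    obtain ⟨a, b, l', rfl, hab⟩ := exists_cons_cons_of_mem_tangledWalks hl
    exact mem_nodupWalks.2 ⟨by simp, by simpa using hab⟩
  · intro l hl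
    obtain ⟨h1, -, -, h2⟩ := mem_tangledWalks.1 hl
    exact mem_goodWalks.2 ⟨by rw [List.length_tail]; lia, h2⟩
  · intro l hl
    obtain ⟨a, b, l', rfl, hab⟩ := exists_cons_cons_of_mem_tangledWalks hl
    simp
  · intro l hl
    obtain ⟨a, b, l', rfl, hab⟩ := exists_cons_cons_of_mem_tangledWalks hl
    exact ⟨b, by simp⟩
  · intro l hl
    obtain ⟨a, b, l', rfl, hab⟩ := exists_cons_cons_of_mem_tangledWalks hl
    rw [supp_cons_cons]
    simp only [List.take_succ_cons, List.take_zero, List.tail_cons]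
    have : supp [a, b] ⊔ (∅, ∅) = (({a, b}, {s(a, b)}) : Piece V) := by
      ext x <;> simp [supp]
    rw [this]
  · intro l hl l' hl' h
    obtain ⟨a, b, m, rfl, -⟩ := exists_cons_cons_of_mem_tangledWalks hl
    obtain ⟨a', b', m', rfl, -⟩ := exists_cons_cons_of_mem_tangledWalks hl'
    simp only [List.take_succ_cons, List.take_zero, List.tail_cons, Prod.mk.injEq,
      List.cons.injEq, and_true] at h ⊢
    exact ⟨h.1.1, h.2⟩

lemma headBound_tangled_reverse [Nonempty V] {L : ℝ} (hL : 1 ≤ L) (R k : ℕ) :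
    HeadBound ((tangledWalks V (k + 1)).image List.reverse) L R 4 (2 * (k + 1))
      (walkConst L R ^ 5) 64 := by
  have hA := three_le_walkConst hL R
  have hform : ∀ m ∈ (tangledWalks V (k + 1)).image List.reverse, ∃ a b l', a ≠ b ∧
      m = l'.reverse ++ [b, a] ∧ (a :: b :: l') ∈ tangledWalks V (k + 1) := by
    intro m hm
    obtain ⟨l, hl, rfl⟩ := mem_image.1 hm
    obtain ⟨a, b, l', rfl, hab⟩ := exists_cons_cons_of_mem_tangledWalks hl
    exact ⟨a, b, l', hab, by simp, hl⟩
  have hdl : ∀ (l : List V) (a b : V), (l ++ [b, a]).dropLast = l ++ [b] := by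
    intro l a b
    rw [show l ++ [b, a] = (l ++ [b]) ++ [a] by simp, List.dropLast_concat]
  have hdr : ∀ (l : List V) (a b : V), l.length + 1 = k → (l ++ [b, a]).drop (k - 1) = [b, a] := by
    intro l a b h
    rw [show k - 1 = l.length by lia, List.drop_left]
  have := HeadBound.comp (𝒲 := (tangledWalks V (k + 1)).image List.reverse)
      (𝒲₂ := nodupWalks V 2) (r₂ := 0) (K₁ := 2 * k)
      (headBound_good (V := V) hL R k)
      (headBound_nodup hL R 2) hL (by positivity) (by norm_num) (by norm_num)
      (r := 4) (by lia) (by lia) (fun α hα => by have := (mem_goodWalks.1 hα).1; lia)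
      (fun α hα => (mem_goodWalks.1 hα).2.1)
      (fun l => l.dropLast) (fun l => l.drop (k - 1)) (fun _ => ∅) (by simp) ?_ ?_ ?_ ?_ ?_ ?_
  · convert this using 1
    · ring
    · ring
    · norm_num
  · intro m hm
    obtain ⟨a, b, l, hab, rfl, hl⟩ := hform m hm
    obtain ⟨h1, -, -, h2⟩ := mem_tangledWalks.1 hl
    refine mem_goodWalks.2 ⟨by simp at h1 ⊢; lia, ?_⟩
    rw [hdl]
    simpa using h2.reverse
  · intro m hm
    obtain ⟨a, b, l, hab, rfl, hl⟩ := hform m hm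
    obtain ⟨h1, -, -, h2⟩ := mem_tangledWalks.1 hl
    rw [hdr _ _ _ (by simp at h1 ⊢; lia)]
    exact mem_nodupWalks.2 ⟨by simp, by simpa using hab.symm⟩
  · intro m hm
    obtain ⟨a, b, l, hab, rfl, hl⟩ := hform m hm
    rw [hdl, List.head?_append, List.head?_append]
    simp
  · intro m hm
    obtain ⟨a, b, l, hab, rfl, hl⟩ := hform m hm
    obtain ⟨h1, -, -, h2⟩ := mem_tangledWalks.1 hl
    rw [hdr _ _ _ (by simp at h1 ⊢; lia), hdl]
    exact ⟨b, by simp⟩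
  · intro m hm
    obtain ⟨a, b, l, hab, rfl, hl⟩ := hform m hm
    obtain ⟨h1, -, -, h2⟩ := mem_tangledWalks.1 hl
    rw [hdr _ _ _ (by simp at h1 ⊢; lia), hdl]
    ext x
    · simp only [supp, Prod.fst_sup, sup_eq_union, union_empty, mem_union, List.mem_toFinset,
        List.mem_append, List.mem_cons, List.not_mem_nil, or_false]
      tauto
    · simp only [supp, Prod.snd_sup, sup_eq_union, union_empty, mem_union, walkEdges,
        edgeList_append_pair, List.mem_toFinset, List.mem_append, edgeList_cons_cons,
        edgeList_singleton]
  · intro m hm m' hm' h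
    obtain ⟨a, b, l, hab, rfl, hl⟩ := hform m hm
    obtain ⟨a', b', l', hab', rfl, hl'⟩ := hform m' hm'
    have h1 := (mem_tangledWalks.1 hl).1
    have h1' := (mem_tangledWalks.1 hl').1
    simp only [Prod.mk.injEq] at h
    rw [hdl, hdl, hdr _ _ _ (by simp at h1 ⊢; lia), hdr _ _ _ (by simp at h1' ⊢; lia)] at h
    obtain ⟨h2, h3⟩ := h
    obtain ⟨h4, -⟩ := List.append_inj h2 (by simp at h1 h1' ⊢; lia)
    rw [h4, h3]

lemma image_reverse_goodWalks (k : ℕ) :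
    (goodWalks V k).image List.reverse = goodWalks V k := by
  ext l
  rw [mem_image]
  constructor
  · rintro ⟨m, hm, rfl⟩
    rw [mem_goodWalks] at hm ⊢
    exact ⟨by simpa using hm.1, hm.2.reverse⟩
  · intro hl
    rw [mem_goodWalks] at hl
    exact ⟨l.reverse, mem_goodWalks.2 ⟨by simpa using hl.1, hl.2.reverse⟩, by simp⟩

/-- The bound for walks that end in the piece `S`, from the one for the reversed walks. -/
lemma HeadBound.sum_getLast_le {𝒲 : Finset (List V)} {L : ℝ} {R r K : ℕ} {C c : ℝ}
    (h : HeadBound (𝒲.image List.reverse) L R r K C c) {y : ℝ} {S : Piece V} {ρ : ℕ} (hy : 0 < y)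
    (hS : Inv ρ S) (hρ : ρ + r ≤ R) (hK : (#S.1 : ℝ) + K ≤ L) (hyL : c * y * (3 * L ^ 4) ≤ 1) :
    ∑ l ∈ 𝒲 with ∃ a ∈ S.1, l.getLast? = some a, weight y (S ⊔ supp l) ≤
      C * weight (c * y) S := by
  refine le_trans (le_of_eq ?_) (h y S ρ hy hS hρ hK hyL)
  rw [filter_image, sum_image (fun x _ y _ h => List.reverse_injective h)]
  simp

/-- The total weight of the chains of `m` pairs of walks of `𝒲` attached to the piece `S`: the
first walk of each pair starts in the piece swept out so far, and the second one ends in it. -/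
noncomputable def chainSum (y : ℝ) (𝒲 : Finset (List V)) : ℕ → Piece V → ℝ
  | 0, S => weight y S
  | m + 1, S => ∑ l ∈ 𝒲 with ∃ a ∈ S.1, l.head? = some a,
      ∑ l' ∈ 𝒲 with ∃ a ∈ (S ⊔ supp l).1, l'.getLast? = some a,
        chainSum y 𝒲 m (S ⊔ supp l ⊔ supp l')

lemma chainSum_nonneg [Nonempty V] {y : ℝ} (hy : 0 < y) (𝒲 : Finset (List V)) (m : ℕ) :
    ∀ S, 0 ≤ chainSum y 𝒲 m S := by
  induction m with
  | zero => exact fun S => (weight_pos hy S).le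
  | succ m ih => exact fun S => sum_nonneg fun l _ => sum_nonneg fun l' _ => ih _

lemma chainSum_le [Nonempty V] {𝒲 : Finset (List V)} {L : ℝ} {R r K : ℕ} {C c : ℝ}
    (h : HeadBound 𝒲 L R r K C c) (h' : HeadBound (𝒲.image List.reverse) L R r K C c)
    (hC : 0 ≤ C) (hc : 1 ≤ c) (hNB : ∀ l ∈ 𝒲, IsNB l) (hlen : ∀ l ∈ 𝒲, l.length ≤ K)
    (m : ℕ) :
    ∀ (y : ℝ) (S : Piece V) (ρ : ℕ), 0 < y → Inv ρ S → ρ + 4 * m + r ≤ R →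
      (#S.1 : ℝ) + (2 * m) * K ≤ L → (c ^ 2) ^ m * y * (3 * L ^ 4) ≤ 1 →
      chainSum y 𝒲 m S ≤ (C ^ 2) ^ m * weight ((c ^ 2) ^ m * y) S := by
  induction m with
  | zero => intro y S ρ hy _ _ _ _; simp [chainSum]
  | succ m ih =>
    intro y S ρ hy hS hρ hK hyL
    push_cast at hK
    have hK0 : (0 : ℝ) ≤ K := K.cast_nonneg
    have hm0 : (0 : ℝ) ≤ m := m.cast_nonneg
    have hmK : 0 ≤ (m : ℝ) * K := by positivity
    have hcm : (1 : ℝ) ≤ (c ^ 2) ^ m := one_le_pow₀ (one_le_pow₀ hc)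
    set z := (c ^ 2) ^ m * y with hz
    have hz0 : 0 < z := by positivity
    have e1 : (c ^ 2) ^ (m + 1) * y = c * (c * z) := by rw [hz, pow_succ]; ring
    have hL4 : 0 ≤ 3 * L ^ 4 := by positivity
    rw [e1] at hyL ⊢
    have hcz : c * z * (3 * L ^ 4) ≤ 1 := by
      refine le_trans ?_ hyL
      refine mul_le_mul_of_nonneg_right ?_ hL4
      exact le_mul_of_one_le_left (by positivity) hc
    have hzL : z * (3 * L ^ 4) ≤ 1 := by
      refine le_trans ?_ hcz
      refine mul_le_mul_of_nonneg_right ?_ hL4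
      exact le_mul_of_one_le_left (by positivity) hc
    have hcard : ∀ (S : Piece V), ∀ l ∈ 𝒲, (#(S ⊔ supp l).1 : ℝ) ≤ #S.1 + K := by
      intro S l hl
      have h1 : #(S ⊔ supp l).1 ≤ #S.1 + K :=
        (card_sup_supp_le S l).trans (by have := hlen l hl; lia)
      exact_mod_cast h1
    rw [chainSum]
    calc _ ≤ ∑ l ∈ 𝒲 with ∃ a ∈ S.1, l.head? = some a,
          (C ^ 2) ^ m * (C * weight (c * z) (S ⊔ supp l)) := by
          refine sum_le_sum fun l hl => ?_
          obtain ⟨hl, a, ha, hla⟩ := mem_filter.1 hl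
          have hS' := hS.sup_supp (hNB l hl) (.inl hla) ha
          have hc' := hcard S l hl
          refine (sum_le_sum (g := fun l' => (C ^ 2) ^ m * weight z (S ⊔ supp l ⊔ supp l'))
            fun l' hl' => ?_).trans ?_
          · obtain ⟨hl', b, hb, hlb⟩ := mem_filter.1 hl'
            have hS'' := hS'.sup_supp (hNB l' hl') (.inr hlb) hb
            refine ih y _ _ hy hS'' (by lia) ?_ hzL
            have := hcard (S ⊔ supp l) l' hl'
            linarith
          · rw [← mul_sum]
            refine mul_le_mul_of_nonneg_left ?_ (by positivity)
            exact h'.sum_getLast_le hz0 hS' (by lia) (by linarith) hcz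
      _ = (C ^ 2) ^ m * C * ∑ l ∈ 𝒲 with ∃ a ∈ S.1, l.head? = some a,
          weight (c * z) (S ⊔ supp l) := by
          rw [mul_sum]; exact sum_congr rfl fun l _ => by ring
      _ ≤ (C ^ 2) ^ m * C * (C * weight (c * (c * z)) S) := by
          refine mul_le_mul_of_nonneg_left ?_ (by positivity)
          exact h (c * z) S ρ (by positivity) hS (by lia) (by linarith) hyL
      _ = _ := by ring

section Chains

/-- The walk `l` starts with the directed edge `e`. -/
def StartsWith (l : List V) (e : OrderedPair V) : Prop := [e.1.1, e.1.2] <+: l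

/-- The walk `l` ends with the directed edge `f`. -/
def EndsWith (l : List V) (f : OrderedPair V) : Prop := [f.1.1, f.1.2] <:+ l

noncomputable instance (l : List V) (e : OrderedPair V) : Decidable (StartsWith l e) :=
  Classical.propDecidable _

noncomputable instance (l : List V) (e : OrderedPair V) : Decidable (EndsWith l e) :=
  Classical.propDecidable _

lemma startsWith_cons_cons {a b : V} {l : List V} {e : OrderedPair V} :
    StartsWith (a :: b :: l) e ↔ e.1.1 = a ∧ e.1.2 = b := by
  simp [StartsWith, List.cons_prefix_cons]

lemma StartsWith.exists_eq {l : List V} {e : OrderedPair V} (h : StartsWith l e) :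
    ∃ l', l = e.1.1 :: e.1.2 :: l' := by
  obtain ⟨t, rfl⟩ := h
  exact ⟨t, rfl⟩

lemma EndsWith.exists_eq {l : List V} {e : OrderedPair V} (h : EndsWith l e) :
    ∃ l', l = l' ++ [e.1.1, e.1.2] := by
  obtain ⟨t, rfl⟩ := h
  exact ⟨t, rfl⟩

lemma StartsWith.unique {l : List V} {e e' : OrderedPair V} (h : StartsWith l e)
    (h' : StartsWith l e') : e = e' := by
  obtain ⟨t, rfl⟩ := h.exists_eq
  obtain ⟨h1, h2⟩ := startsWith_cons_cons.1 h'
  exact Subtype.ext (Prod.ext h1.symm h2.symm)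

lemma EndsWith.unique {l : List V} {e e' : OrderedPair V} (h : EndsWith l e)
    (h' : EndsWith l e') : e = e' := by
  obtain ⟨t, rfl⟩ := h.exists_eq
  obtain ⟨t', ht⟩ := h'.exists_eq
  have := (List.append_inj' ht rfl).2
  simp only [List.cons.injEq, and_true] at this
  exact Subtype.ext (Prod.ext this.1 this.2)

/-- A pair of walks, together with the directed edge at which both end, and the directed edge with
which the second one starts. -/
abbrev WalkPair (V : Type*) := List V × OrderedPair V × List V × OrderedPair V

/-- The walks of the pair end with the recorded edge; the first one starts with `e`, and the second
one with the recorded edge. -/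
def PairFrom (e : OrderedPair V) (π : WalkPair V) : Prop :=
  StartsWith π.1 e ∧ EndsWith π.1 π.2.1 ∧ EndsWith π.2.2.1 π.2.1 ∧ StartsWith π.2.2.1 π.2.2.2

/-- The pairs of walks can be traversed one after the other from `e` to `e'`, the second walk of
each pair being reversed. -/
def IsChain : OrderedPair V → List (WalkPair V) → OrderedPair V → Prop
  | e, [], e' => e = e'
  | e, π :: Γ, e' => PairFrom e π ∧ IsChain π.2.2.2 Γ e'

noncomputable instance (e : OrderedPair V) (π : WalkPair V) : Decidable (PairFrom e π) :=
  Classical.propDecidable _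

noncomputable instance (e e' : OrderedPair V) (Γ : List (WalkPair V)) :
    Decidable (IsChain e Γ e') := Classical.propDecidable _

/-- The vertices and edges visited by the walks of a chain. -/
def chainSupp : List (WalkPair V) → Piece V
  | [] => (∅, ∅)
  | π :: Γ => supp π.1 ⊔ supp π.2.2.1 ⊔ chainSupp Γ

/-- The walk pairs with both walks in `𝒲`. -/
def walkPairs (𝒲 : Finset (List V)) : Finset (WalkPair V) := 𝒲 ×ˢ univ ×ˢ 𝒲 ×ˢ univ

lemma mem_walkPairs {𝒲 : Finset (List V)} {π : WalkPair V} :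
    π ∈ walkPairs 𝒲 ↔ π.1 ∈ 𝒲 ∧ π.2.2.1 ∈ 𝒲 := by
  simp [walkPairs]

lemma sum_openChains_le_aux [Nonempty V] {y : ℝ} (hy : 0 < y) (𝒲 : Finset (List V)) {m : ℕ}
    (ih : ∀ (e : OrderedPair V) (S : Piece V), e.1.1 ∈ S.1 →
      ∑ Γ ∈ listsOf (walkPairs 𝒲) m, (if ∃ e', IsChain e Γ e' then
        weight y (S ⊔ chainSupp Γ) else 0) ≤ chainSum y 𝒲 m S)
    (e : OrderedPair V) (S : Piece V) :
    ∑ Γ ∈ listsOf (walkPairs 𝒲) (m + 1), (if ∃ e', IsChain e Γ e' then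
        weight y (S ⊔ chainSupp Γ) else 0) ≤
      ∑ l ∈ 𝒲 with StartsWith l e, ∑ l' ∈ 𝒲 with ∃ a ∈ (S ⊔ supp l).1, l'.getLast? = some a,
        chainSum y 𝒲 m (S ⊔ supp l ⊔ supp l') := by
  classical
  rw [sum_listsOf_succ]
  calc _ ≤ ∑ π ∈ walkPairs 𝒲, if PairFrom e π then
        chainSum y 𝒲 m (S ⊔ supp π.1 ⊔ supp π.2.2.1) else 0 := by
        refine sum_le_sum fun π _ => ?_
        by_cases hπ : PairFrom e π
        · rw [if_pos hπ]
          refine le_trans (le_of_eq (sum_congr rfl fun Γ _ => ?_)) (ih π.2.2.2 _ ?_)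
          · simp only [IsChain, hπ, true_and, chainSupp, ← sup_assoc]
          · obtain ⟨t, ht⟩ := hπ.2.2.2.exists_eq
            simp [supp, ht]
        · rw [if_neg hπ]
          refine (sum_eq_zero fun Γ _ => if_neg ?_).le
          rintro ⟨e', h⟩
          exact hπ h.1
    _ = ∑ π ∈ walkPairs 𝒲 with PairFrom e π, chainSum y 𝒲 m (S ⊔ supp π.1 ⊔ supp π.2.2.1) := by
        rw [sum_filter]
    _ = ∑ p ∈ ({π ∈ walkPairs 𝒲 | PairFrom e π} : Finset (WalkPair V)).image
          (fun π => (⟨π.1, π.2.2.1⟩ : (_ : List V) × List V)),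
          chainSum y 𝒲 m (S ⊔ supp p.1 ⊔ supp p.2) := by
        rw [sum_image]
        rintro ⟨l, f, l', e'⟩ hx ⟨l2, f2, l2', e2'⟩ hy h
        simp only [Sigma.mk.injEq, heq_eq_eq] at h
        obtain ⟨rfl, rfl⟩ := h
        have h1 := (mem_filter.1 hx).2
        have h2 := (mem_filter.1 hy).2
        obtain rfl : f = f2 := h1.2.1.unique h2.2.1
        obtain rfl : e' = e2' := h1.2.2.2.unique h2.2.2.2
        rfl
    _ ≤ ∑ p ∈ ({l ∈ 𝒲 | StartsWith l e} : Finset (List V)).sigma fun l =>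
          ({l' ∈ 𝒲 | ∃ a ∈ (S ⊔ supp l).1, l'.getLast? = some a} : Finset (List V)),
          chainSum y 𝒲 m (S ⊔ supp p.1 ⊔ supp p.2) := by
        refine sum_le_sum_of_subset_of_nonneg ?_ fun _ _ _ => chainSum_nonneg hy _ _ _
        intro p hp
        obtain ⟨π, hπ, rfl⟩ := mem_image.1 hp
        obtain ⟨hπ, h1, h2, h3, -⟩ := mem_filter.1 hπ
        obtain ⟨hl, hl'⟩ := mem_walkPairs.1 hπ
        rw [mem_sigma, mem_filter, mem_filter]
        refine ⟨⟨hl, h1⟩, hl', π.2.1.1.2, ?_, ?_⟩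
        · obtain ⟨t, ht⟩ := h2.exists_eq
          simp [supp, ht]
        · obtain ⟨t, ht⟩ := h3.exists_eq
          simp [ht]
    _ = _ := by rw [sum_sigma]

lemma sum_openChains_le [Nonempty V] {y : ℝ} (hy : 0 < y) (𝒲 : Finset (List V)) (m : ℕ) :
    ∀ (e : OrderedPair V) (S : Piece V), e.1.1 ∈ S.1 →
      ∑ Γ ∈ listsOf (walkPairs 𝒲) m, (if ∃ e', IsChain e Γ e' then
        weight y (S ⊔ chainSupp Γ) else 0) ≤ chainSum y 𝒲 m S := by
  induction m with
  | zero =>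
    intro e S _
    have : S ⊔ ((∅, ∅) : Piece V) = S := by ext x <;> simp
    rw [listsOf, sum_singleton, if_pos ⟨e, rfl⟩, chainSupp, this, chainSum]
  | succ m ih =>
    intro e S he
    refine (sum_openChains_le_aux hy 𝒲 ih e S).trans ?_
    rw [chainSum]
    refine sum_le_sum_of_subset_of_nonneg ?_
      fun l _ _ => sum_nonneg fun _ _ => chainSum_nonneg hy _ _ _
    intro l hl
    rw [mem_filter] at hl ⊢
    obtain ⟨t, ht⟩ := hl.2.exists_eq
    exact ⟨hl.1, e.1.1, he, by simp [ht]⟩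

/-- The sum over all chains, whatever their first edge. -/
lemma sum_sum_chains_le [Nonempty V] {y : ℝ} (hy : 0 < y) (𝒲 : Finset (List V)) (m : ℕ) :
    ∑ e : OrderedPair V, ∑ Γ ∈ listsOf (walkPairs 𝒲) (m + 1), (if IsChain e Γ e then
        weight y (chainSupp Γ) else 0) ≤ ∑ u : V, chainSum y 𝒲 (m + 1) ({u}, ∅) := by
  classical
  rw [← sum_fiberwise (s := univ) (g := fun e : OrderedPair V => e.1.1)]
  refine sum_le_sum fun u _ => ?_
  calc _ ≤ ∑ e : OrderedPair V with e.1.1 = u, ∑ l ∈ 𝒲 with StartsWith l e,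
        ∑ l' ∈ 𝒲 with ∃ a ∈ (({u}, ∅) ⊔ supp l).1, l'.getLast? = some a,
        chainSum y 𝒲 m (({u}, ∅) ⊔ supp l ⊔ supp l') := by
        refine sum_le_sum fun e he => ?_
        refine le_trans (sum_le_sum fun Γ hΓ => ?_)
          (sum_openChains_le_aux hy 𝒲 (sum_openChains_le hy 𝒲 m) e ({u}, ∅))
        by_cases h : IsChain e Γ e
        · rw [if_pos h, if_pos ⟨e, h⟩]
          cases Γ with
          | nil => simp [mem_listsOf] at hΓ
          | cons π Γ =>
            obtain ⟨t, ht⟩ := h.1.1.exists_eq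
            have hu : (({u}, ∅) : Piece V) ⊔ supp π.1 = supp π.1 := by
              have : u ∈ (supp π.1).1 := by simp [supp, ht, ← (mem_filter.1 he).2]
              refine sup_eq_right.2 ⟨?_, empty_subset _⟩
              simpa using this
            rw [chainSupp, ← sup_assoc, ← sup_assoc, hu]
        · rw [if_neg h]
          split_ifs
          · exact (weight_pos hy _).le
          · exact le_rfl
    _ = ∑ p ∈ ({e : OrderedPair V | e.1.1 = u} : Finset _).sigma fun e =>
          ({l ∈ 𝒲 | StartsWith l e} : Finset (List V)),
        ∑ l' ∈ 𝒲 with ∃ a ∈ (({u}, ∅) ⊔ supp p.2).1, l'.getLast? = some a,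
        chainSum y 𝒲 m (({u}, ∅) ⊔ supp p.2 ⊔ supp l') := by rw [sum_sigma]
    _ = ∑ l ∈ (({e : OrderedPair V | e.1.1 = u} : Finset _).sigma fun e =>
          ({l ∈ 𝒲 | StartsWith l e} : Finset (List V))).image (fun p => p.2),
        ∑ l' ∈ 𝒲 with ∃ a ∈ (({u}, ∅) ⊔ supp l).1, l'.getLast? = some a,
        chainSum y 𝒲 m (({u}, ∅) ⊔ supp l ⊔ supp l') := by
        rw [sum_image]
        rintro ⟨e, l⟩ h1 ⟨e', l'⟩ h2 h
        simp only [coe_sigma, coe_filter, Set.mem_sigma_iff, Set.mem_ofPred_eq] at h1 h2 h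
        subst h
        rw [h1.2.2.unique h2.2.2]
    _ ≤ _ := by
        rw [chainSum]
        refine sum_le_sum_of_subset_of_nonneg ?_
          fun l _ _ => sum_nonneg fun _ _ => chainSum_nonneg hy _ _ _
        intro l hl
        obtain ⟨p, hp, rfl⟩ := mem_image.1 hl
        simp only [mem_sigma, mem_filter, mem_univ, true_and] at hp
        obtain ⟨t, ht⟩ := hp.2.2.exists_eq
        exact mem_filter.2 ⟨hp.2.1, u, by simp, by rw [ht, ← hp.1]; rfl⟩

/-- Traversing a chain from a vertex of a piece adds at least as many edges as vertices. -/
lemma excess_chain {Γ : List (WalkPair V)} : ∀ {e e' : OrderedPair V} {S : Piece V},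
    (∀ ε ∈ S.2, ∀ w ∈ ε, w ∈ S.1) → e.1.1 ∈ S.1 → IsChain e Γ e' →
      #(S ⊔ chainSupp Γ).1 + #S.2 ≤ #S.1 + #(S ⊔ chainSupp Γ).2 := by
  induction Γ with
  | nil => intro e e' S _ _ _; simp [chainSupp]
  | cons π Γ ih =>
    rintro e e' S hS he ⟨⟨h1, h2, h3, h4⟩, hΓ⟩
    have hS1 := valid_sup hS (valid_supp π.1)
    have hS2 := valid_sup hS1 (valid_supp π.2.2.1)
    have e1 : #(S ⊔ supp π.1).1 + #S.2 ≤ #S.1 + #(S ⊔ supp π.1).2 := by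
      obtain ⟨t, ht⟩ := h1.exists_eq
      rw [ht]
      exact excess_supp hS he
    have e2 : #(S ⊔ supp π.1 ⊔ supp π.2.2.1).1 + #(S ⊔ supp π.1).2 ≤
        #(S ⊔ supp π.1).1 + #(S ⊔ supp π.1 ⊔ supp π.2.2.1).2 := by
      obtain ⟨t, ht⟩ := h2.exists_eq
      obtain ⟨t', ht'⟩ := h3.exists_eq
      rw [← supp_reverse π.2.2.1]
      have : π.2.2.1.reverse = π.2.1.1.2 :: π.2.1.1.1 :: t'.reverse := by simp [ht']
      rw [this]
      exact excess_supp hS1 (by simp [supp, ht])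
    have e3 := ih (e := π.2.2.2) (e' := e') (S := S ⊔ supp π.1 ⊔ supp π.2.2.1) hS2
      (by obtain ⟨t, ht⟩ := h4.exists_eq; simp [supp, ht]) hΓ
    rw [chainSupp, ← sup_assoc, ← sup_assoc]
    lia

/-- If the walks of `𝒲` have at least `g - 1` more edges than vertices, then so have chains. -/
lemma excess_closedChain {𝒲 : Finset (List V)} {g m : ℕ}
    (hg : ∀ l ∈ 𝒲, #l.toFinset + g ≤ #(walkEdges l) + 1) {e : OrderedPair V}
    {Γ : List (WalkPair V)} (hΓ : Γ ∈ listsOf (walkPairs 𝒲) (m + 1)) (h : IsChain e Γ e) :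
    #(chainSupp Γ).1 + g ≤ #(chainSupp Γ).2 + 1 := by
  cases Γ with
  | nil => simp [mem_listsOf] at hΓ
  | cons π Γ =>
    have hπ := mem_walkPairs.1 ((mem_listsOf.1 hΓ).2 π (by simp))
    have h1 := hg _ hπ.1
    obtain ⟨t, ht⟩ := h.1.1.exists_eq
    have h2 := excess_chain (S := supp π.1) (valid_supp _) (by simp [supp, ht]) h
    have h3 : supp π.1 ⊔ chainSupp (π :: Γ) = chainSupp (π :: Γ) := by
      rw [chainSupp, ← sup_assoc, ← sup_assoc, sup_idem]
    rw [h3] at h2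
    simp only [supp] at h2
    lia

/-- The bound on the number of closed chains, weighted by a factor `n⁻¹` per edge: each unit of the
excess `g` gains a factor of the order of `n⁻¹`. -/
theorem sum_closedChains_le [Nonempty V] {𝒲 : Finset (List V)} {L : ℝ} {R r K : ℕ} {C c : ℝ}
    (h : HeadBound 𝒲 L R r K C c) (h' : HeadBound (𝒲.image List.reverse) L R r K C c)
    (hC : 0 ≤ C) (hc : 1 ≤ c) (hNB : ∀ l ∈ 𝒲, IsNB l) (hlen : ∀ l ∈ 𝒲, l.length ≤ K)
    {g m : ℕ} (hg : ∀ l ∈ 𝒲, #l.toFinset + g ≤ #(walkEdges l) + 1) {y : ℝ} (hy : 0 < y)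
    (hm : m ≠ 0) (hR : 1 + 4 * m + r ≤ R) (hK : 1 + (2 * m) * (K : ℝ) ≤ L)
    (hyL : (c ^ 2) ^ m * y * (3 * L ^ 4) ≤ 1) (hny : 1 ≤ (Fintype.card V : ℝ) * y) :
    ∑ e : OrderedPair V, ∑ Γ ∈ listsOf (walkPairs 𝒲) m, (if IsChain e Γ e then
        (Fintype.card V : ℝ)⁻¹ ^ #(chainSupp Γ).2 else 0) ≤
      Fintype.card V / ((Fintype.card V : ℝ) * y) ^ g * (C ^ 2) ^ m := by
  have hn : (0 : ℝ) < Fintype.card V := by exact_mod_cast Fintype.card_pos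
  obtain ⟨m, rfl⟩ := Nat.exists_eq_succ_of_ne_zero hm
  set n := (Fintype.card V : ℝ) with hndef
  have hcm : (1 : ℝ) ≤ (c ^ 2) ^ (m + 1) := one_le_pow₀ (one_le_pow₀ hc)
  have hy0 : n * y ≠ 0 := by positivity
  calc _ ≤ ∑ e : OrderedPair V, ∑ Γ ∈ listsOf (walkPairs 𝒲) (m + 1), (n * y) / (n * y) ^ g *
        (if IsChain e Γ e then weight y (chainSupp Γ) else 0) := by
        refine sum_le_sum fun e _ => sum_le_sum fun Γ hΓ => ?_
        split_ifs with hch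
        · have hex := excess_closedChain hg hΓ hch
          set v := #(chainSupp Γ).1
          set E := #(chainSupp Γ).2
          rw [weight, ← hndef]
          have h1 : n⁻¹ ^ E = (n * y)⁻¹ ^ E * y ^ E := by
            rw [← mul_pow]; congr 1; field_simp
          rw [h1, ← mul_assoc]
          refine mul_le_mul_of_nonneg_right ?_ (by positivity)
          rw [inv_pow, inv_pow, div_mul_eq_mul_div, ← div_eq_mul_inv, div_div,
            le_div_iff₀ (by positivity), inv_mul_eq_div, div_le_iff₀ (by positivity), ← pow_add,
            ← pow_succ']
          exact pow_le_pow_right₀ hny hex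
        · simp
    _ = (n * y) / (n * y) ^ g * ∑ e : OrderedPair V, ∑ Γ ∈ listsOf (walkPairs 𝒲) (m + 1),
        (if IsChain e Γ e then weight y (chainSupp Γ) else 0) := by
        simp only [mul_sum]
    _ ≤ (n * y) / (n * y) ^ g * ∑ u : V, chainSum y 𝒲 (m + 1) ({u}, ∅) := by
        refine mul_le_mul_of_nonneg_left (sum_sum_chains_le hy 𝒲 m) (by positivity)
    _ ≤ (n * y) / (n * y) ^ g * ∑ u : V, (C ^ 2) ^ (m + 1) * (n * y)⁻¹ := by
        refine mul_le_mul_of_nonneg_left (sum_le_sum fun u _ => ?_) (by positivity)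
        refine (chainSum_le h h' hC hc hNB hlen (m + 1) y ({u}, ∅) 1 hy (Inv.singleton u) hR
          (by simpa using hK) hyL).trans ?_
        refine mul_le_mul_of_nonneg_left ?_ (by positivity)
        simp only [weight, card_singleton, pow_one, card_empty, pow_zero, mul_one]
        rw [← hndef]
        gcongr
        exact le_mul_of_one_le_left hy.le hcm
    _ = _ := by
        rw [sum_const, card_univ, nsmul_eq_mul, ← hndef]
        field_simp

end Chains

end

/-! ### Centred edge weights of the random graph -/

section

open MeasureTheory

instance {V : Type*} [Countable V] : MeasurableSingletonClass (SimpleGraph V) where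
  measurableSet_singleton G := by
    have : ({G} : Set (SimpleGraph V)) = SimpleGraph.edgeSet ⁻¹' {G.edgeSet} := by
      ext H; simp
    rw [this]
    exact SimpleGraph.measurable_edgeSet (measurableSet_singleton _)

variable {V : Type*} [DecidableEq V] [Fintype V]

lemma binomialRandom_real_singleton (p : unitInterval) (G : SimpleGraph V) [DecidableRel G.Adj] :
    (SimpleGraph.binomialRandom V p).real {G} =
      ∏ ε : Sym2 V with ¬ ε.IsDiag, if ε ∈ G.edgeFinset then (p : ℝ) else 1 - p := by
  classical
  have hsub : G.edgeFinset ⊆ ({ε | ¬ ε.IsDiag} : Finset (Sym2 V)) := by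
    intro ε hε
    simpa using G.not_isDiag_of_mem_edgeFinset hε
  have hcard : #({ε | ¬ ε.IsDiag} : Finset (Sym2 V)) = (Nat.card V).choose 2 := by
    rw [Nat.card_eq_fintype_card, ← Sym2.card_subtype_not_diag, Fintype.card_subtype]
  rw [Measure.real, SimpleGraph.binomialRandom_singleton, ENNReal.toReal_mul, ENNReal.toReal_pow,
    ENNReal.toReal_pow, prod_ite, prod_const, prod_const, filter_mem_eq_inter,
    inter_eq_right.2 hsub]
  have h1 : G.edgeSet.ncard = #G.edgeFinset := by
    rw [← SimpleGraph.coe_edgeFinset, Set.ncard_coe_finset]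
  have h2 : #({ε ∈ ({ε | ¬ ε.IsDiag} : Finset (Sym2 V)) | ε ∉ G.edgeFinset}) =
      (Nat.card V).choose 2 - #G.edgeFinset := by
    rw [← sdiff_eq_filter, card_sdiff_of_subset hsub, hcard]
  rw [h1, h2]
  simp

/-- Distinct edges are present independently of each other. -/
lemma integral_prod_edges (p : unitInterval) (F : Finset (Sym2 V)) (hF : ∀ ε ∈ F, ¬ ε.IsDiag)
    (φ : Sym2 V → Prop → ℝ) :
    ∫ G, ∏ ε ∈ F, φ ε (ε ∈ G.edgeSet) ∂(SimpleGraph.binomialRandom V p) =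
      ∏ ε ∈ F, (p * φ ε True + (1 - p) * φ ε False) := by
  classical
  set U : Finset (Sym2 V) := {ε | ¬ ε.IsDiag} with hU
  set ψ : Sym2 V → Prop → ℝ := fun ε b => if ε ∈ F then φ ε b else 1 with hψ
  have hFU : F ⊆ U := fun ε hε => by simpa [hU] using hF ε hε
  have hext : ∀ g : Sym2 V → ℝ, ∏ ε ∈ F, g ε = ∏ ε ∈ U, if ε ∈ F then g ε else 1 := by
    intro g
    rw [prod_ite_mem, inter_eq_right.2 hFU]
  rw [integral_fintype Integrable.of_finite]
  have hR : ∏ ε ∈ F, (p * φ ε True + (1 - p) * φ ε False) =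
      ∏ ε ∈ U, (p * ψ ε True + (1 - p) * ψ ε False) := by
    rw [hext]
    refine prod_congr rfl fun ε _ => ?_
    simp only [hψ]
    split_ifs
    · rfl
    · ring
  rw [hR, prod_add]
  refine sum_bij' (fun G _ => G.edgeFinset) (fun S _ => SimpleGraph.fromEdgeSet (S : Set (Sym2 V)))
    ?_ ?_ ?_ ?_ ?_
  · intro G _
    rw [mem_powerset]
    intro ε hε
    simpa [hU] using G.not_isDiag_of_mem_edgeFinset hε
  · simp
  · intro G _
    simp
  · intro S hS
    ext ε
    rw [mem_powerset] at hS
    simp only [SimpleGraph.mem_edgeFinset, SimpleGraph.edgeSet_fromEdgeSet, Set.mem_sdiff, mem_coe]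
    refine ⟨fun h => h.1, fun h => ⟨h, ?_⟩⟩
    simpa [hU] using hS h
  · intro G _
    have hsub : G.edgeFinset ⊆ U := by
      intro ε hε
      simpa [hU] using G.not_isDiag_of_mem_edgeFinset hε
    rw [binomialRandom_real_singleton, hext, smul_eq_mul, ← hU, ← prod_mul_distrib,
      ← prod_sdiff hsub, mul_comm]
    congr 1
    · refine prod_congr rfl fun ε hε => ?_
      have h : ε ∈ G.edgeSet := by simpa using hε
      simp [h, hψ]
    · refine prod_congr rfl fun ε hε => ?_
      have h : ε ∉ G.edgeSet := by simpa using (mem_sdiff.1 hε).2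
      simp [h, hψ]

open Classical in
/-- The centred indicator of the presence of an edge. -/
noncomputable def edgeWeight (p : ℝ) (G : SimpleGraph V) (ε : Sym2 V) : ℝ :=
  (if ε ∈ G.edgeSet then 1 else 0) - p

/-- Bounds on mixed moments of a centred Bernoulli variable and its absolute value. -/
lemma abs_moment_le {p : ℝ} (h0 : 0 ≤ p) (h1 : p ≤ 1) {a b : ℕ} (hab : 1 ≤ a + b) :
    |p * ((1 - p) ^ a * |1 - p| ^ b) + (1 - p) * ((0 - p) ^ a * |0 - p| ^ b)| ≤ 2 ^ b * p := by
  have hq : 0 ≤ 1 - p := by linarith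
  rw [zero_sub, abs_neg, abs_of_nonneg h0, abs_of_nonneg hq]
  have hsum : |p * ((1 - p) ^ a * (1 - p) ^ b) + (1 - p) * ((-p) ^ a * p ^ b)| ≤
      p * (1 - p) ^ (a + b) + (1 - p) * p ^ (a + b) := by
    refine (abs_add_le _ _).trans (le_of_eq ?_)
    rw [abs_mul, abs_mul, abs_mul, abs_mul, abs_pow, abs_pow, abs_pow, abs_pow, abs_neg,
      abs_of_nonneg h0, abs_of_nonneg hq, pow_add, pow_add]
  rcases Nat.eq_zero_or_pos b with rfl | hb
  · rcases (show a = 1 ∨ 2 ≤ a by lia) with rfl | ha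
    · have : p * ((1 - p) ^ 1 * (1 - p) ^ 0) + (1 - p) * ((-p) ^ 1 * p ^ 0) = 0 := by ring
      rw [this, abs_zero]
      positivity
    · refine hsum.trans ?_
      have e1 : (1 - p) ^ (a + 0) ≤ (1 - p) ^ 2 := pow_le_pow_of_le_one hq (by linarith) (by lia)
      have e2 : p ^ (a + 0) ≤ p ^ 2 := pow_le_pow_of_le_one h0 h1 (by lia)
      rw [pow_zero, one_mul]
      nlinarith [mul_nonneg h0 hq]
  · refine hsum.trans ?_
    have e1 : (1 - p) ^ (a + b) ≤ 1 := pow_le_one₀ hq (by linarith)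
    have e2 : p ^ (a + b) ≤ p ^ 1 := pow_le_pow_of_le_one h0 h1 (by lia)
    have e3 : (2 : ℝ) ^ 1 ≤ 2 ^ b := pow_le_pow_right₀ (by norm_num) hb
    have e4 : 2 ^ 1 * p ≤ 2 ^ b * p := by gcongr
    rw [pow_one] at e2
    nlinarith [mul_nonneg h0 hq]

/-- The mixed moments of the edge weights: an edge that occurs exactly once in `A` and not in `J`
makes the moment vanish, since its weight is centred. -/
lemma abs_integral_edgeWeight_le (p : unitInterval) (A J : List (Sym2 V))
    (hd : ∀ ε ∈ A ++ J, ¬ ε.IsDiag) :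
    |∫ G, (A.map (edgeWeight p G)).prod * (J.map fun ε => |edgeWeight p G ε|).prod
        ∂(SimpleGraph.binomialRandom V p)| ≤
      if 2 * #(A ++ J).toFinset ≤ A.length + 2 * J.length then
        2 ^ J.length * (p : ℝ) ^ #(A ++ J).toFinset else 0 := by
  classical
  set F := (A ++ J).toFinset with hF
  have hA : A.toFinset ⊆ F := by rw [hF, List.toFinset_append]; exact subset_union_left
  have hJ : J.toFinset ⊆ F := by rw [hF, List.toFinset_append]; exact subset_union_right
  have hprod : ∀ (B : List (Sym2 V)), B.toFinset ⊆ F → ∀ g : Sym2 V → ℝ,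
      (B.map g).prod = ∏ ε ∈ F, g ε ^ B.count ε := by
    intro B hB g
    rw [prod_list_map_count]
    refine prod_subset hB fun ε _ hε => ?_
    rw [List.count_eq_zero_of_not_mem (by simpa using hε), pow_zero]
  have hsum : ∀ (B : List (Sym2 V)), B.toFinset ⊆ F → ∑ ε ∈ F, B.count ε = B.length := by
    intro B hB
    rw [← List.sum_toFinset_count_eq_length]
    refine (sum_subset hB fun ε _ hε => ?_).symm
    rw [List.count_eq_zero_of_not_mem (by simpa using hε)]
  set φ : Sym2 V → Prop → ℝ := fun ε b =>
    ((if b then 1 else 0) - (p : ℝ)) ^ A.count ε * |(if b then 1 else 0) - (p : ℝ)| ^ J.count ε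
    with hφ
  have hint : ∀ G : SimpleGraph V,
      (A.map (edgeWeight p G)).prod * (J.map fun ε => |edgeWeight p G ε|).prod =
        ∏ ε ∈ F, φ ε (ε ∈ G.edgeSet) := by
    intro G
    rw [hprod A hA, hprod J hJ, ← prod_mul_distrib]
    refine prod_congr rfl fun ε _ => ?_
    simp only [edgeWeight, hφ]
    congr!
  simp only [hint]
  rw [integral_prod_edges p F (fun ε hε => hd ε (by simpa [hF] using hε)), abs_prod]
  have hp0 := p.2.1
  have hp1 := p.2.2
  have hone : ∀ ε ∈ F, 1 ≤ A.count ε + J.count ε := by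
    intro ε hε
    rw [← List.count_append]
    exact List.count_pos_iff.2 (by simpa [hF] using hε)
  split_ifs with h
  · calc _ ≤ ∏ ε ∈ F, (2 ^ J.count ε * (p : ℝ)) := by
          refine prod_le_prod (fun _ _ => abs_nonneg _) fun ε hε => ?_
          have := abs_moment_le hp0 hp1 (hone ε hε)
          simpa [hφ] using this
      _ = _ := by
          rw [prod_mul_distrib, prod_pow_eq_pow_sum, hsum J hJ, prod_const]
  · obtain ⟨ε, hε, hlt⟩ : ∃ ε ∈ F, A.count ε + 2 * J.count ε < 2 := by
      by_contra hc
      push Not at hc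
      apply h
      have h1 : ∑ ε ∈ F, 2 ≤ ∑ ε ∈ F, (A.count ε + 2 * J.count ε) := sum_le_sum hc
      rw [sum_const, smul_eq_mul, sum_add_distrib, ← mul_sum, hsum A hA, hsum J hJ] at h1
      lia
    have h1 := hone ε hε
    have hJ0 : J.count ε = 0 := by lia
    have hA1 : A.count ε = 1 := by lia
    refine (prod_eq_zero hε ?_).le
    rw [abs_eq_zero]
    simp only [hφ, hJ0, hA1, if_true, if_false]
    ring

end

/-! ### Matrices of walks and their traces -/

section

variable {V : Type*} [DecidableEq V] [Fintype V]

/-- The undirected edge of an ordered pair. -/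
def toEdge (e : OrderedPair V) : Sym2 V := s(e.1.1, e.1.2)

lemma not_isDiag_toEdge (e : OrderedPair V) : ¬ (toEdge e).IsDiag := by
  simpa [toEdge] using e.2

/-- The edges of a walk, except for the first and the last one. -/
def interiorEdges (l : List V) : List (Sym2 V) := (edgeList l).tail.dropLast

lemma interiorEdges_cons {a b c d : V} {t : List V} :
    interiorEdges (a :: b :: c :: d :: t) = s(b, c) :: interiorEdges (b :: c :: d :: t) := by
  simp [interiorEdges]

lemma length_interiorEdges (l : List V) : (interiorEdges l).length = l.length - 3 := by
  simp only [interiorEdges, List.length_dropLast, List.length_tail, length_edgeList]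
  lia

lemma mem_edgeList_of_mem_interiorEdges {l : List V} {ε : Sym2 V} (h : ε ∈ interiorEdges l) :
    ε ∈ edgeList l :=
  List.mem_of_mem_tail (List.mem_of_mem_dropLast h)

lemma eq_or_mem_interiorEdges {l : List V} {e f : OrderedPair V} (he : StartsWith l e)
    (hf : EndsWith l f) {ε : Sym2 V} (hε : ε ∈ edgeList l) :
    ε = toEdge e ∨ ε ∈ interiorEdges l ∨ ε = toEdge f := by
  obtain ⟨t, ht⟩ := he.exists_eq
  obtain ⟨t', ht'⟩ := hf.exists_eq
  have hlast : ∃ s, edgeList l = s ++ [toEdge f] := ⟨_, by rw [ht', edgeList_append_pair]; rfl⟩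
  obtain ⟨s, hs⟩ := hlast
  have hfirst : edgeList l = toEdge e :: (edgeList l).tail := by rw [ht]; rfl
  rw [hfirst, List.mem_cons] at hε
  refine hε.imp_right fun hε => ?_
  unfold interiorEdges
  cases s with
  | nil => rw [hs] at hε; simp at hε
  | cons x s =>
    rw [hs] at hε ⊢
    simpa using hε

/-- The matrix of the sums of the weights of the walks of `𝒲` with given first and last edges, where
the weight of a walk is the product over its other edges. -/
noncomputable def walkMatrix (x : Sym2 V → ℝ) (𝒲 : Finset (List V)) :
    Matrix (OrderedPair V) (OrderedPair V) ℝ :=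
  Matrix.of fun e f => ∑ l ∈ 𝒲,
    if StartsWith l e ∧ EndsWith l f then ((interiorEdges l).map x).prod else 0

/-- The diagonal matrix with the values of `x` at the edges. -/
def edgeDiag (x : Sym2 V → ℝ) : Matrix (OrderedPair V) (OrderedPair V) ℝ :=
  Matrix.diagonal fun e => x (toEdge e)

/-- The non-backtracking matrix of the complete graph. -/
def nbAdj (V : Type*) [DecidableEq V] : Matrix (OrderedPair V) (OrderedPair V) ℝ :=
  nonBacktrackingMatrix fun _ _ => 1

lemma nbAdj_apply (e f : OrderedPair V) :
    nbAdj V e f = if f.1.1 = e.1.2 ∧ f.1.2 ≠ e.1.1 then 1 else 0 := rfl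

lemma nonBacktrackingMatrix_eq (x : Sym2 V → ℝ) :
    (nonBacktrackingMatrix fun i j => x s(i, j)) = nbAdj V * edgeDiag x := by
  ext e f
  rw [edgeDiag, Matrix.mul_diagonal, nbAdj_apply]
  simp [nonBacktrackingMatrix, toEdge]

lemma walkMatrix_goodWalks_three (x : Sym2 V → ℝ) :
    walkMatrix x (goodWalks V 3) = nbAdj V := by
  ext e f
  rw [walkMatrix, Matrix.of_apply, nbAdj_apply]
  have hs : ∀ l ∈ goodWalks V 3, StartsWith l e ∧ EndsWith l f →
      l = [e.1.1, e.1.2, f.1.2] ∧ f.1.1 = e.1.2 := by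
    intro l hl h
    obtain ⟨t, rfl⟩ := h.1.exists_eq
    have hlen := (mem_goodWalks.1 hl).1
    obtain ⟨c, rfl⟩ : ∃ c, t = [c] := List.length_eq_one_iff.1 (by simpa using hlen)
    obtain ⟨t', ht'⟩ := h.2.exists_eq
    have := (List.append_inj' (s₁ := [e.1.1]) (t₁ := [e.1.2, c]) ht' rfl).2
    simp only [List.cons.injEq, and_true] at this
    simp [this.1, this.2]
  by_cases h : f.1.1 = e.1.2 ∧ f.1.2 ≠ e.1.1
  · rw [if_pos h, sum_eq_single [e.1.1, e.1.2, f.1.2]]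
    · rw [if_pos]
      · simp [interiorEdges]
      · exact ⟨startsWith_cons_cons.2 ⟨rfl, rfl⟩, [e.1.1], by simp [h.1]⟩
    · intro l hl hne
      exact if_neg fun h' => hne (hs l hl h').1
    · intro hl
      refine absurd (mem_goodWalks.2 ⟨rfl, isGood_of_nodup ?_⟩) hl
      have h1 := e.2
      have h2 : e.1.2 ≠ f.1.2 := h.1 ▸ f.2
      simp [h1, h2, h.2.symm]
  · rw [if_neg h]
    refine sum_eq_zero fun l hl => if_neg fun h' => h ?_
    obtain ⟨rfl, h1⟩ := hs l hl h'
    refine ⟨h1, ?_⟩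
    exact ((mem_goodWalks.1 hl).2.1 0 2 _ _ rfl rfl (by simp) (by simp)).symm

lemma sum_nbAdj_mul {x : Sym2 V → ℝ} {l : List V} (hl : IsNB l) (hlen : 3 ≤ l.length)
    (e g : OrderedPair V) :
    ∑ f, nbAdj V e f * x (toEdge f) *
        (if StartsWith l f ∧ EndsWith l g then ((interiorEdges l).map x).prod else 0) =
      if IsNB (e.1.1 :: l) ∧ StartsWith (e.1.1 :: l) e ∧ EndsWith (e.1.1 :: l) g then
        ((interiorEdges (e.1.1 :: l)).map x).prod else 0 := by
  obtain ⟨b, c, d, t, rfl⟩ : ∃ b c d t, l = b :: c :: d :: t := by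
    match l, hlen with
    | b :: c :: d :: t, _ => exact ⟨b, c, d, t, rfl⟩
  have hbc : b ≠ c := hl 0 1 _ _ rfl rfl (by simp) (by simp)
  have hend : EndsWith (e.1.1 :: b :: c :: d :: t) g ↔ EndsWith (b :: c :: d :: t) g := by
    constructor
    · intro h
      rcases List.suffix_cons_iff.1 h with h' | h'
      · simp at h'
      · exact h'
    · intro h
      exact List.suffix_cons_iff.2 (.inr h)
  rw [sum_eq_single (⟨(b, c), hbc⟩ : OrderedPair V)]
  · rw [nbAdj_apply, interiorEdges_cons, List.map_cons, List.prod_cons]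
    simp only [hend, startsWith_cons_cons, true_and, toEdge, isNB_cons (a := e.1.1), hl, and_true,
      List.getElem?_cons_zero, List.getElem?_cons_succ, Option.some.injEq, forall_eq']
    have he := e.2
    by_cases h1 : b = e.1.2 ∧ c ≠ e.1.1
    · obtain ⟨rfl, h1⟩ := h1
      simp [h1, h1.symm, he]
    · rw [if_neg h1, zero_mul, zero_mul, if_neg]
      rintro ⟨⟨-, h2⟩, h3, -⟩
      exact h1 ⟨h3.symm, h2.symm⟩
  · intro f _ hf
    rw [if_neg, mul_zero]
    rintro ⟨h, -⟩
    rw [startsWith_cons_cons] at h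
    exact hf (Subtype.ext (Prod.ext h.1 h.2))
  · simp

/-- Prolonging a good walk by one step at its start gives a good walk or a tangled one. -/
lemma nbAdj_mul_walkMatrix (x : Sym2 V → ℝ) {k : ℕ} (hk : 3 ≤ k) :
    nbAdj V * edgeDiag x * walkMatrix x (goodWalks V k) =
      walkMatrix x (goodWalks V (k + 1)) + walkMatrix x (tangledWalks V (k + 1)) := by
  ext e g
  have hR : ∀ l : List V, (if IsGood l then
        (if StartsWith l e ∧ EndsWith l g then ((interiorEdges l).map x).prod else 0) else 0) +
      (if IsNB l ∧ ¬ IsGood l ∧ IsGood l.tail then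
        (if StartsWith l e ∧ EndsWith l g then ((interiorEdges l).map x).prod else 0) else 0) =
      if IsGood l.tail then if IsNB l ∧ StartsWith l e ∧ EndsWith l g then
        ((interiorEdges l).map x).prod else 0 else 0 := by
    intro l
    have ht : IsGood l → IsGood l.tail := by
      intro h
      cases l with
      | nil => exact h
      | cons a l => exact h.tail
    by_cases h1 : IsGood l
    · simp [h1, h1.1, ht h1]
    · by_cases h2 : IsGood l.tail <;> by_cases h3 : IsNB l <;> simp [h1, h2, h3]
  rw [Matrix.add_apply, walkMatrix, walkMatrix, walkMatrix, Matrix.of_apply, Matrix.of_apply,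
    goodWalks, goodWalks, tangledWalks, sum_filter, sum_filter, ← sum_add_distrib,
    sum_congr rfl fun l _ => hR l, sum_listsOf_succ, sum_comm, Matrix.mul_apply]
  simp only [edgeDiag, Matrix.mul_diagonal, Matrix.of_apply]
  simp only [mul_sum]
  rw [sum_comm, sum_filter]
  refine sum_congr rfl fun l hl => ?_
  simp only [List.tail_cons]
  by_cases hg : IsGood l
  · simp only [hg, if_true]
    rw [mem_listsOf_univ] at hl
    rw [sum_nbAdj_mul hg.1 (by lia) e g, sum_eq_single e.1.1]
    · intro a _ ha
      refine if_neg fun h => ha ?_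
      obtain ⟨t, ht⟩ := h.2.1.exists_eq
      exact (List.cons.inj ht).1
    · simp
  · simp [hg]

section Balanced

/-- The square root of the absolute value of an edge weight. -/
noncomputable def rootWeight (x : Sym2 V → ℝ) (ε : Sym2 V) : ℝ := Real.sqrt |x ε|

/-- The square root of the absolute value of an edge weight, with the sign of the weight. -/
noncomputable def signedRoot (x : Sym2 V → ℝ) (ε : Sym2 V) : ℝ :=
  Real.sqrt |x ε| * SignType.sign (x ε)

/-- The matrix `N` with rows and columns weighted by square roots of the edge weights. If `D` is the
diagonal matrix of the edge weights, this makes the product `N * D * N'` into a product of the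
balanced matrices, in a way that treats rows and columns alike. -/
noncomputable def balanced (x : Sym2 V → ℝ) (N : Matrix (OrderedPair V) (OrderedPair V) ℝ) :
    Matrix (OrderedPair V) (OrderedPair V) ℝ :=
  edgeDiag (rootWeight x) * N * edgeDiag (signedRoot x)

lemma edgeDiag_mul (x y : Sym2 V → ℝ) :
    edgeDiag x * edgeDiag y = edgeDiag fun ε => x ε * y ε := by
  rw [edgeDiag, edgeDiag, Matrix.diagonal_mul_diagonal]; rfl

lemma edgeDiag_transpose (x : Sym2 V → ℝ) : (edgeDiag x).transpose = edgeDiag x :=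
  Matrix.diagonal_transpose _

lemma signedRoot_mul_rootWeight (x : Sym2 V → ℝ) (ε : Sym2 V) :
    signedRoot x ε * rootWeight x ε = x ε := by
  rw [signedRoot, rootWeight, mul_right_comm, Real.mul_self_sqrt (abs_nonneg _), abs_mul_sign]

lemma signedRoot_mul_self (x : Sym2 V → ℝ) (ε : Sym2 V) :
    signedRoot x ε * signedRoot x ε = |x ε| := by
  rw [signedRoot, mul_mul_mul_comm, Real.mul_self_sqrt (abs_nonneg _)]
  rcases lt_trichotomy (x ε) 0 with h | h | h <;> simp [h]

lemma balanced_mul_balanced (x : Sym2 V → ℝ) (N N' : Matrix (OrderedPair V) (OrderedPair V) ℝ) :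
    balanced x N * balanced x N' = balanced x (N * edgeDiag x * N') := by
  have h : edgeDiag (signedRoot x) * edgeDiag (rootWeight x) = edgeDiag x := by
    rw [edgeDiag_mul]
    congr 1
    exact funext fun ε => signedRoot_mul_rootWeight x ε
  rw [balanced, balanced, balanced, ← h]
  simp only [Matrix.mul_assoc]

lemma balanced_add (x : Sym2 V → ℝ) (N N' : Matrix (OrderedPair V) (OrderedPair V) ℝ) :
    balanced x (N + N') = balanced x N + balanced x N' := by
  simp only [balanced, Matrix.mul_add, Matrix.add_mul]

lemma trace_pow_mul_comm {ι : Type*} [Fintype ι] [DecidableEq ι] (X Y : Matrix ι ι ℝ) (m : ℕ)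
    (hm : m ≠ 0) : ((X * Y) ^ m).trace = ((Y * X) ^ m).trace := by
  obtain ⟨m, rfl⟩ := Nat.exists_eq_succ_of_ne_zero hm
  have h : SemiconjBy X (Y * X) (X * Y) := by
    rw [SemiconjBy, ← mul_assoc]
  have h' : X * (Y * X) ^ m = (X * Y) ^ m * X := h.pow_right m
  rw [Nat.succ_eq_add_one, pow_succ, ← mul_assoc, ← h', Matrix.trace_mul_comm, ← mul_assoc,
    pow_succ', mul_assoc]

/-- The square roots combine to absolute values of edge weights in the traces of Gram matrices. -/
lemma trace_balanced (x : Sym2 V → ℝ) (N : Matrix (OrderedPair V) (OrderedPair V) ℝ) {m : ℕ}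
    (hm : m ≠ 0) : ((balanced x N * (balanced x N).transpose) ^ m).trace =
      ((N * edgeDiag (fun ε => |x ε|) * N.transpose * edgeDiag fun ε => |x ε|) ^ m).trace := by
  have h1 : edgeDiag (signedRoot x) * edgeDiag (signedRoot x) = edgeDiag fun ε => |x ε| := by
    rw [edgeDiag_mul]
    congr 1
    exact funext fun ε => signedRoot_mul_self x ε
  have h2 : edgeDiag (rootWeight x) * edgeDiag (rootWeight x) = edgeDiag fun ε => |x ε| := by
    rw [edgeDiag_mul]
    congr 1
    exact funext fun ε => Real.mul_self_sqrt (abs_nonneg _)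
  have h3 : balanced x N * (balanced x N).transpose = edgeDiag (rootWeight x) *
      (N * edgeDiag (fun ε => |x ε|) * N.transpose * edgeDiag (rootWeight x)) := by
    rw [balanced, Matrix.transpose_mul, Matrix.transpose_mul, edgeDiag_transpose,
      edgeDiag_transpose, ← h1]
    simp only [Matrix.mul_assoc]
  rw [h3, trace_pow_mul_comm _ _ _ hm, mul_assoc _ (edgeDiag (rootWeight x)), h2]

end Balanced

section Trace

/-- The contribution of a pair of walks to the entries of `N |D| Nᵀ |D|`. -/
noncomputable def pairWeight (x : Sym2 V → ℝ) (π : WalkPair V) : ℝ :=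
  ((interiorEdges π.1).map x).prod * |x (toEdge π.2.1)| *
    (((interiorEdges π.2.2.1).map x).prod * |x (toEdge π.2.2.2)|)

lemma pairMatrix_apply (x : Sym2 V → ℝ) (𝒲 : Finset (List V)) (e e' : OrderedPair V) :
    (walkMatrix x 𝒲 * edgeDiag (fun ε => |x ε|) * (walkMatrix x 𝒲).transpose *
      edgeDiag fun ε => |x ε|) e e' =
      ∑ π ∈ walkPairs 𝒲, if PairFrom e π ∧ π.2.2.2 = e' then pairWeight x π else 0 := by
  rw [edgeDiag, Matrix.mul_diagonal, Matrix.mul_apply, walkPairs, sum_product]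
  simp only [Matrix.mul_diagonal, Matrix.transpose_apply, walkMatrix, Matrix.of_apply, sum_mul]
  rw [sum_comm]
  refine sum_congr rfl fun l _ => ?_
  rw [sum_product]
  refine sum_congr rfl fun f _ => ?_
  rw [mul_sum, sum_mul, sum_product]
  refine sum_congr rfl fun l' _ => ?_
  rw [sum_eq_single e']
  · simp only [PairFrom, pairWeight, and_true]
    by_cases h1 : StartsWith l e ∧ EndsWith l f
    · by_cases h2 : StartsWith l' e' ∧ EndsWith l' f
      · rw [if_pos h1, if_pos h2, if_pos ⟨h1.1, h1.2, h2.2, h2.1⟩]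
        ring
      · rw [if_neg h2, mul_zero, zero_mul, if_neg]
        rintro ⟨-, -, h3, h4⟩
        exact h2 ⟨h4, h3⟩
    · rw [if_neg h1, zero_mul, zero_mul, zero_mul, if_neg]
      rintro ⟨h3, h4, -⟩
      exact h1 ⟨h3, h4⟩
  · intro e'' _ h
    exact if_neg fun h' => h h'.2
  · simp

lemma pairMatrix_pow_apply (x : Sym2 V → ℝ) (𝒲 : Finset (List V)) (m : ℕ) :
    ∀ e e' : OrderedPair V, ((walkMatrix x 𝒲 * edgeDiag (fun ε => |x ε|) *
      (walkMatrix x 𝒲).transpose * edgeDiag fun ε => |x ε|) ^ m) e e' =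
      ∑ Γ ∈ listsOf (walkPairs 𝒲) m,
        if IsChain e Γ e' then (Γ.map (pairWeight x)).prod else 0 := by
  induction m with
  | zero =>
    intro e e'
    rw [pow_zero, Matrix.one_apply, listsOf, sum_singleton, List.map_nil, List.prod_nil]
    exact if_congr Iff.rfl rfl rfl
  | succ m ih =>
    intro e e'
    rw [pow_succ', Matrix.mul_apply, sum_listsOf_succ]
    simp only [ih, pairMatrix_apply, sum_mul]
    rw [sum_comm]
    refine sum_congr rfl fun π _ => ?_
    rw [sum_eq_single π.2.2.2]
    · rw [mul_sum]
      refine sum_congr rfl fun Γ _ => ?_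
      simp only [IsChain, and_true, List.map_cons, List.prod_cons]
      by_cases h1 : PairFrom e π <;> by_cases h2 : IsChain π.2.2.2 Γ e' <;> simp [h1, h2]
    · intro f _ hf
      rw [if_neg fun h => hf h.2.symm, zero_mul]
    · simp

/-- The edges in the interior of the walks of a chain, with multiplicity. -/
def chainInterior (Γ : List (WalkPair V)) : List (Sym2 V) :=
  Γ.flatMap fun π => interiorEdges π.1 ++ interiorEdges π.2.2.1

/-- The edges at which two walks of a closed chain meet, with multiplicity. -/
def chainJoints (Γ : List (WalkPair V)) : List (Sym2 V) :=
  Γ.flatMap fun π => [toEdge π.2.1, toEdge π.2.2.2]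

lemma prod_pairWeight (x : Sym2 V → ℝ) (Γ : List (WalkPair V)) :
    (Γ.map (pairWeight x)).prod =
      ((chainInterior Γ).map x).prod * ((chainJoints Γ).map fun ε => |x ε|).prod := by
  induction Γ with
  | nil => simp [chainInterior, chainJoints]
  | cons π Γ ih =>
    rw [List.map_cons, List.prod_cons, ih]
    simp only [chainInterior, chainJoints, List.flatMap_cons, List.map_append, List.prod_append,
      List.map_cons, List.prod_cons, List.map_nil, List.prod_nil, pairWeight]
    ring

lemma length_chainJoints (Γ : List (WalkPair V)) : (chainJoints Γ).length = 2 * Γ.length := by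
  induction Γ with
  | nil => rfl
  | cons π Γ ih =>
    simp only [chainJoints, List.flatMap_cons, List.length_append, List.length_cons,
      List.length_nil] at ih ⊢
    lia

lemma length_chainInterior {𝒲 : Finset (List V)} {k : ℕ} (h𝒲 : ∀ l ∈ 𝒲, l.length = k)
    {Γ : List (WalkPair V)} (hΓ : ∀ π ∈ Γ, π ∈ walkPairs 𝒲) :
    (chainInterior Γ).length = 2 * Γ.length * (k - 3) := by
  induction Γ with
  | nil => simp [chainInterior]
  | cons π Γ ih =>
    have h1 := ih fun π' h => hΓ π' (List.mem_cons_of_mem _ h)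
    have h2 := mem_walkPairs.1 (hΓ π (by simp))
    simp only [chainInterior, List.flatMap_cons, List.length_append, List.length_cons,
      length_interiorEdges, h𝒲 _ h2.1, h𝒲 _ h2.2] at h1 ⊢
    rw [h1]
    ring

lemma mem_chain_of_mem_chainSupp {Γ : List (WalkPair V)} :
    ∀ {e e' : OrderedPair V}, IsChain e Γ e' → ∀ ε ∈ (chainSupp Γ).2,
      ε = toEdge e ∨ ε ∈ chainInterior Γ ++ chainJoints Γ := by
  induction Γ with
  | nil => intro e e' _ ε hε; simp [chainSupp] at hε
  | cons π Γ ih =>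
    rintro e e' ⟨⟨h1, h2, h3, h4⟩, hΓ⟩ ε hε
    simp only [chainSupp, supp, Prod.snd_sup, sup_eq_union, mem_union, walkEdges,
      List.mem_toFinset] at hε
    simp only [chainInterior, chainJoints, List.flatMap_cons, List.mem_append, List.mem_cons,
      List.not_mem_nil, or_false]
    rcases hε with (hε | hε) | hε
    · rcases eq_or_mem_interiorEdges h1 h2 hε with h | h | h <;> tauto
    · rcases eq_or_mem_interiorEdges h4 h3 hε with h | h | h <;> tauto
    · have := ih hΓ ε hε
      simp only [chainInterior, chainJoints, List.mem_append] at this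
      tauto

lemma toEdge_mem_chainJoints {Γ : List (WalkPair V)} : ∀ {e e' : OrderedPair V},
    IsChain e Γ e' → Γ ≠ [] → toEdge e' ∈ chainJoints Γ := by
  induction Γ with
  | nil => intro e e' _ h; exact absurd rfl h
  | cons π Γ ih =>
    rintro e e' ⟨-, hΓ⟩ -
    cases Γ with
    | nil =>
      have : π.2.2.2 = e' := hΓ
      simp [chainJoints, this]
    | cons π' Γ =>
      have := ih hΓ (by simp)
      simp only [chainJoints, List.flatMap_cons, List.mem_append] at this ⊢
      tauto

lemma not_isDiag_of_mem_chain {𝒲 : Finset (List V)} (hNB : ∀ l ∈ 𝒲, IsNB l)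
    {Γ : List (WalkPair V)} (hΓ : ∀ π ∈ Γ, π ∈ walkPairs 𝒲) {ε : Sym2 V}
    (hε : ε ∈ chainInterior Γ ++ chainJoints Γ) : ¬ ε.IsDiag := by
  rw [List.mem_append, chainInterior, chainJoints, List.mem_flatMap, List.mem_flatMap] at hε
  rcases hε with ⟨π, hπ, h⟩ | ⟨π, hπ, h⟩
  · have h2 := mem_walkPairs.1 (hΓ π hπ)
    rcases List.mem_append.1 h with h | h
    · exact not_isDiag_of_isNB (hNB _ h2.1) (mem_edgeList_of_mem_interiorEdges h)
    · exact not_isDiag_of_isNB (hNB _ h2.2) (mem_edgeList_of_mem_interiorEdges h)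
  · simp only [List.mem_cons, List.not_mem_nil, or_false] at h
    rcases h with rfl | rfl <;> exact not_isDiag_toEdge _

open MeasureTheory in
/-- The expected trace is bounded by a weighted number of closed chains of walks. A chain that
traverses some edge only once, and not at a joint, does not contribute, so that the number of
distinct edges is at most `m * (k - 1)`, which is where the power of `d` comes from. -/
theorem integral_trace_le [Nonempty V] {p : unitInterval} {d : ℝ} (hd : 1 ≤ d)
    (hp : (p : ℝ) = d / Fintype.card V) {𝒲 : Finset (List V)} {k : ℕ} (hk : 3 ≤ k)
    (h𝒲 : ∀ l ∈ 𝒲, l.length = k) (hNB : ∀ l ∈ 𝒲, IsNB l) {m : ℕ} (hm : m ≠ 0) :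
    ∫ G, ((balanced (edgeWeight p G) (walkMatrix (edgeWeight p G) 𝒲) *
        (balanced (edgeWeight p G) (walkMatrix (edgeWeight p G) 𝒲)).transpose) ^ m).trace
        ∂(SimpleGraph.binomialRandom V p) ≤
      4 ^ m * d ^ (m * (k - 1)) * ∑ e : OrderedPair V, ∑ Γ ∈ listsOf (walkPairs 𝒲) m,
        (if IsChain e Γ e then (Fintype.card V : ℝ)⁻¹ ^ #(chainSupp Γ).2 else 0) := by
  have hn : (0 : ℝ) < Fintype.card V := by exact_mod_cast Fintype.card_pos
  have hn1 : (Fintype.card V : ℝ)⁻¹ ≤ 1 :=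
    inv_le_one_of_one_le₀ (by exact_mod_cast Fintype.card_pos)
  have htr : ∀ G : SimpleGraph V, ((balanced (edgeWeight p G) (walkMatrix (edgeWeight p G) 𝒲) *
        (balanced (edgeWeight p G) (walkMatrix (edgeWeight p G) 𝒲)).transpose) ^ m).trace =
      ∑ e : OrderedPair V, ∑ Γ ∈ listsOf (walkPairs 𝒲) m, if IsChain e Γ e then
        ((chainInterior Γ).map (edgeWeight p G)).prod *
          ((chainJoints Γ).map fun ε => |edgeWeight p G ε|).prod else 0 := by
    intro G
    rw [trace_balanced _ _ hm, Matrix.trace]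
    simp only [Matrix.diag_apply, pairMatrix_pow_apply, prod_pairWeight]
  simp only [htr]
  rw [integral_finsetSum _ fun _ _ => Integrable.of_finite, mul_sum]
  refine sum_le_sum fun e _ => ?_
  rw [integral_finsetSum _ fun _ _ => Integrable.of_finite, mul_sum]
  refine sum_le_sum fun Γ hΓ => ?_
  obtain ⟨hlen, hmem⟩ := mem_listsOf.1 hΓ
  by_cases hch : IsChain e Γ e
  · simp only [hch, if_true]
    refine (le_abs_self _).trans ((abs_integral_edgeWeight_le p _ _
      fun ε hε => not_isDiag_of_mem_chain hNB hmem hε).trans ?_)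
    split_ifs with hF
    · set F := (chainInterior Γ ++ chainJoints Γ).toFinset with hFdef
      rw [length_chainJoints, length_chainInterior h𝒲 hmem, hlen] at hF
      have hFm : #F ≤ m * (k - 1) := by
        obtain ⟨j, rfl⟩ : ∃ j, k = j + 3 := ⟨k - 3, by lia⟩
        have e1 : j + 3 - 3 = j := by lia
        have e2 : j + 3 - 1 = j + 2 := by lia
        rw [e1] at hF
        rw [e2]
        nlinarith
      have hsub : (chainSupp Γ).2 ⊆ F := by
        intro ε hε
        rw [hFdef, List.mem_toFinset]
        rcases mem_chain_of_mem_chainSupp hch ε hε with rfl | h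
        · refine List.mem_append_right _ (toEdge_mem_chainJoints hch ?_)
          rintro rfl
          exact hm hlen.symm
        · exact h
      rw [length_chainJoints, hlen, pow_mul, hp, div_eq_mul_inv, mul_pow, ← mul_assoc]
      have h4 : ((2 : ℝ) ^ 2) = 4 := by norm_num
      rw [h4]
      gcongr 4 ^ m * ?_ * ?_
      · exact pow_le_pow_right₀ hd hFm
      · exact pow_le_pow_of_le_one (inv_nonneg.2 hn.le) hn1 (card_le_card hsub)
    · positivity
  · simp [hch]

end Trace

end

/-! ### Operator norms and the spectral radius -/

section

section Norm

open scoped Matrix.Norms.L2Operator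

variable {ι : Type*} [Fintype ι] [DecidableEq ι]

/-- A real square matrix as a complex matrix. -/
noncomputable def toComplex : Matrix ι ι ℝ →+* Matrix ι ι ℂ := Complex.ofRealHom.mapMatrix

lemma toComplex_apply (M : Matrix ι ι ℝ) (i j : ι) : toComplex M i j = (M i j : ℂ) := rfl

lemma toComplex_eq_map (M : Matrix ι ι ℝ) : toComplex M = M.map Complex.ofReal := rfl

lemma star_toComplex (M : Matrix ι ι ℝ) : star (toComplex M) = toComplex M.transpose := by
  ext i j
  rw [Matrix.star_apply, toComplex_apply, toComplex_apply, Matrix.transpose_apply]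
  exact Complex.conj_ofReal _

/-- The operator norm is at most the Frobenius norm. -/
lemma norm_toComplex_sq_le (M : Matrix ι ι ℝ) : ‖toComplex M‖ ^ 2 ≤ (M * M.transpose).trace := by
  have htr : (M * M.transpose).trace = ∑ i, ∑ j, M i j ^ 2 := by
    simp [Matrix.trace, Matrix.mul_apply, sq]
  rw [htr]
  set F := ∑ i, ∑ j, M i j ^ 2 with hF
  have hF0 : 0 ≤ F := sum_nonneg fun i _ => sum_nonneg fun j _ => sq_nonneg _
  have h : ‖toComplex M‖ ≤ Real.sqrt F := by
    rw [Matrix.cstar_norm_def]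
    refine ContinuousLinearMap.opNorm_le_bound _ (Real.sqrt_nonneg _) fun v => ?_
    rw [EuclideanSpace.norm_eq, EuclideanSpace.norm_eq, ← Real.sqrt_mul hF0]
    refine Real.sqrt_le_sqrt ?_
    rw [hF, sum_mul]
    refine sum_le_sum fun i _ => ?_
    rw [Matrix.ofLp_toEuclideanCLM, Matrix.mulVec, dotProduct]
    calc ‖∑ j, toComplex M i j * v.ofLp j‖ ^ 2 ≤ (∑ j, |M i j| * ‖v.ofLp j‖) ^ 2 := by
          gcongr
          refine (norm_sum_le _ _).trans (le_of_eq (sum_congr rfl fun j _ => ?_))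
          rw [norm_mul, toComplex_apply, Complex.norm_real, Real.norm_eq_abs]
      _ ≤ (∑ j, |M i j| ^ 2) * ∑ j, ‖v.ofLp j‖ ^ 2 := sum_mul_sq_le_sq_mul_sq _ _ _
      _ = _ := by simp only [sq_abs]
  calc ‖toComplex M‖ ^ 2 ≤ Real.sqrt F ^ 2 := by gcongr
    _ = F := Real.sq_sqrt hF0

/-- The operator norm of `M` is bounded by the trace of `(M * Mᵀ) ^ m`, where `m` is a power of
two. -/
lemma norm_toComplex_pow_le (M : Matrix ι ι ℝ) (q : ℕ) :
    ‖toComplex M‖ ^ (2 * 2 ^ q) ≤ ((M * M.transpose) ^ 2 ^ q).trace := by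
  cases q with
  | zero => simpa using norm_toComplex_sq_le M
  | succ q =>
    set P := M * M.transpose with hP
    have hPt : P.transpose = P := by rw [hP, Matrix.transpose_mul, Matrix.transpose_transpose]
    have hsa : IsSelfAdjoint (toComplex P) := by
      rw [IsSelfAdjoint, star_toComplex, hPt]
    have h1 : ‖toComplex P‖ = ‖toComplex M‖ ^ 2 := by
      rw [hP, map_mul, ← star_toComplex, CStarRing.norm_self_mul_star, sq]
    have h2 := norm_toComplex_sq_le (P ^ 2 ^ q)
    rw [map_pow, hsa.norm_pow_two_pow, h1, Matrix.transpose_pow, hPt, ← pow_add, ← pow_mul,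
      ← pow_mul] at h2
    have e1 : 2 * (2 ^ q * 2) = 2 * 2 ^ (q + 1) := by ring
    have e2 : 2 ^ q + 2 ^ q = 2 ^ (q + 1) := by ring
    rwa [e1, e2] at h2

/-- A perturbation argument: the powers of `b` are close to a sequence that is almost geometric. -/
lemma norm_pow_le_of_recursion {A : Type*} [NormedRing A] [NormOneClass A] {b : A} {N R : ℕ → A}
    (h1 : N 1 = b) (hrec : ∀ k, 1 ≤ k → b * N k = N (k + 1) + R (k + 1)) {ℓ : ℕ} {M δ η : ℝ}
    (hM : 1 ≤ M) (hδ : 1 ≤ δ) (hη : 0 ≤ η) (hηℓ : 2 * (η * ℓ) ≤ 1)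
    (hN : ∀ k, 1 ≤ k → k ≤ ℓ → ‖N k‖ ≤ M * δ ^ k) (hR : ∀ k, 2 ≤ k → k ≤ ℓ → ‖R k‖ ≤ η) :
    ∀ k ≤ ℓ, ‖b ^ k‖ ≤ 2 * (M * δ ^ k) := by
  -- unrolling the recursion
  have hsum : ∀ k, 1 ≤ k → b ^ k = N k + ∑ τ ∈ Ico 2 (k + 1), b ^ (k - τ) * R τ := by
    intro k hk
    induction k, hk using Nat.le_induction with
    | base => simp [h1]
    | succ k hk ih =>
      rw [pow_succ', ih, mul_add, hrec k hk, sum_Ico_succ_top (by lia : 2 ≤ k + 1), Nat.sub_self,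
        pow_zero, one_mul, add_assoc, add_comm (R (k + 1)), mul_sum]
      congr 2
      refine sum_congr rfl fun τ hτ => ?_
      rw [mem_Ico] at hτ
      rw [← mul_assoc, ← pow_succ']
      congr 2
      lia
  intro k
  induction k using Nat.strong_induction_on with
  | h k ih =>
    intro hkℓ
    have hδk : 1 ≤ δ ^ k := one_le_pow₀ hδ
    rcases Nat.eq_zero_or_pos k with rfl | hk
    · rw [pow_zero, norm_one, pow_zero]; linarith
    rw [hsum k hk]
    have hterm : ∀ τ ∈ Ico 2 (k + 1), ‖b ^ (k - τ) * R τ‖ ≤ 2 * (M * δ ^ k) * η := by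
      intro τ hτ
      rw [mem_Ico] at hτ
      refine (norm_mul_le _ _).trans ?_
      have e1 := ih (k - τ) (by lia) (by lia)
      have e2 : δ ^ (k - τ) ≤ δ ^ k := pow_le_pow_right₀ hδ (by lia)
      refine mul_le_mul (e1.trans ?_) (hR τ hτ.1 (by lia)) (norm_nonneg _) (by positivity)
      gcongr
    have hle := (norm_add_le (N k) (∑ τ ∈ Ico 2 (k + 1), b ^ (k - τ) * R τ))
    have hle2 := (norm_sum_le (Ico 2 (k + 1)) fun τ => b ^ (k - τ) * R τ).trans (sum_le_sum hterm)
    rw [sum_const, Nat.card_Ico, nsmul_eq_mul] at hle2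
    have hcard : ((k + 1 - 2 : ℕ) : ℝ) ≤ ℓ := by exact_mod_cast (by lia : k + 1 - 2 ≤ ℓ)
    have hX : 0 ≤ M * δ ^ k := by positivity
    have hle3 : ((k + 1 - 2 : ℕ) : ℝ) * (2 * (M * δ ^ k) * η) ≤ M * δ ^ k := by
      calc ((k + 1 - 2 : ℕ) : ℝ) * (2 * (M * δ ^ k) * η) ≤ ℓ * (2 * (M * δ ^ k) * η) := by gcongr
        _ = M * δ ^ k * (2 * (η * ℓ)) := by ring
        _ ≤ M * δ ^ k * 1 := by gcongr
        _ = M * δ ^ k := mul_one _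
    have := hN k hk hkℓ
    linarith

end Norm

variable {V : Type*} [DecidableEq V] [Fintype V]

open scoped Matrix.Norms.L2Operator in
/-- The spectral radius of a weighted non-backtracking matrix is controlled by the powers of its
balanced version, which has the same non-zero eigenvalues. -/
lemma realMatrixSpectralRadius_le [Nontrivial V] (x : Sym2 V → ℝ) {k : ℕ} (hk : k ≠ 0) {r : ℝ}
    (hr : 0 ≤ r) (h : ‖toComplex (balanced x (nbAdj V)) ^ k‖ ≤ r ^ k) :
    realMatrixSpectralRadius (nbAdj V * edgeDiag x) ≤ ENNReal.ofReal r := by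
  have : Nonempty (OrderedPair V) := by
    obtain ⟨a, b, hab⟩ := exists_pair_ne V
    exact ⟨⟨(a, b), hab⟩⟩
  have hx : edgeDiag x = edgeDiag (signedRoot x) * edgeDiag (rootWeight x) := by
    rw [edgeDiag_mul]
    congr 1
    exact funext fun ε => (signedRoot_mul_rootWeight x ε).symm
  have hspec := spectrum.nonzero_mul_comm (𝕜 := ℂ) (toComplex (edgeDiag (rootWeight x)))
    (toComplex (nbAdj V * edgeDiag (signedRoot x)))
  rw [realMatrixSpectralRadius, ← toComplex_eq_map, spectralRadius]
  refine iSup₂_le fun lam hlam => ?_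
  have hnorm : ‖lam‖ ≤ r := by
    by_cases h0 : lam = 0
    · simpa [h0] using hr
    have hmem : lam ∈ spectrum ℂ (toComplex (balanced x (nbAdj V))) := by
      rw [hx, ← mul_assoc, map_mul] at hlam
      have : lam ∈ spectrum ℂ (toComplex (edgeDiag (rootWeight x)) *
          toComplex (nbAdj V * edgeDiag (signedRoot x))) \ {0} := by
        rw [hspec]
        exact ⟨hlam, h0⟩
      rw [balanced, mul_assoc, map_mul]
      exact this.1
    have hpow := spectrum.norm_le_norm_of_mem (spectrum.pow_mem_pow _ k hmem)
    rw [norm_pow] at hpow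
    exact le_of_pow_le_pow_left₀ hk hr (hpow.trans h)
  rw [← ENNReal.ofReal_coe_nnreal, coe_nnnorm]
  exact ENNReal.ofReal_le_ofReal hnorm

end

/-! ### The limit -/

section

variable {V : Type*} [DecidableEq V] [Fintype V]

/-- The Gram matrix of the balanced matrix of a family of walks. -/
noncomputable def walkGram (x : Sym2 V → ℝ) (𝒲 : Finset (List V)) :
    Matrix (OrderedPair V) (OrderedPair V) ℝ :=
  balanced x (walkMatrix x 𝒲) * (balanced x (walkMatrix x 𝒲)).transpose

/-- A bound for the number of vertices of `m` pairs of walks with at most `ℓ + 2` vertices, where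
each walk counts twice, as it may be a lasso whose two parts overlap. -/
def lengthBound (m ℓ : ℕ) : ℝ := 1 + 4 * m * (ℓ + 2)

/-- The inverse of the parameter `y` of the weights of pieces in the count of closed chains. -/
def edgeCost (m ℓ : ℕ) : ℝ := (64 ^ 2) ^ m * (3 * lengthBound m ℓ ^ 4)

/-- The common factor in the moment bounds, which is polynomial in `ℓ`. -/
noncomputable def momentFactor (d : ℝ) (m ℓ : ℕ) : ℝ :=
  (4 * d * walkConst (lengthBound m ℓ) (4 * m + 9) ^ 10) ^ m * edgeCost m ℓ ^ 2

lemma one_le_lengthBound (m ℓ : ℕ) : 1 ≤ lengthBound m ℓ := by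
  unfold lengthBound
  have : (0 : ℝ) ≤ 4 * m * (ℓ + 2) := by positivity
  linarith

lemma one_le_edgeCost (m ℓ : ℕ) : 1 ≤ edgeCost m ℓ := by
  have h1 : (1 : ℝ) ≤ (64 ^ 2) ^ m := one_le_pow₀ (by norm_num)
  have h2 : (1 : ℝ) ≤ lengthBound m ℓ ^ 4 := one_le_pow₀ (one_le_lengthBound m ℓ)
  exact one_le_mul_of_one_le_of_one_le h1 (by linarith)

lemma lengthBound_ge {m k ℓ : ℕ} (hk : k ≤ ℓ) {m' : ℕ} (hm : m' ≤ m) :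
    1 + 2 * (m' : ℝ) * ((2 * (k + 2) : ℕ) : ℝ) ≤ lengthBound m ℓ := by
  have h1 : (k : ℝ) ≤ ℓ := by exact_mod_cast hk
  have h2 : (m' : ℝ) ≤ m := by exact_mod_cast hm
  unfold lengthBound
  push_cast
  have : (m' : ℝ) * (k + 2) ≤ m * (ℓ + 2) := by gcongr
  linarith

lemma card_toFinset_le {l : List V} (h0 : l ≠ []) :
    #l.toFinset ≤ #(walkEdges l) + 1 := by
  obtain ⟨a, t, rfl⟩ := List.exists_cons_of_ne_nil h0
  have := excess_supp (l := t) (S := (({a}, ∅) : Piece V)) (a := a) (by simp) (by simp)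
  simp only [card_empty, card_singleton, add_zero, supp] at this
  have h2 : #(a :: t).toFinset ≤ #({a} ∪ (a :: t).toFinset) := card_le_card subset_union_right
  have h3 : (∅ ∪ walkEdges (a :: t)) = walkEdges (a :: t) := empty_union _
  have h4 : #(({a}, ∅) ⊔ ((a :: t).toFinset, walkEdges (a :: t)) : Piece V).2 =
    #(walkEdges (a :: t)) := congrArg card h3
  rw [h4] at this
  have h5 : #(({a}, ∅) ⊔ ((a :: t).toFinset, walkEdges (a :: t)) : Piece V).1 =
    #({a} ∪ (a :: t).toFinset) := rfl
  lia

lemma edgeCost_mul_le {m ℓ : ℕ} {c : ℝ} {m' : ℕ} (hc : (c ^ 2) ^ m' ≤ (64 ^ 2) ^ m) :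
    (c ^ 2) ^ m' * (edgeCost m ℓ)⁻¹ * (3 * lengthBound m ℓ ^ 4) ≤ 1 := by
  have h0 := one_le_edgeCost m ℓ
  have hL := one_le_lengthBound m ℓ
  have : (c ^ 2) ^ m' * (3 * lengthBound m ℓ ^ 4) ≤ edgeCost m ℓ := by
    unfold edgeCost; gcongr
  calc (c ^ 2) ^ m' * (edgeCost m ℓ)⁻¹ * (3 * lengthBound m ℓ ^ 4)
      = (edgeCost m ℓ)⁻¹ * ((c ^ 2) ^ m' * (3 * lengthBound m ℓ ^ 4)) := by ring
    _ ≤ (edgeCost m ℓ)⁻¹ * edgeCost m ℓ := by gcongr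
    _ = 1 := inv_mul_cancel₀ (by positivity)

section Moments

variable [Nonempty V] {p : unitInterval} {d : ℝ} {m k ℓ : ℕ}

lemma one_le_walkConst (m ℓ R : ℕ) : 1 ≤ walkConst (lengthBound m ℓ) R :=
  le_trans (by norm_num) (three_le_walkConst (one_le_lengthBound m ℓ) R)

/-- Good walks: the expected trace is of order `n * d ^ (m * k)`, up to a polynomial in `ℓ`. -/
lemma integral_trace_goodWalks_le (hd : 1 ≤ d) (hp : (p : ℝ) = d / Fintype.card V) (hm : m ≠ 0)
    (hk : 1 ≤ k) (hkℓ : k ≤ ℓ) (hV : edgeCost m ℓ ≤ Fintype.card V) :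
    ∫ G, (walkGram (edgeWeight p G) (goodWalks V (k + 2)) ^ m).trace
      ∂SimpleGraph.binomialRandom V p ≤
      momentFactor d m ℓ * Fintype.card V * d ^ (m * k) := by
  have hc0 := one_le_edgeCost m ℓ
  set A := walkConst (lengthBound m ℓ) (4 * m + 9) with hA
  have hA1 : 1 ≤ A := one_le_walkConst _ _ _
  have hhead := headBound_good (V := V) (one_le_lengthBound m ℓ) (4 * m + 9) (k + 2)
  have hsum := sum_closedChains_le hhead (by rwa [image_reverse_goodWalks])
    (by positivity) (by norm_num) (fun l hl => (mem_goodWalks.1 hl).2.1)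
    (fun l hl => by rw [(mem_goodWalks.1 hl).1]; lia) (g := 0) (m := m)
    (fun l hl => card_toFinset_le
      (List.ne_nil_of_length_pos (by rw [(mem_goodWalks.1 hl).1]; lia)))
    (y := (edgeCost m ℓ)⁻¹) (by positivity) hm (by lia) (lengthBound_ge hkℓ le_rfl)
    (edgeCost_mul_le (by gcongr; norm_num))
    (by rw [← div_eq_mul_inv]; exact (one_le_div (by positivity)).2 hV)
  have htr := integral_trace_le hd hp (k := k + 2) (𝒲 := goodWalks V (k + 2)) (by lia)
    (fun l hl => (mem_goodWalks.1 hl).1) (fun l hl => (mem_goodWalks.1 hl).2.1) hm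
  refine htr.trans ?_
  have e1 : m * (k + 2 - 1) = m + m * k := by
    rw [show k + 2 - 1 = 1 + k by lia, mul_add, mul_one]
  rw [pow_zero, div_one] at hsum
  calc _ ≤ 4 ^ m * d ^ (m * (k + 2 - 1)) * (Fintype.card V * ((A ^ 4) ^ 2) ^ m) := by gcongr
    _ = (4 * d * A ^ 8) ^ m * 1 ^ 2 * Fintype.card V * d ^ (m * k) := by
      rw [e1, pow_add, mul_pow, mul_pow, ← pow_mul A 4 2]; ring
    _ ≤ _ := by
      unfold momentFactor
      rw [← hA]
      gcongr
      norm_num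

/-- Tangled walks: since they have more edges than vertices, the expected trace gains a factor
`n ^ (-2)` over the one of good walks. -/
lemma integral_trace_tangledWalks_le (hd : 1 ≤ d) (hp : (p : ℝ) = d / Fintype.card V) (hm : m ≠ 0)
    (hk : 1 ≤ k) (hkℓ : k ≤ ℓ) (hV : edgeCost m ℓ ≤ Fintype.card V) :
    ∫ G, (walkGram (edgeWeight p G) (tangledWalks V (k + 2))).trace
      ∂SimpleGraph.binomialRandom V p ≤
      momentFactor d m ℓ * d ^ k / Fintype.card V := by
  have hc0 := one_le_edgeCost m ℓ
  have hn : (0 : ℝ) < Fintype.card V := by linarith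
  set A := walkConst (lengthBound m ℓ) (4 * m + 9) with hA
  have hA1 : 1 ≤ A := one_le_walkConst _ _ _
  have hm1 : 1 ≤ m := Nat.one_le_iff_ne_zero.2 hm
  have hsum := sum_closedChains_le
    (headBound_tangled (V := V) (one_le_lengthBound m ℓ) (4 * m + 9) (k + 1))
    (headBound_tangled_reverse (V := V) (one_le_lengthBound m ℓ) (4 * m + 9) (k + 1))
    (by positivity) (by norm_num) (fun l hl => (mem_tangledWalks.1 hl).2.1)
    (fun l hl => by rw [(mem_tangledWalks.1 hl).1]; lia) (g := 2) (m := 1)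
    (fun l hl => by
      obtain ⟨-, h1, h2, -⟩ := mem_tangledWalks.1 hl
      have : ¬ #(walkEdges l) ≤ #l.toFinset := fun h => h2 ⟨h1, h⟩
      lia)
    (y := (edgeCost m ℓ)⁻¹) (by positivity) one_ne_zero (by lia) (lengthBound_ge hkℓ hm1)
    (edgeCost_mul_le (pow_le_pow_right₀ (by norm_num) hm1))
    (by rw [← div_eq_mul_inv]; exact (one_le_div (by positivity)).2 hV)
  have htr := integral_trace_le hd hp (k := k + 2) (𝒲 := tangledWalks V (k + 2)) (by lia)
    (fun l hl => (mem_tangledWalks.1 hl).1) (fun l hl => (mem_tangledWalks.1 hl).2.1)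
    (m := 1) one_ne_zero
  simp only [pow_one] at htr hsum
  refine htr.trans ?_
  have e1 : 1 * (k + 2 - 1) = k + 1 := by lia
  have hX : 1 ≤ 4 * d * A ^ 10 :=
    one_le_mul_of_one_le_of_one_le (by linarith) (one_le_pow₀ hA1)
  calc _ ≤ 4 * d ^ (1 * (k + 2 - 1)) * (Fintype.card V /
        (Fintype.card V * (edgeCost m ℓ)⁻¹) ^ 2 * (A ^ 5) ^ 2) := by gcongr
    _ = (4 * d * A ^ 10) * edgeCost m ℓ ^ 2 * d ^ k / Fintype.card V := by
      rw [e1]; field_simp; ring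
    _ ≤ _ := by
      unfold momentFactor
      rw [← hA]
      gcongr
      exact le_self_pow₀ hX hm

end Moments

section Deterministic

open scoped Matrix.Norms.L2Operator

lemma walkGram_trace_nonneg (x : Sym2 V → ℝ) (𝒲 : Finset (List V)) (q : ℕ) :
    0 ≤ (walkGram x 𝒲 ^ 2 ^ q).trace :=
  le_trans (by positivity) (norm_toComplex_pow_le (balanced x (walkMatrix x 𝒲)) q)

/-- Trace bounds for good and tangled walks of length up to `ℓ` control the spectral radius. -/
lemma realMatrixSpectralRadius_le_of_trace [Nontrivial V] (x : Sym2 V → ℝ) {q ℓ : ℕ}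
    {M δ η r : ℝ} (hℓ : ℓ ≠ 0) (hM : 1 ≤ M) (hδ : 1 ≤ δ) (hη : 0 ≤ η) (hηℓ : 2 * (η * ℓ) ≤ 1)
    (hr : 0 ≤ r) (hMr : 2 * (M * δ ^ ℓ) ≤ r ^ ℓ)
    (hgood : ∀ k, 1 ≤ k → k ≤ ℓ →
      (walkGram x (goodWalks V (k + 2)) ^ 2 ^ q).trace ≤ (M * δ ^ k) ^ (2 * 2 ^ q))
    (htangled : ∀ k, 1 ≤ k → k ≤ ℓ → (walkGram x (tangledWalks V (k + 2))).trace ≤ η ^ 2) :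
    realMatrixSpectralRadius (nbAdj V * edgeDiag x) ≤ ENNReal.ofReal r := by
  have : Nonempty (OrderedPair V) := by
    obtain ⟨a, b, hab⟩ := exists_pair_ne V
    exact ⟨⟨(a, b), hab⟩⟩
  refine realMatrixSpectralRadius_le x hℓ hr (le_trans ?_ hMr)
  refine norm_pow_le_of_recursion (ℓ := ℓ)
    (N := fun k => toComplex (balanced x (walkMatrix x (goodWalks V (k + 2)))))
    (R := fun k => toComplex (balanced x (walkMatrix x (tangledWalks V (k + 2)))))
    (by rw [show 1 + 2 = 3 from rfl, walkMatrix_goodWalks_three]) (fun k hk => ?_)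
    hM hδ hη hηℓ (fun k hk hkℓ => ?_) (fun k hk hkℓ => ?_) ℓ le_rfl
  · rw [← map_mul, balanced_mul_balanced, nbAdj_mul_walkMatrix x (by lia), balanced_add, map_add,
      show k + 1 + 2 = k + 2 + 1 by lia]
  · exact le_of_pow_le_pow_left₀ (by positivity) (by positivity)
      ((norm_toComplex_pow_le _ q).trans (hgood k hk hkℓ))
  · exact le_of_pow_le_pow_left₀ two_ne_zero hη
      ((norm_toComplex_sq_le _).trans (htangled k (by lia) hkℓ))

end Deterministic

section Probability

open MeasureTheory

variable [Nontrivial V] {p : unitInterval} {d : ℝ} {q ℓ : ℕ}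

/-- The probability that the spectral radius is large, in terms of the length `ℓ` of the walks: the
norms of the matrices of good walks are at most `M * √d ^ k` and those of the matrices of tangled
walks at most `d ^ (-ℓ)`, outside of events bounded by Markov's inequality. -/
lemma measure_spectralRadius_gt_le (hd : 1 ≤ d) (hp : (p : ℝ) = d / Fintype.card V)
    (hℓ : ℓ ≠ 0) (hV : d ^ (4 * ℓ) ≤ Fintype.card V) {M r : ℝ} (hM : 1 ≤ M)
    (hVM : (Fintype.card V : ℝ) ≤ M ^ 2 ^ q)
    (hcost : edgeCost (2 ^ q) ℓ ≤ d ^ (4 * ℓ)) (hηℓ : 2 * ((d ^ ℓ)⁻¹ * ℓ) ≤ 1) (hr : 0 ≤ r)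
    (hMr : 2 * (M * Real.sqrt d ^ ℓ) ≤ r ^ ℓ) :
    (SimpleGraph.binomialRandom V p).real {G | ¬ realMatrixSpectralRadius
      (nbAdj V * edgeDiag (edgeWeight p G)) ≤ ENNReal.ofReal r} ≤
      2 * (ℓ * momentFactor d (2 ^ q) ℓ) / d ^ ℓ := by
  set μ := SimpleGraph.binomialRandom V p with hμ
  have hd0 : 0 < d := by linarith
  have hdl : 1 ≤ d ^ ℓ := one_le_pow₀ hd
  have hn1 : (1 : ℝ) ≤ Fintype.card V := le_trans (one_le_pow₀ hd) hV
  have hP0 : 0 ≤ momentFactor d (2 ^ q) ℓ := by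
    have := one_le_walkConst (2 ^ q) ℓ (4 * 2 ^ q + 9)
    unfold momentFactor
    positivity
  have hδ : 1 ≤ Real.sqrt d := Real.one_le_sqrt.2 hd
  -- Markov's inequality on the finite probability space.
  have hmarkov : ∀ (f : SimpleGraph V → ℝ) (t b : ℝ), (∀ G, 0 ≤ f G) → 0 < t →
      ∫ G, f G ∂μ ≤ t * b → μ.real {G | t ≤ f G} ≤ b := by
    intro f t b hf ht hb
    have h1 := mul_meas_ge_le_integral_of_nonneg (μ := μ) (f := f) (ae_of_all _ hf)
      Integrable.of_finite t
    exact le_of_mul_le_mul_left (h1.trans hb) ht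
  set Bg : ℕ → Set (SimpleGraph V) := fun k => {G | (M * Real.sqrt d ^ k) ^ (2 * 2 ^ q) ≤
    (walkGram (edgeWeight p G) (goodWalks V (k + 2)) ^ 2 ^ q).trace} with hBg
  set Bt : ℕ → Set (SimpleGraph V) := fun k => {G | ((d ^ ℓ)⁻¹) ^ 2 ≤
    (walkGram (edgeWeight p G) (tangledWalks V (k + 2))).trace} with hBt
  have hsub : {G | ¬ realMatrixSpectralRadius
      (nbAdj V * edgeDiag (edgeWeight p G)) ≤ ENNReal.ofReal r} ⊆
      ⋃ k ∈ Icc 1 ℓ, Bg k ∪ Bt k := by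
    intro G hG
    by_contra hcon
    simp only [Set.mem_iUnion, not_exists, Set.mem_union, not_or, mem_Icc, hBg, hBt,
      Set.mem_ofPred_eq, not_le] at hcon
    exact hG (realMatrixSpectralRadius_le_of_trace _ hℓ hM hδ (by positivity) hηℓ hr hMr
      (fun k hk hkℓ => (hcon k ⟨hk, hkℓ⟩).1.le) (fun k hk hkℓ => (hcon k ⟨hk, hkℓ⟩).2.le))
  have hg : ∀ k ∈ Icc 1 ℓ, μ.real (Bg k) ≤ momentFactor d (2 ^ q) ℓ / d ^ ℓ := by
    intro k hk
    rw [mem_Icc] at hk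
    refine hmarkov _ _ _ (fun G => walkGram_trace_nonneg _ _ _) (by positivity) ?_
    refine (integral_trace_goodWalks_le hd hp (by positivity) hk.1 hk.2 (hcost.trans hV)).trans ?_
    have e1 : (M * Real.sqrt d ^ k) ^ (2 * 2 ^ q) = (M ^ 2 ^ q) ^ 2 * d ^ (2 ^ q * k) := by
      rw [mul_pow, ← pow_mul, ← pow_mul, show k * (2 * 2 ^ q) = 2 * (2 ^ q * k) by ring,
        pow_mul (Real.sqrt d), Real.sq_sqrt hd0.le, mul_comm 2 (2 ^ q)]
    have e2 : d ^ ℓ ≤ Fintype.card V := le_trans (pow_le_pow_right₀ hd (by lia)) hV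
    have e3 : (Fintype.card V : ℝ) * d ^ ℓ ≤ (M ^ 2 ^ q) ^ 2 := by
      rw [sq]
      exact mul_le_mul hVM (e2.trans hVM) (by positivity) (by positivity)
    rw [e1]
    calc momentFactor d (2 ^ q) ℓ * Fintype.card V * d ^ (2 ^ q * k)
        = Fintype.card V * d ^ ℓ * d ^ (2 ^ q * k) * (momentFactor d (2 ^ q) ℓ / d ^ ℓ) := by
          field_simp
      _ ≤ _ := by gcongr
  have ht : ∀ k ∈ Icc 1 ℓ, μ.real (Bt k) ≤ momentFactor d (2 ^ q) ℓ / d ^ ℓ := by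
    intro k hk
    rw [mem_Icc] at hk
    refine hmarkov _ _ _ (fun G => by simpa using walkGram_trace_nonneg _ _ 0) (by positivity) ?_
    refine (integral_trace_tangledWalks_le hd hp (m := 2 ^ q) (by positivity) hk.1 hk.2
      (hcost.trans hV)).trans ?_
    calc momentFactor d (2 ^ q) ℓ * d ^ k / Fintype.card V
        ≤ momentFactor d (2 ^ q) ℓ * d ^ ℓ / d ^ (4 * ℓ) := by
          gcongr
          exact hk.2
      _ = _ := by rw [mul_comm 4 ℓ, pow_mul]; field_simp
  calc _ ≤ μ.real (⋃ k ∈ Icc 1 ℓ, Bg k ∪ Bt k) := measureReal_mono hsub (measure_ne_top μ _)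
    _ ≤ ∑ k ∈ Icc 1 ℓ, μ.real (Bg k ∪ Bt k) := measureReal_biUnion_finset_le _ _
    _ ≤ ∑ k ∈ Icc 1 ℓ, 2 * (momentFactor d (2 ^ q) ℓ / d ^ ℓ) := by
      refine sum_le_sum fun k hk => (measureReal_union_le _ _).trans ?_
      have := hg k hk
      have := ht k hk
      linarith
    _ = _ := by
      rw [sum_const, Nat.card_Icc, nsmul_eq_mul, Nat.add_sub_cancel]
      ring

end Probability

section Asymptotics

open Filter Topology

/-- Polynomials in `ℓ` are negligible against `d ^ ℓ`. -/
lemma tendsto_mul_momentFactor {d : ℝ} (hd : 1 < d) {m : ℕ} (hm : m ≠ 0) :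
    Tendsto (fun ℓ : ℕ => ℓ * momentFactor d m ℓ / d ^ ℓ) atTop (𝓝 0) := by
  have hpoly : ∀ s : ℕ, Tendsto (fun ℓ : ℕ => lengthBound m ℓ ^ s / d ^ ℓ) atTop (𝓝 0) := by
    intro s
    have h1 := tendsto_pow_const_div_const_pow_of_one_lt s hd
    have h2 := (h1.const_mul ((1 + 12 * (m : ℝ)) ^ s))
    rw [mul_zero] at h2
    refine squeeze_zero' (Eventually.of_forall fun ℓ => ?_) ?_ h2
    · have := one_le_lengthBound m ℓ
      positivity
    · filter_upwards [eventually_ge_atTop 1] with ℓ hℓ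
      have hℓ' : (1 : ℝ) ≤ ℓ := by exact_mod_cast hℓ
      have := one_le_lengthBound m ℓ
      rw [← mul_div_assoc, ← mul_pow]
      gcongr
      unfold lengthBound
      have : (m : ℝ) * (ℓ + 2) ≤ m * (3 * ℓ) := by gcongr; linarith
      nlinarith
  have h := (hpoly (30 * m + 9)).const_mul ((4 * d * (4 ^ (4 * m + 9) * 3) ^ 10) ^ m *
    ((64 ^ 2) ^ m * 3) ^ 2)
  rw [mul_zero] at h
  have hP : ∀ ℓ, momentFactor d m ℓ = (4 * d * (4 ^ (4 * m + 9) * 3) ^ 10) ^ m *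
    ((64 ^ 2) ^ m * 3) ^ 2 * lengthBound m ℓ ^ (30 * m + 8) := by
    intro ℓ
    unfold momentFactor edgeCost walkConst
    rw [pow_add, pow_mul]
    simp only [mul_pow]
    ring
  refine squeeze_zero (fun ℓ => ?_) (fun ℓ => ?_) h
  · have := one_le_lengthBound m ℓ
    rw [hP]
    positivity
  · have h1 := one_le_lengthBound m ℓ
    have h2 : (ℓ : ℝ) ≤ lengthBound m ℓ := by
      have hm1 : (1 : ℝ) ≤ m := by exact_mod_cast Nat.one_le_iff_ne_zero.2 hm
      have : 1 * ((ℓ : ℝ) + 2) ≤ m * (ℓ + 2) := by gcongr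
      unfold lengthBound
      linarith
    rw [hP, ← mul_div_assoc, show 30 * m + 9 = 30 * m + 8 + 1 from rfl, pow_succ' _ (30 * m + 8),
      mul_left_comm]
    gcongr

lemma edgeCost_le_momentFactor {d : ℝ} (hd : 1 ≤ d) (m ℓ : ℕ) :
    edgeCost m ℓ ≤ momentFactor d m ℓ := by
  have h1 := one_le_edgeCost m ℓ
  have h2 := one_le_walkConst m ℓ (4 * m + 9)
  have h3 : 1 ≤ (4 * d * walkConst (lengthBound m ℓ) (4 * m + 9) ^ 10) ^ m :=
    one_le_pow₀ (one_le_mul_of_one_le_of_one_le (by linarith) (one_le_pow₀ h2))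
  calc edgeCost m ℓ ≤ edgeCost m ℓ ^ 2 := le_self_pow₀ h1 two_ne_zero
    _ ≤ momentFactor d m ℓ := le_mul_of_one_le_left (by positivity) h3

open MeasureTheory in
/-- The length `ℓ` of the walks is chosen as a small multiple of `log n`, namely with
`d ^ (4 * ℓ) ≤ n < d ^ (4 * (ℓ + 1))`: short enough for tangles to be rare, and long enough for the
factor `n` in the bound on the traces to vanish in the `ℓ`-th root. -/
lemma exists_measure_spectralRadius_gt_le {d ε δ : ℝ} (hd : 1 < d) (hε : 0 < ε) (hδ : 0 < δ) :
    ∃ n₀ : ℕ, ∀ n : ℕ, n₀ ≤ n → ∀ p : unitInterval, (p : ℝ) = d / n →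
      (SimpleGraph.binomialRandom (Fin n) p).real {G | ¬ realMatrixSpectralRadius
        (nbAdj (Fin n) * edgeDiag (edgeWeight p G)) ≤ ENNReal.ofReal (Real.sqrt d * (1 + ε))} ≤
        δ := by
  have hd0 : 0 < d := by linarith
  obtain ⟨s, hs⟩ := pow_unbounded_of_one_lt (d ^ 8) (by linarith : 1 < 1 + ε / 2)
  -- the power `2 ^ q` in the trace is so large that `n ^ (1 / 2 ^ q) ≤ (1 + ε / 2) ^ ℓ`
  obtain ⟨q, hq⟩ : ∃ q : ℕ, d ^ 8 ≤ (1 + ε / 2) ^ 2 ^ q :=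
    ⟨s, hs.le.trans (pow_le_pow_right₀ (by linarith) Nat.lt_two_pow_self.le)⟩
  have hT := tendsto_mul_momentFactor hd (m := 2 ^ q) (by positivity)
  have hE1 := hT.eventually_le_const (show 0 < min 1 (δ / 2) by positivity)
  have hE2 := (tendsto_pow_const_div_const_pow_of_one_lt 1 hd).eventually_le_const
    (show (0 : ℝ) < 1 / 2 by norm_num)
  have hratio : 1 < (1 + ε) / (1 + ε / 2) := by rw [one_lt_div (by positivity)]; linarith
  have hE3 := (tendsto_pow_atTop_atTop_of_one_lt hratio).eventually_ge_atTop 2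
  obtain ⟨ℓ₀, hℓ₀⟩ := eventually_atTop.1 (hE1.and (hE2.and hE3))
  have hb : 1 < d ^ 4 := one_lt_pow₀ hd (by norm_num)
  refine ⟨max 2 ⌈(d ^ 4) ^ (max 1 ℓ₀)⌉₊, fun n hn p hp => ?_⟩
  have hn2 : 2 ≤ n := (le_max_left _ _).trans hn
  have hnℓ : (d ^ 4) ^ (max 1 ℓ₀) ≤ n := Nat.ceil_le.1 ((le_max_right _ _).trans hn)
  obtain ⟨ℓ, hℓ1, hℓ2⟩ := exists_nat_pow_near
    (by exact_mod_cast (by lia : 1 ≤ n) : (1 : ℝ) ≤ n) hb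
  have hℓ : max 1 ℓ₀ < ℓ + 1 := (pow_lt_pow_iff_right₀ hb).1 (hnℓ.trans_lt hℓ2)
  have hℓpos : 1 ≤ ℓ := (le_max_left _ _).trans (Nat.lt_succ_iff.1 hℓ)
  obtain ⟨h1, h2, h3⟩ := hℓ₀ ℓ ((le_max_right _ _).trans (Nat.lt_succ_iff.1 hℓ))
  rw [← pow_mul] at hℓ1 hℓ2
  have hnt : Nontrivial (Fin n) := Fin.nontrivial_iff_two_le.2 hn2
  have hcard : (Fintype.card (Fin n) : ℝ) = n := by rw [Fintype.card_fin]
  have hdℓ : 0 < d ^ ℓ := by positivity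
  have hfac : edgeCost (2 ^ q) ℓ ≤ d ^ ℓ := by
    have e1 := edgeCost_le_momentFactor hd.le (2 ^ q) ℓ
    have e2 := (div_le_iff₀ hdℓ).1 (h1.trans (min_le_left _ _))
    have e3 : (1 : ℝ) ≤ ℓ := by exact_mod_cast hℓpos
    have e4 := one_le_edgeCost (2 ^ q) ℓ
    nlinarith
  have hmain := measure_spectralRadius_gt_le (V := Fin n) (p := p) (q := q) (ℓ := ℓ)
    (M := (1 + ε / 2) ^ ℓ) (r := Real.sqrt d * (1 + ε)) hd.le (by rw [hcard, hp]) (by lia)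
    (by rw [hcard]; exact hℓ1) (one_le_pow₀ (by linarith)) ?_
    (hfac.trans (pow_le_pow_right₀ hd.le (by lia))) ?_ (by positivity) ?_
  · refine hmain.trans ?_
    have := h1.trans (min_le_right _ _)
    rw [mul_div_assoc]
    linarith
  · rw [hcard]
    calc (n : ℝ) ≤ d ^ (4 * (ℓ + 1)) := hℓ2.le
      _ ≤ d ^ (8 * ℓ) := pow_le_pow_right₀ hd.le (by lia)
      _ = (d ^ 8) ^ ℓ := pow_mul _ _ _
      _ ≤ ((1 + ε / 2) ^ 2 ^ q) ^ ℓ := by gcongr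
      _ = _ := by rw [← pow_mul, ← pow_mul, mul_comm]
  · rw [pow_one, div_eq_inv_mul] at h2
    linarith
  · rw [div_pow, le_div_iff₀ (by positivity)] at h3
    calc 2 * ((1 + ε / 2) ^ ℓ * Real.sqrt d ^ ℓ) = 2 * (1 + ε / 2) ^ ℓ * Real.sqrt d ^ ℓ := by ring
      _ ≤ (1 + ε) ^ ℓ * Real.sqrt d ^ ℓ := by gcongr
      _ = _ := by rw [mul_pow, mul_comm]

end Asymptotics

lemma centeredNonBacktrackingMatrix_eq {d : ℝ} {n : ℕ} {p : unitInterval} (hp : (p : ℝ) = d / n)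
    (G : SimpleGraph (Fin n)) :
    centeredNonBacktrackingMatrix d n G = nbAdj (Fin n) * edgeDiag (edgeWeight p G) := by
  rw [← nonBacktrackingMatrix_eq, centeredNonBacktrackingMatrix]
  congr 1
  ext i j
  rw [SimpleGraph.adjMatrix_apply, edgeWeight, hp]
  by_cases h : G.Adj i j <;> simp [h]

end

end NonBacktracking

theorem mainTheorem7 (d : ℝ) (hd : 1 < d) (ε : ℝ) (hε : 0 < ε) :
    Filter.Tendsto
      (fun n : ℕ => SimpleGraph.binomialRandom (Fin n) (edgeProb d n)
        {G : SimpleGraph (Fin n) |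
          realMatrixSpectralRadius (centeredNonBacktrackingMatrix d n G) ≤
            ENNReal.ofReal (Real.sqrt d * (1 + ε))})
      Filter.atTop (nhds 1) := by
  rw [← ENNReal.tendsto_toReal_iff (fun n => MeasureTheory.measure_ne_top _ _) ENNReal.one_ne_top,
    ENNReal.toReal_one, Metric.tendsto_atTop]
  intro δ hδ
  obtain ⟨n₀, hn₀⟩ := NonBacktracking.exists_measure_spectralRadius_gt_le hd hε (half_pos hδ)
  refine ⟨max n₀ ⌈d⌉₊, fun n hn => ?_⟩
  have hp : (edgeProb d n : ℝ) = d / n :=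
    edgeProb_coe (by linarith) (Nat.ceil_le.1 ((le_max_right _ _).trans hn))
  have h := hn₀ n ((le_max_left _ _).trans hn) _ hp
  simp only [← NonBacktracking.centeredNonBacktrackingMatrix_eq hp] at h
  set S := {G : SimpleGraph (Fin n) | realMatrixSpectralRadius
    (centeredNonBacktrackingMatrix d n G) ≤ ENNReal.ofReal (Real.sqrt d * (1 + ε))}
  have hcompl := MeasureTheory.probReal_compl_eq_one_sub
    (μ := SimpleGraph.binomialRandom (Fin n) (edgeProb d n)) (s := S) (Set.toFinite S).measurableSet
  have hle : (SimpleGraph.binomialRandom (Fin n) (edgeProb d n)).real Sᶜ ≤ δ / 2 := h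
  have hone := MeasureTheory.measureReal_le_one
    (μ := SimpleGraph.binomialRandom (Fin n) (edgeProb d n)) (s := S)
  rw [Real.dist_eq, abs_lt]
  change -δ < (SimpleGraph.binomialRandom (Fin n) (edgeProb d n)).real S - 1 ∧
    (SimpleGraph.binomialRandom (Fin n) (edgeProb d n)).real S - 1 < δ
  constructor <;> linarith
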